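/- Let $q\ge 1$ be an integer and let $\alpha,\beta\in\left(1-\tfrac1{2q},\,1\right)$. For $\gamma\in(0,1)$ write $R_\gamma(s,t)=\tfrac12\left(s^{2\gamma}+t^{2\gamma}-|s-t|^{2\gamma}\right)$, $s,t\in[0,1]$. Let $W=(W_{s,t})_{(s,t)\in[0,1]^2}$ be a fractional Brownian sheet with Hurst indices $(\alpha,\beta)$ on a probability space $(\Omega,\mathcal F,P)$, that is, a centered Gaussian process, zero on the axes $\{s=0\}\cup\{t=0\}$, with $\mathbb E[W_{s_1,t_1}W_{s_2,t_2}]=R_\alpha(s_1,s_2)R_\beta(t_1,t_2)$. Let $\mathcal H$ be its canonical Hilbert space, the completion of the span of the indicators $\mathbf 1_{[0,s]\times[0,t]}$ for the scalar product $\langle \mathbf 1_{[0,s_1]\times[0,t_1]},\mathbf 1_{[0,s_2]\times[0,t_2]}\rangle=R_\alpha(s_1,s_2)R_\beta(t_1,t_2)$; let $\varphi\mapsto W(\varphi)$ be the linear isometry $\mathcal H\to L^2(\Omega)$ with $W(\mathbf 1_{[0,s]\times[0,t]})=W_{s,t}$; and let $I_q$ be the multiple integral, the continuous linear map from the symmetric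 tensors in $\mathcal H^{\otimes q}$ to $L^2(\Omega)$ with $I_q(\varphi^{\otimes q})=q!\,H_q(W(\varphi))$ for $\|\varphi\|=1$, where $H_q(x)=\frac{(-1)^q}{q!}e^{x^2/2}\frac{d^q}{dx^q}e^{-x^2/2}$. Put $\kappa_\gamma=\dfrac{\gamma^q(2\gamma-1)^q}{(\gamma q-q+1)(2\gamma q-2q+1)}$ and, for $(s,t)\in[0,1]^2$, $$h_{N,M}(s,t)=\frac1{q!}\sqrt{\frac{q!}{\kappa_\alpha\kappa_\beta}}\,N^{q-1}M^{q-1}\sum_{i=0}^{\lfloor (N-1)s\rfloor}\ \sum_{j=0}^{\lfloor (M-1)t\rfloor}\mathbf 1_{[\frac iN,\frac{i+1}N]\times[\frac jM,\frac{j+1}M]}^{\otimes q}.$$ Then $h_{N,M}(s,t)$ converges in $\mathcal H^{\otimes q}$ as $N,M\to\infty$ to a limit $\mu^{(q)}_{s,t}$, and the Hermite sheet of order $q$, $Z^{(q)}_{s,t}=I_q\big(\mu^{(q)}_{s,t}\big)$, $(s,t)\in[0,1]^2$, is well defined. Set $H_1=q(\alpha-1)+1$ and $H_2=q(\beta-1)+1$;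 these lie in $(0,1)$. The Hermite sheet has the following properties. (a) It is centered and square integrable, and $\mathbb E\big[Z^{(q)}_{s,t}Z^{(q)}_{u,v}\big]=R_{H_1}(s,u)\,R_{H_2}(t,v)$ for all $s,t,u,v\in[0,1]$. Consequently it has the same covariance as a fractional Brownian sheet with Hurst indices $(H_1,H_2)$. (b) It is self-similar: for all $c,d>0$ the processes $Z^{(q)}_{cs,dt}$ and $c^{H_1}d^{H_2}Z^{(q)}_{s,t}$ have the same finite-dimensional laws, at all points $(s,t)$ for which both $(s,t)$ and $(cs,dt)$ lie in $[0,1]^2$. (c) It has stationary increments: for every $n$ and all $(s_1,t_1),\dots,(s_n,t_n)\in[0,1]^2$ the joint law of the rectangular increments $$Z^{(q)}_{s+s_k,t+t_k}-Z^{(q)}_{s,t+t_k}-Z^{(q)}_{s+s_k,t}+Z^{(q)}_{s,t},\qquad k=1,\dots,n,$$ does not depend on $(s,t)\in[0,1]^2$, as long as all the points involved lie in $[0,1]^2$. (d) Its paths are Hölder continuous of every order $(a,b)$ with $0<a<H_1$ and $0<b<H_2$: there is a modification $\tilde Z$ of $Z^{(q)}$ such that for every $\omega$ and all such $(a,b)$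 there is a finite constant $C$ with, for all $s,s',t,t'\in[0,1]$, $$\big|\tilde Z_{s',t'}-\tilde Z_{s,t'}-\tilde Z_{s',t}+\tilde Z_{s,t}\big|\le C|s-s'|^{a}|t-t'|^{b},\qquad \big|\tilde Z_{s,t}-\tilde Z_{s',t'}\big|\le C\big(|s-s'|^{a}+|t-t'|^{b}\big).$$ -/

import Mathlib

open MeasureTheory ProbabilityTheory Set Filter Topology
open scoped unitInterval

noncomputable section

namespace HermiteSheet

/-- The covariance `R_γ(s,t) = (s^{2γ} + t^{2γ} - |s-t|^{2γ})/2` of the fractional Brownian motion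
with Hurst index `γ`, for `s, t ≥ 0`. -/
def fbmCov (γ s t : ℝ) : ℝ := (s ^ (2 * γ) + t ^ (2 * γ) - |s - t| ^ (2 * γ)) / 2

/-! ### Positive definiteness of the fractional covariance

`C · |x|^{2γ} = ∫₀^∞ (1 - cos(x u)) u^{-1-2γ} du` shows that `R_γ` is a positive semidefinite
kernel; this is what makes the canonical Hilbert space below well defined. -/

/-- The integrand `(1 - cos(x u)) u^{-1-2γ}`. -/
def spectralDensity (γ x u : ℝ) : ℝ := (1 - Real.cos (x * u)) * u ^ (-1 - 2 * γ)

theorem spectralDensity_nonneg {γ x u : ℝ} (hu : 0 < u) : 0 ≤ spectralDensity γ x u :=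
  mul_nonneg (by linarith [Real.cos_le_one (x * u)]) (Real.rpow_nonneg hu.le _)

theorem spectralDensity_integrable {γ : ℝ} (h : γ ∈ Ioo (0 : ℝ) 1) (x : ℝ) :
    IntegrableOn (spectralDensity γ x) (Ioi 0) := by
  have hm : Measurable (spectralDensity γ x) := by unfold spectralDensity; fun_prop
  rw [← Ioc_union_Ioi_eq_Ioi (zero_le_one' ℝ)]
  refine IntegrableOn.union ?_ ?_
  · have h1 : IntegrableOn (fun u : ℝ => x ^ 2 / 2 * u ^ (1 - 2 * γ)) (Ioc 0 1) :=
      ((intervalIntegrable_iff_integrableOn_Ioc_of_le zero_le_one).1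
        (intervalIntegral.intervalIntegrable_rpow' (by linarith [h.2]))).const_mul _
    refine h1.mono' hm.aestronglyMeasurable ?_
    refine (ae_restrict_mem measurableSet_Ioc).mono fun u hu => ?_
    rw [Real.norm_of_nonneg (spectralDensity_nonneg hu.1)]
    have e : u ^ (1 - 2 * γ) = u ^ 2 * u ^ (-1 - 2 * γ) := by
      rw [← Real.rpow_natCast, ← Real.rpow_add hu.1]; congr 1; push_cast; ring
    rw [e, ← mul_assoc]
    refine mul_le_mul_of_nonneg_right ?_ (Real.rpow_nonneg hu.1.le _)
    have := Real.one_sub_sq_div_two_le_cos (x := x * u)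
    nlinarith
  · have h1 : IntegrableOn (fun u : ℝ => 2 * u ^ (-1 - 2 * γ)) (Ioi 1) :=
      (integrableOn_Ioi_rpow_of_lt (by linarith [h.1]) zero_lt_one).const_mul _
    refine h1.mono' hm.aestronglyMeasurable ?_
    refine (ae_restrict_mem measurableSet_Ioi).mono fun u hu => ?_
    have hu0 : (0 : ℝ) < u := lt_trans zero_lt_one hu
    rw [Real.norm_of_nonneg (spectralDensity_nonneg hu0)]
    exact mul_le_mul_of_nonneg_right (by linarith [Real.neg_one_le_cos (x * u)])
      (Real.rpow_nonneg hu0.le _)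

theorem spectralDensity_integral {γ : ℝ} (h : γ ∈ Ioo (0 : ℝ) 1) (x : ℝ) :
    ∫ u in Ioi 0, spectralDensity γ x u = |x| ^ (2 * γ) * ∫ u in Ioi 0, spectralDensity γ 1 u := by
  rcases eq_or_ne x 0 with rfl | hx
  · have := h.1
    simp [spectralDensity, Real.zero_rpow (by positivity : (2 * γ) ≠ 0)]
  have hx' : 0 < |x| := abs_pos.2 hx
  have key := integral_comp_mul_left_Ioi (spectralDensity γ 1) 0 hx'
  rw [mul_zero, smul_eq_mul] at key
  have e : ∫ u in Ioi 0, spectralDensity γ x u = ∫ u in Ioi 0, |x| ^ (1 + 2 * γ) * spectralDensity γ 1 (|x| * u) := by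
    refine setIntegral_congr_fun measurableSet_Ioi fun u hu => ?_
    have hc : Real.cos (1 * (|x| * u)) = Real.cos (x * u) := by
      rw [one_mul, ← Real.cos_abs (x * u), abs_mul, abs_of_pos (show (0 : ℝ) < u from hu)]
    simp only [spectralDensity, hc]
    rw [Real.mul_rpow hx'.le (le_of_lt hu),
      show |x| ^ (1 + 2 * γ) * ((1 - Real.cos (x * u)) * (|x| ^ (-1 - 2 * γ) * u ^ (-1 - 2 * γ)))
        = (|x| ^ (1 + 2 * γ) * |x| ^ (-1 - 2 * γ)) * ((1 - Real.cos (x * u)) * u ^ (-1 - 2 * γ))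
        by ring, ← Real.rpow_add hx', show 1 + 2 * γ + (-1 - 2 * γ) = 0 by ring]
    simp
  rw [e, integral_const_mul, key, ← mul_assoc, ← Real.rpow_neg_one, ← Real.rpow_add hx']
  congr 2; ring

theorem spectralDensity_integral_pos {γ : ℝ} (h : γ ∈ Ioo (0 : ℝ) 1) : 0 < ∫ u in Ioi 0, spectralDensity γ 1 u := by
  rw [setIntegral_pos_iff_support_of_nonneg_ae]
  · have hsub : Ioo (0 : ℝ) 1 ⊆ Function.support (spectralDensity γ 1) ∩ Ioi 0 := by
      intro u hu
      refine ⟨?_, hu.1⟩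
      have h1 : Real.cos u < 1 := by
        have := Real.cos_lt_cos_of_nonneg_of_le_pi (le_refl 0) (by linarith [hu.2, Real.pi_gt_three] : u ≤ Real.pi) hu.1
        simpa using this
      have h2 := Real.rpow_pos_of_pos hu.1 (-1 - 2 * γ)
      have : 0 < spectralDensity γ 1 u := by
        unfold spectralDensity; rw [one_mul]; exact mul_pos (by linarith) h2
      exact this.ne'
    refine lt_of_lt_of_le ?_ (measure_mono hsub)
    simp
  · exact (ae_restrict_mem measurableSet_Ioi).mono fun u hu => spectralDensity_nonneg hu
  · exact spectralDensity_integrable h 1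

/-- The extension of `fbmCov` to all real times. -/
def fbmCovAbs (γ s t : ℝ) : ℝ :=
  (|s| ^ (2 * γ) + |t| ^ (2 * γ) - |s - t| ^ (2 * γ)) / 2

theorem fbmCov_abs_posSemidef {γ : ℝ} (h : γ ∈ Ioo (0 : ℝ) 1) :
    (Matrix.of (fbmCovAbs γ)).PosSemidef := by
  refine ⟨by ext s t; simp [fbmCovAbs, abs_sub_comm s t, add_comm], fun c => ?_⟩
  have hC := spectralDensity_integral_pos h
  set C := ∫ u in Ioi 0, spectralDensity γ 1 u with hCdef
  let k : ℝ → ℝ → ℝ → ℝ := fun s t u => (spectralDensity γ s u + spectralDensity γ t u - spectralDensity γ (s - t) u) / 2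
  have hk : ∀ s t, IntegrableOn (k s t) (Ioi 0) := fun s t =>
    (((spectralDensity_integrable h s).add (spectralDensity_integrable h t)).sub (spectralDensity_integrable h (s - t))).div_const 2
  have hK : ∀ s t, C * fbmCovAbs γ s t = ∫ u in Ioi 0, k s t u := by
    intro s t
    simp only [k]
    rw [integral_div, integral_sub (f := fun u => spectralDensity γ s u + spectralDensity γ t u)
        ((spectralDensity_integrable h s).add (spectralDensity_integrable h t)) (spectralDensity_integrable h _), integral_add (spectralDensity_integrable h s) (spectralDensity_integrable h t), spectralDensity_integral h s, spectralDensity_integral h t,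
      spectralDensity_integral h (s - t), ← hCdef, fbmCovAbs]
    ring
  have hsum : C * (c.sum fun s a => c.sum fun t b => star a * Matrix.of (fbmCovAbs γ) s t * b)
      = ∫ u in Ioi 0, ∑ s ∈ c.support, ∑ t ∈ c.support, c s * k s t u * c t := by
    rw [integral_finsetSum _ fun s _ => integrable_finsetSum _ fun t _ =>
      ((hk s t).const_mul _).mul_const _]
    simp only [Finsupp.sum, Finset.mul_sum]
    refine Finset.sum_congr rfl fun s _ => ?_
    rw [integral_finsetSum _ fun t _ => ((hk s t).const_mul _).mul_const _]
    refine Finset.sum_congr rfl fun t _ => ?_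
    rw [integral_mul_const, integral_const_mul, ← hK]
    simp only [star_trivial, Matrix.of_apply]; ring
  refine nonneg_of_mul_nonneg_right (a := C) ?_ hC
  rw [hsum]
  refine setIntegral_nonneg measurableSet_Ioi fun u hu => ?_
  have e : ∑ s ∈ c.support, ∑ t ∈ c.support, c s * k s t u * c t
      = ((∑ s ∈ c.support, c s * (1 - Real.cos (s * u))) ^ 2
        + (∑ s ∈ c.support, c s * Real.sin (s * u)) ^ 2) * u ^ (-1 - 2 * γ) / 2 := by
    rw [sq, sq, Finset.sum_mul_sum, Finset.sum_mul_sum, ← Finset.sum_add_distrib, Finset.sum_mul,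
      Finset.sum_div]
    refine Finset.sum_congr rfl fun s _ => ?_
    rw [← Finset.sum_add_distrib, Finset.sum_mul, Finset.sum_div]
    refine Finset.sum_congr rfl fun t _ => ?_
    simp only [k, spectralDensity, sub_mul, Real.cos_sub]
    ring
  rw [e]
  have := Real.rpow_nonneg (le_of_lt hu) (-1 - 2 * γ)
  positivity

theorem fbmCov_posSemidef {γ : ℝ} (h : γ ∈ Ioo (0 : ℝ) 1) :
    (Matrix.of fun s t : I => fbmCov γ s t).PosSemidef := by
  convert (fbmCov_abs_posSemidef h).submatrix ((↑) : I → ℝ) using 1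
  ext s t
  simp [fbmCov, fbmCovAbs, abs_of_nonneg s.2.1, abs_of_nonneg t.2.1]

/-- A real positive semidefinite kernel, seen as an operator-valued one acting on `ℝ` by scalars. -/
def opKernel {X : Type*} (k : Matrix X X ℝ) : Matrix X X (ℝ →L[ℝ] ℝ) :=
  Matrix.of fun x y => k x y • ContinuousLinearMap.id ℝ ℝ

theorem opKernel_posSemidef {X : Type*} {k : Matrix X X ℝ} (hk : k.PosSemidef) :
    (opKernel k).PosSemidef := by
  have tfae := RKHS.posSemidef_tfae (𝕜 := ℝ) (K := opKernel k)
  refine (tfae.out 0 2 rfl rfl).2 ⟨?_, fun c => ?_⟩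
  · ext x y
    have := hk.1.apply x y
    simp only [star_trivial] at this
    simp [opKernel, Matrix.conjTranspose_apply, ← this,
      show ContinuousLinearMap.id ℝ ℝ = 1 from rfl]
  · have h := hk.2 c
    rw [Finsupp.sum_comm] at h
    simpa [opKernel, mul_comm, mul_left_comm, mul_assoc] using h

/-! ### The canonical Hilbert space of the fractional Brownian sheet -/

/-- Hurst indices. -/
abbrev Hurst : Type := Ioo (0 : ℝ) 1

/-- The covariance `R_α(s₁,s₂) R_β(t₁,t₂)` of the fractional Brownian sheet on `[0,1]²`. -/
def sheetKernel (α β : Hurst) : Matrix (I × I) (I × I) ℝ :=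
  Matrix.of fun p r => fbmCov α p.1 r.1 * fbmCov β p.2 r.2

theorem sheetKernel_posSemidef (α β : Hurst) : (sheetKernel α β).PosSemidef := by
  exact ((fbmCov_posSemidef α.2).submatrix (Prod.fst : I × I → I)).hadamard
    ((fbmCov_posSemidef β.2).submatrix (Prod.snd : I × I → I))

instance (α β : Hurst) : Fact (opKernel (sheetKernel α β)).PosSemidef :=
  ⟨opKernel_posSemidef (sheetKernel_posSemidef α β)⟩

/-- The canonical Hilbert space `ℋ^{α,β}`: the completion of the linear span of the symbols
`1_{[0,s]×[0,t]}`, `(s,t) ∈ [0,1]²`, for the scalar product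
`⟨1_{[0,s₁]×[0,t₁]}, 1_{[0,s₂]×[0,t₂]}⟩ = R_α(s₁,s₂) R_β(t₁,t₂)`. -/
abbrev CanonicalSpace (α β : Hurst) : Type := RKHS.OfKernel (opKernel (sheetKernel α β))

/-- The element `1_{[0,s]×[0,t]}` of `ℋ^{α,β}`. -/
def box (α β : Hurst) (p : I × I) : CanonicalSpace α β :=
  RKHS.kerFun (CanonicalSpace α β) p (1 : ℝ)

theorem inner_box (α β : Hurst) (p r : I × I) :
    inner ℝ (box α β p) (box α β r) = fbmCov α p.1 r.1 * fbmCov β p.2 r.2 := by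
  have := RKHS.kernel_inner (CanonicalSpace α β) r p (1 : ℝ) (1 : ℝ)
  rw [RKHS.OfKernel.kernel_ofKernel] at this
  rw [box, box, ← this]
  have h := (sheetKernel_posSemidef α β).1.apply p r
  simp only [star_trivial, sheetKernel, Matrix.of_apply] at h
  simp [opKernel, sheetKernel, h]

/-- The element `1_{[s₁,s₂]×[t₁,t₂]}` of `ℋ^{α,β}`, for `0 ≤ s₁ ≤ s₂ ≤ 1` and `0 ≤ t₁ ≤ t₂ ≤ 1`
(the coordinates are projected onto `[0,1]`, which does not change them in this range). -/
def rect (α β : Hurst) (s₁ s₂ t₁ t₂ : ℝ) : CanonicalSpace α β :=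
  let x : ℝ → I := projIcc 0 1 zero_le_one
  box α β (x s₂, x t₂) - box α β (x s₁, x t₂) - box α β (x s₂, x t₁) + box α β (x s₁, x t₁)

/-! ### Hilbert tensor powers -/

/-- The kernel `⟨x₁ ⊗ ⋯ ⊗ x_q, y₁ ⊗ ⋯ ⊗ y_q⟩ = ∏ ⟨x_k, y_k⟩`. -/
def tensorKernel (E : Type*) [NormedAddCommGroup E] [InnerProductSpace ℝ E] (q : ℕ) :
    Matrix (Fin q → E) (Fin q → E) ℝ :=
  Matrix.of fun x y => ∏ k, inner ℝ (x k) (y k)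

theorem innerKernel_posSemidef (E : Type*) [NormedAddCommGroup E] [InnerProductSpace ℝ E] :
    (Matrix.of fun x y : E => inner ℝ x y).PosSemidef := by
  refine ⟨by ext x y; simp [real_inner_comm], fun c => ?_⟩
  have h : (c.sum fun x a => c.sum fun y b => star a * (Matrix.of fun x y : E => inner ℝ x y) x y * b)
      = inner ℝ (c.sum fun x a => a • x) (c.sum fun x a => a • x) := by
    simp only [Finsupp.sum, sum_inner, inner_sum, real_inner_smul_left, real_inner_smul_right]
    refine Finset.sum_congr rfl fun x _ => Finset.sum_congr rfl fun y _ => ?_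
    simp only [star_trivial, Matrix.of_apply, real_inner_comm x y]; ring
  rw [h]
  exact real_inner_self_nonneg

theorem tensorKernel_posSemidef (E : Type*) [NormedAddCommGroup E] [InnerProductSpace ℝ E]
    (q : ℕ) : (tensorKernel E q).PosSemidef := by
  classical
  have key : ∀ S : Finset (Fin q),
      (Matrix.of fun x y : Fin q → E => ∏ k ∈ S, inner ℝ (x k) (y k)).PosSemidef := by
    intro S
    induction S using Finset.induction_on with
    | empty =>
      refine ⟨by ext; simp, fun c => ?_⟩
      have h : (c.sum fun x a => c.sum fun y b => star a *
          (Matrix.of fun x y : Fin q → E => ∏ k ∈ (∅ : Finset (Fin q)), inner ℝ (x k) (y k)) x y * b)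
          = (∑ x ∈ c.support, c x) ^ 2 := by
        simp [Finsupp.sum, sq, Finset.sum_mul_sum]
      rw [h]; positivity
    | insert a S ha ih =>
      have e : (Matrix.of fun x y : Fin q → E => ∏ k ∈ insert a S, inner ℝ (x k) (y k)) =
          ((Matrix.of fun x y : E => inner ℝ x y).submatrix (fun x : Fin q → E => x a)
            (fun x : Fin q → E => x a)).hadamard
            (Matrix.of fun x y : Fin q → E => ∏ k ∈ S, inner ℝ (x k) (y k)) := by
        ext x y
        simp [Finset.prod_insert ha]
      rw [e]
      exact ((innerKernel_posSemidef E).submatrix fun x : Fin q → E => x a).hadamard ih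
  exact key Finset.univ

instance (E : Type*) [NormedAddCommGroup E] [InnerProductSpace ℝ E] (q : ℕ) :
    Fact (opKernel (tensorKernel E q)).PosSemidef :=
  ⟨opKernel_posSemidef (tensorKernel_posSemidef E q)⟩

/-- The Hilbert space tensor power `E^{⊗q}`: the completion of the span of the elementary tensors
`x₁ ⊗ ⋯ ⊗ x_q` for `⟨x₁ ⊗ ⋯ ⊗ x_q, y₁ ⊗ ⋯ ⊗ y_q⟩ = ∏ ⟨x_k, y_k⟩`. -/
abbrev TensorPower (E : Type*) [NormedAddCommGroup E] [InnerProductSpace ℝ E] (q : ℕ) : Type _ :=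
  RKHS.OfKernel (opKernel (tensorKernel E q))

/-- The elementary tensor `x₁ ⊗ ⋯ ⊗ x_q`. -/
def elemTensor {E : Type*} [NormedAddCommGroup E] [InnerProductSpace ℝ E] {q : ℕ}
    (x : Fin q → E) : TensorPower E q :=
  RKHS.kerFun (TensorPower E q) x (1 : ℝ)

theorem inner_elemTensor {E : Type*} [NormedAddCommGroup E] [InnerProductSpace ℝ E] {q : ℕ}
    (x y : Fin q → E) :
    inner ℝ (elemTensor x) (elemTensor y) = ∏ k, inner ℝ (x k) (y k) := by
  have := RKHS.kernel_inner (TensorPower E q) y x (1 : ℝ) (1 : ℝ)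
  rw [RKHS.OfKernel.kernel_ofKernel] at this
  rw [elemTensor, elemTensor, ← this]
  have h := (tensorKernel_posSemidef E q).1.apply x y
  simp only [star_trivial, tensorKernel, Matrix.of_apply] at h
  simp [opKernel, tensorKernel, h]

/-- The tensor power `x^{⊗q}` of one vector. -/
def tensorPow {E : Type*} [NormedAddCommGroup E] [InnerProductSpace ℝ E] (q : ℕ) (x : E) :
    TensorPower E q :=
  elemTensor fun _ => x

/-! ### The fractional Brownian sheet and multiple integrals -/

/-- `W` is, on `[0,1]²`, a fractional Brownian sheet with Hurst indices `(α,β) ∈ (0,1)²`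
(the values of `W` outside `[0,1]²` are irrelevant). -/
structure IsFractionalBrownianSheet {Ω : Type*} [MeasurableSpace Ω] (α β : ℝ)
    (W : ℝ → ℝ → Ω → ℝ) (P : Measure Ω) : Prop where
  hurst_fst : α ∈ Ioo (0 : ℝ) 1
  hurst_snd : β ∈ Ioo (0 : ℝ) 1
  gaussian : IsGaussianProcess (fun p : I × I => W p.1 p.2) P
  centered : ∀ s ∈ I, ∀ t ∈ I, ∫ ω, W s t ω ∂P = 0
  axes : ∀ s ∈ I, ∀ t ∈ I, s = 0 ∨ t = 0 → W s t =ᵐ[P] 0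
  covariance : ∀ s₁ ∈ I, ∀ t₁ ∈ I, ∀ s₂ ∈ I, ∀ t₂ ∈ I,
    ∫ ω, W s₁ t₁ ω * W s₂ t₂ ω ∂P = fbmCov α s₁ s₂ * fbmCov β t₁ t₂

/-- The graph of the isometry `φ ↦ W(φ)` from `ℋ^{α,β}` to `L²(Ω)`, that is the continuous linear
extension of `1_{[0,s]×[0,t]} ↦ W_{s,t}`. -/
def wienerGraph {Ω : Type*} [MeasurableSpace Ω] (α β : Hurst) (W : ℝ → ℝ → Ω → ℝ)
    (P : Measure Ω) : Submodule ℝ (CanonicalSpace α β × Lp ℝ 2 P) :=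
  (Submodule.span ℝ {x : CanonicalSpace α β × Lp ℝ 2 P |
    ∃ p : I × I, x.1 = box α β p ∧ x.2 =ᵐ[P] W p.1 p.2}).topologicalClosure

/-- The Hermite polynomial `H_n(x) = ((-1)^n / n!) e^{x²/2} (d/dx)^n e^{-x²/2}`. -/
def hermitePoly (n : ℕ) (x : ℝ) : ℝ :=
  (n.factorial : ℝ)⁻¹ * Polynomial.aeval x (Polynomial.hermite n)

/-- The graph of the multiple integral `I_q` from the symmetric tensors (the closed linear span of
the `φ^{⊗q}`) to `L²(Ω)`, that is the continuous linear extension of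
`φ^{⊗q} ↦ q! H_q(W(φ))`, `‖φ‖ = 1`. -/
def multipleIntegralGraph {Ω : Type*} [MeasurableSpace Ω] (α β : Hurst) (q : ℕ)
    (W : ℝ → ℝ → Ω → ℝ) (P : Measure Ω) :
    Submodule ℝ (TensorPower (CanonicalSpace α β) q × Lp ℝ 2 P) :=
  (Submodule.span ℝ {x : TensorPower (CanonicalSpace α β) q × Lp ℝ 2 P |
    ∃ (φ : CanonicalSpace α β) (F : Lp ℝ 2 P), (φ, F) ∈ wienerGraph α β W P ∧ ‖φ‖ = 1 ∧
      x.1 = tensorPow q φ ∧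
      x.2 =ᵐ[P] fun ω => (q.factorial : ℝ) * hermitePoly q (F ω)}).topologicalClosure

/-! ### The Hermite sheet -/

/-- `κ_γ = γ^q (2γ-1)^q / ((γq-q+1)(2γq-2q+1))`. -/
def kappa (q : ℕ) (γ : ℝ) : ℝ :=
  γ ^ q * (2 * γ - 1) ^ q / ((γ * q - q + 1) * (2 * γ * q - 2 * q + 1))

/-- The normalization `√(q!/(κ_α κ_β)) N^{q-1} M^{q-1}`. -/
def normalization (q : ℕ) (α β : ℝ) (N M : ℕ) : ℝ :=
  √(q.factorial / (kappa q α * kappa q β)) * (N : ℝ) ^ (q - 1) * (M : ℝ) ^ (q - 1)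

/-- The kernel `h_{N,M}(s,t) = (1/q!) φ(α,β,N,M) ∑_{i=0}^{[(N-1)s]} ∑_{j=0}^{[(M-1)t]}
1_{[i/N,(i+1)/N]×[j/M,(j+1)/M]}^{⊗q}`. -/
def approxKernel (α β : Hurst) (q : ℕ) (s t : ℝ) (N M : ℕ) :
    TensorPower (CanonicalSpace α β) q :=
  ((q.factorial : ℝ)⁻¹ * normalization q α β N M) •
    ∑ i ∈ Finset.range (⌊((N : ℝ) - 1) * s⌋₊ + 1), ∑ j ∈ Finset.range (⌊((M : ℝ) - 1) * t⌋₊ + 1),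
      tensorPow q (rect α β (i / N) ((i + 1) / N) (j / M) ((j + 1) / M))

/-- `Z` is the Hermite sheet of order `q` driven by `W`: for `(s,t) ∈ [0,1]²`,
`Z_{s,t} = I_q(μ_{s,t})` almost surely, where `μ_{s,t}` is the limit of `h_{N,M}(s,t)` in the
`q`-th tensor power of `ℋ^{α,β}` as `N, M → ∞`. -/
def IsHermiteSheet {Ω : Type*} [MeasurableSpace Ω] (α β : Hurst) (q : ℕ)
    (W : ℝ → ℝ → Ω → ℝ) (P : Measure Ω) (Z : ℝ → ℝ → Ω → ℝ) : Prop :=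
  ∀ s ∈ I, ∀ t ∈ I, ∃ (μ : TensorPower (CanonicalSpace α β) q) (F : Lp ℝ 2 P),
    Tendsto (fun n : ℕ × ℕ => approxKernel α β q s t n.1 n.2) (atTop ×ˢ atTop) (𝓝 μ) ∧
    (μ, F) ∈ multipleIntegralGraph α β q W P ∧ Z s t =ᵐ[P] F

/-! ### Properties of two-parameter processes on `[0,1]²` -/

/-- The rectangular increment `x(s₂,t₂) - x(s₁,t₂) - x(s₂,t₁) + x(s₁,t₁)`. -/
def rectIncrement (x : ℝ → ℝ → ℝ) (s₁ s₂ t₁ t₂ : ℝ) : ℝ :=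
  x s₂ t₂ - x s₁ t₂ - x s₂ t₁ + x s₁ t₁

/-- Self-similarity of order `(a,b)`: for `c, d > 0` the processes `X_{cs,dt}` and
`c^a d^b X_{s,t}` have the same finite-dimensional laws, at all points for which `(s,t)` and
`(cs,dt)` lie in `[0,1]²`. -/
def IsSelfSimilar {Ω : Type*} [MeasurableSpace Ω] (a b : ℝ) (X : ℝ → ℝ → Ω → ℝ)
    (P : Measure Ω) : Prop :=
  ∀ c > (0 : ℝ), ∀ d > (0 : ℝ), ∀ (n : ℕ) (s t : Fin n → ℝ),
    (∀ k, s k ∈ I ∧ t k ∈ I ∧ c * s k ∈ I ∧ d * t k ∈ I) →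
    IdentDistrib (fun ω k => X (c * s k) (d * t k) ω)
      (fun ω k => c ^ a * d ^ b * X (s k) (t k) ω) P P

/-- Stationary increments: the joint law of the rectangular increments of `X` over
`[s,s+s_k]×[t,t+t_k]`, `k = 1,…,n`, does not depend on `(s,t)`, as long as these rectangles lie in
`[0,1]²`. -/
def HasStationaryIncrements {Ω : Type*} [MeasurableSpace Ω] (X : ℝ → ℝ → Ω → ℝ)
    (P : Measure Ω) : Prop :=
  ∀ (n : ℕ) (x y : Fin n → ℝ), (∀ k, x k ∈ I ∧ y k ∈ I) →
    ∀ s ∈ I, ∀ t ∈ I, ∀ s' ∈ I, ∀ t' ∈ I,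
      (∀ k, s + x k ∈ I ∧ t + y k ∈ I ∧ s' + x k ∈ I ∧ t' + y k ∈ I) →
      IdentDistrib (fun ω k => rectIncrement (fun u v => X u v ω) s (s + x k) t (t + y k))
        (fun ω k => rectIncrement (fun u v => X u v ω) s' (s' + x k) t' (t' + y k)) P P

/-- Hölder continuity of order `(a,b)` on `[0,1]²`, both for the rectangular increments and for the
increments between two points. -/
def IsHolderOnSquare (a b : ℝ) (x : ℝ → ℝ → ℝ) : Prop :=
  ∃ C : ℝ, ∀ s ∈ I, ∀ s' ∈ I, ∀ t ∈ I, ∀ t' ∈ I,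
    |rectIncrement x s s' t t'| ≤ C * (|s - s'| ^ a * |t - t'| ^ b) ∧
    |x s t - x s' t'| ≤ C * (|s - s'| ^ a + |t - t'| ^ b)

end HermiteSheet

end

/-! Everything is read off from scalar products of kernels built on grids. For two grids the scalar
product of the sums of `q`-th tensor powers factors over the two coordinates, and each factor is a
normalized sum of `q`-th powers of covariances of fractional Brownian increments over cells
(`inner_gridKernel`). Since γ > 1/2, such a covariance is γ(2γ-1) times the integral of |x-y|^{2γ-2}
over the product of two cells. The normalized sum is therefore a Riemann sum for (γ(2γ-1))^q ∬
|x-y|^{-q(2-2γ)}, and γ > 1 - 1/(2q) is precisely the integrability of this kernel. It is bounded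
above cell by cell by the power mean inequality, and below by the kernel (|x-y|+ε)^{-q(2-2γ)} with ε
the sum of the meshes; both bounds have the same limit, namely κ_γ times an increment covariance of
index H = q(γ-1)+1 (`tendsto_gridSum`).

So all Gram matrices of grid kernels converge, and the limits depend only on the underlying
rectangles. Hence grid kernels are Cauchy, their limit does not depend on the grids, it is additive
over rectangles, and its scalar products are 1/q! times the covariances of a fractional Brownian
sheet of indices (H₁,H₂). The isometry E[I_q(f)I_q(g)] = q!⟨f,g⟩ gives existence and (a).

For (b) and (c), the grids may be chosen freely: with equal numbers of cells on a rectangle and on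
its translated and dilated image, the Gram matrices of the cells differ by one scalar factor,
because fractional Brownian increments are stationary and self-similar. The integrals of the grid
kernels are the same function of two Gaussian vectors, up to the scaling, so their laws correspond
exactly; equality in law passes to L² limits (`identDistrib_gridKernel`,
`identDistrib_limitKernel`).

For (d), all even moments in a fixed chaos are controlled by the second one: E[I_q(f)^{2m}] ≤ (mq)!
2^{mq} ‖f‖^{2m}. This follows from He_q(x) = E(x+iY)^q, Jensen's inequality and Wick's formula, in
which every pairing is bounded by Cauchy–Schwarz (`integral_sum_hermite_pow_le`). The moments of
rectangular increments then feed a two-parameter Kolmogorov criterion on dyadic cells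
(`HasIncrementMoments.exists_modification`). -/

noncomputable section

namespace HermiteSheet

/-! ### The singular kernel `|x - y|^{-τ}` -/

/-- The odd antiderivative of `|z|^{-τ}`. -/
def powPrim (τ z : ℝ) : ℝ := z * |z| ^ (-τ) / (1 - τ)

/-- The even second antiderivative of `|z|^{-τ}`. -/
def powPrimTwo (τ z : ℝ) : ℝ := |z| ^ (2 - τ) / ((1 - τ) * (2 - τ))

/-- `∫_a^b ∫_c^d |x - y|^{-τ}`, in closed form. -/
def rieszRect (τ a b c d : ℝ) : ℝ :=
  powPrimTwo τ (b - c) - powPrimTwo τ (a - c) - powPrimTwo τ (b - d) + powPrimTwo τ (a - d)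

theorem hasDerivAt_powPrimTwo {τ : ℝ} (hτ : τ < 1) (z : ℝ) :
    HasDerivAt (powPrimTwo τ) (powPrim τ z) z := by
  have h := (hasDerivAt_abs_rpow z (p := 2 - τ) (by linarith)).div_const ((1 - τ) * (2 - τ))
  have e : powPrim τ z = (2 - τ) * |z| ^ (2 - τ - 2) * z / ((1 - τ) * (2 - τ)) := by
    rw [powPrim, show 2 - τ - 2 = -τ by ring]
    have h1 : 1 - τ ≠ 0 := by linarith
    have h2 : 2 - τ ≠ 0 := by linarith
    field_simp
  rw [e]
  exact h

theorem continuous_powPrimTwo {τ : ℝ} (hτ : τ < 1) : Continuous (powPrimTwo τ) :=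
  continuous_iff_continuousAt.2 fun z => (hasDerivAt_powPrimTwo hτ z).continuousAt

theorem powPrim_neg (τ z : ℝ) : powPrim τ (-z) = -powPrim τ z := by
  simp [powPrim]; ring

theorem powPrim_of_nonneg {τ z : ℝ} (hτ : τ < 1) (hz : 0 ≤ z) :
    powPrim τ z = z ^ (1 - τ) / (1 - τ) := by
  rcases hz.eq_or_lt with rfl | hz
  · rw [Real.zero_rpow (by linarith), powPrim]; simp
  · rw [powPrim, abs_of_pos hz, show 1 - τ = 1 + -τ by ring, Real.rpow_add hz, Real.rpow_one]

theorem intervalIntegrable_abs_rpow_and_integral {τ : ℝ} (hτ : τ < 1) (v : ℝ) :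
    IntervalIntegrable (fun z : ℝ => |z| ^ (-τ)) volume 0 v ∧
      ∫ z in (0 : ℝ)..v, |z| ^ (-τ) = powPrim τ v := by
  have pos : ∀ v : ℝ, 0 ≤ v → IntervalIntegrable (fun z : ℝ => |z| ^ (-τ)) volume 0 v ∧
      ∫ z in (0 : ℝ)..v, |z| ^ (-τ) = powPrim τ v := by
    intro v hv
    have hE : ∀ z ∈ uIcc 0 v, z ^ (-τ) = |z| ^ (-τ) := by
      intro z hz
      rw [uIcc_of_le hv] at hz
      rw [abs_of_nonneg hz.1]
    have hE' : EqOn (fun z : ℝ => z ^ (-τ)) (fun z : ℝ => |z| ^ (-τ)) (uIoc 0 v) :=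
      fun z hz => hE z (uIoc_subset_uIcc hz)
    refine ⟨(intervalIntegral.intervalIntegrable_rpow' (by linarith)).congr hE', ?_⟩
    rw [← intervalIntegral.integral_congr hE, integral_rpow (Or.inl (by linarith)),
      powPrim_of_nonneg hτ hv, show -τ + 1 = 1 - τ by ring, Real.zero_rpow (by linarith), sub_zero]
  rcases le_total 0 v with hv | hv
  · exact pos v hv
  · obtain ⟨h1, h2⟩ := pos (-v) (by linarith)
    have h3 := (IntervalIntegrable.iff_comp_neg (f := fun z : ℝ => |z| ^ (-τ)) (a := 0) (b := -v)).1 h1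
    simp only [abs_neg, neg_zero, neg_neg] at h3
    refine ⟨h3, ?_⟩
    have h4 := intervalIntegral.integral_comp_neg (a := 0) (b := -v) (fun z : ℝ => |z| ^ (-τ))
    simp only [abs_neg, neg_zero, neg_neg] at h4
    rw [intervalIntegral.integral_symm, ← h4, h2, powPrim_neg, neg_neg]

theorem intervalIntegrable_abs_rpow {τ : ℝ} (hτ : τ < 1) (u v : ℝ) :
    IntervalIntegrable (fun z : ℝ => |z| ^ (-τ)) volume u v :=
  (intervalIntegrable_abs_rpow_and_integral hτ u).1.symm.trans
    (intervalIntegrable_abs_rpow_and_integral hτ v).1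

theorem integral_abs_rpow {τ : ℝ} (hτ : τ < 1) (u v : ℝ) :
    ∫ z in u..v, |z| ^ (-τ) = powPrim τ v - powPrim τ u := by
  rw [← (intervalIntegrable_abs_rpow_and_integral hτ v).2,
    ← (intervalIntegrable_abs_rpow_and_integral hτ u).2,
    intervalIntegral.integral_interval_sub_left (intervalIntegrable_abs_rpow hτ _ _)
      (intervalIntegrable_abs_rpow hτ _ _)]

theorem intervalIntegrable_abs_sub_rpow {τ : ℝ} (hτ : τ < 1) (x c d : ℝ) :
    IntervalIntegrable (fun y : ℝ => |x - y| ^ (-τ)) volume c d := by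
  have := (intervalIntegrable_abs_rpow hτ (x - c) (x - d)).comp_sub_left x
  simpa using this

theorem integral_abs_sub_rpow {τ : ℝ} (hτ : τ < 1) (x c d : ℝ) :
    ∫ y in c..d, |x - y| ^ (-τ) = powPrim τ (x - c) - powPrim τ (x - d) := by
  rw [intervalIntegral.integral_comp_sub_left (fun z : ℝ => |z| ^ (-τ)) x, integral_abs_rpow hτ]

theorem continuous_powPrim {τ : ℝ} (hτ : τ < 1) : Continuous (powPrim τ) := by
  have h : powPrim τ = fun v => ∫ z in (0 : ℝ)..v, |z| ^ (-τ) :=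
    funext fun v => (intervalIntegrable_abs_rpow_and_integral hτ v).2.symm
  rw [h]
  exact intervalIntegral.continuous_primitive (fun a b => intervalIntegrable_abs_rpow hτ a b) 0

theorem integral_powPrim_sub {τ : ℝ} (hτ : τ < 1) (a b c : ℝ) :
    ∫ x in a..b, powPrim τ (x - c) = powPrimTwo τ (b - c) - powPrimTwo τ (a - c) := by
  refine intervalIntegral.integral_eq_sub_of_hasDerivAt
    (f := fun x => powPrimTwo τ (x - c)) (fun x _ => ?_) ?_
  · exact (hasDerivAt_powPrimTwo hτ (x - c)).comp_sub_const x c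
  · exact ((continuous_powPrim hτ).comp (continuous_id.sub continuous_const)).intervalIntegrable _ _

theorem integral_integral_abs_sub_rpow {τ : ℝ} (hτ : τ < 1) (a b c d : ℝ) :
    ∫ x in a..b, ∫ y in c..d, |x - y| ^ (-τ) = rieszRect τ a b c d := by
  have hc : ∀ c, IntervalIntegrable (fun x => powPrim τ (x - c)) volume a b := fun c =>
    ((continuous_powPrim hτ).comp (continuous_id.sub continuous_const)).intervalIntegrable _ _
  simp only [integral_abs_sub_rpow hτ]
  rw [intervalIntegral.integral_sub (hc c) (hc d), integral_powPrim_sub hτ, integral_powPrim_sub hτ,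
    rieszRect]
  ring

/-- The power mean inequality for interval integrals. -/
theorem pow_integral_le {f : ℝ → ℝ} {c d : ℝ} {q : ℕ} (hq : 1 ≤ q) (hcd : c ≤ d)
    (hf0 : ∀ y, 0 ≤ f y) (hf : IntervalIntegrable f volume c d)
    (hfq : IntervalIntegrable (fun y => f y ^ q) volume c d) :
    (∫ y in c..d, f y) ^ q ≤ (d - c) ^ (q - 1) * ∫ y in c..d, f y ^ q := by
  rcases hcd.eq_or_lt with rfl | hcd
  · simp [show q ≠ 0 by omega]
  have hL : 0 < d - c := sub_pos.2 hcd
  set A := ∫ y in c..d, f y with hA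
  have hA0 : 0 ≤ A := intervalIntegral.integral_nonneg hcd.le fun y _ => hf0 y
  set m := A / (d - c) with hm
  have hm0 : 0 ≤ m := by positivity
  -- The tangent line to x^q at the mean m lies below the curve (Bernoulli applied to x/m). Its
  -- linear part integrates to zero against f - m, which gives Jensen's inequality.
  have tang : ∀ x : ℝ, 0 ≤ x → m ^ q + q * m ^ (q - 1) * (x - m) ≤ x ^ q := by
    intro x hx
    rcases hm0.eq_or_lt with h0 | h0
    · rw [← h0]
      rcases (show q = 1 ∨ 2 ≤ q by omega) with rfl | h2
      · simp
      · rw [zero_pow (by omega), zero_pow (by omega)]; simp; positivity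
    · have hb := one_add_mul_le_pow (a := x / m - 1) (by have := div_nonneg hx hm0; linarith) q
      have := mul_le_mul_of_nonneg_left hb (pow_nonneg hm0 q)
      rw [← mul_pow] at this
      have e1 : m * (1 + (x / m - 1)) = x := by field_simp; ring
      rw [e1] at this
      refine le_trans (le_of_eq ?_) this
      obtain ⟨p, rfl⟩ : ∃ p, q = p + 1 := ⟨q - 1, by omega⟩
      simp only [Nat.add_sub_cancel]
      field_simp
      ring
  have hint : IntervalIntegrable (fun y => m ^ q + q * m ^ (q - 1) * (f y - m)) volume c d :=
    intervalIntegrable_const.add ((hf.sub intervalIntegrable_const).const_mul _)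
  have key := intervalIntegral.integral_mono_on hcd.le hint hfq fun y _ => tang (f y) (hf0 y)
  rw [intervalIntegral.integral_add intervalIntegrable_const
    ((hf.sub intervalIntegrable_const).const_mul _), intervalIntegral.integral_const_mul,
    intervalIntegral.integral_sub hf intervalIntegrable_const] at key
  simp only [intervalIntegral.integral_const, smul_eq_mul, ← hA] at key
  have e2 : (d - c) * m = A := by rw [hm]; field_simp
  rw [e2, sub_self, mul_zero, add_zero] at key
  have := mul_le_mul_of_nonneg_left key (pow_nonneg hL.le (q - 1))
  refine le_trans (le_of_eq ?_) this
  rw [← e2, mul_pow]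
  obtain ⟨p, rfl⟩ : ∃ p, q = p + 1 := ⟨q - 1, by omega⟩
  simp only [Nat.add_sub_cancel]
  ring

theorem abs_rpow_neg_pow (z θ : ℝ) (q : ℕ) : (|z| ^ (-θ)) ^ q = |z| ^ (-(q * θ)) := by
  rw [← Real.rpow_mul_natCast (abs_nonneg z)]; congr 1; ring

theorem rieszRect_nonneg {τ : ℝ} (hτ : τ < 1) {a b c d : ℝ} (hab : a ≤ b) (hcd : c ≤ d) :
    0 ≤ rieszRect τ a b c d := by
  rw [← integral_integral_abs_sub_rpow hτ]
  exact intervalIntegral.integral_nonneg hab fun x _ =>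
    intervalIntegral.integral_nonneg hcd fun y _ => by positivity

theorem continuous_integral_abs_sub_rpow {τ : ℝ} (hτ : τ < 1) (c d : ℝ) :
    Continuous fun x => ∫ y in c..d, |x - y| ^ (-τ) := by
  simp only [integral_abs_sub_rpow hτ]
  exact ((continuous_powPrim hτ).comp (continuous_id.sub continuous_const)).sub
    ((continuous_powPrim hτ).comp (continuous_id.sub continuous_const))

/-- The power mean inequality in y and then in x. The exponent of the kernel becomes `q * θ`, which
must stay below 1 for the right side to be a convergent integral. -/
theorem rieszRect_pow_le {θ : ℝ} {q : ℕ} (hq : 1 ≤ q) (hqθ : q * θ < 1)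
    {a b c d : ℝ} (hab : a ≤ b) (hcd : c ≤ d) :
    rieszRect θ a b c d ^ q ≤
      (b - a) ^ (q - 1) * ((d - c) ^ (q - 1) * rieszRect (q * θ) a b c d) := by
  have hθ1 : θ < 1 := by
    have : (1 : ℝ) ≤ q := by exact_mod_cast hq
    nlinarith
  rw [← integral_integral_abs_sub_rpow hθ1, ← integral_integral_abs_sub_rpow hqθ]
  have hcont := continuous_integral_abs_sub_rpow hθ1 c d
  have hcont' := continuous_integral_abs_sub_rpow hqθ c d
  refine (pow_integral_le hq hab (fun x => intervalIntegral.integral_nonneg hcd fun y _ => by positivity)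
    (hcont.intervalIntegrable _ _) ((hcont.pow q).intervalIntegrable _ _)).trans ?_
  refine mul_le_mul_of_nonneg_left ?_ (pow_nonneg (sub_nonneg.2 hab) _)
  rw [← intervalIntegral.integral_const_mul]
  refine intervalIntegral.integral_mono_on hab ((hcont.pow q).intervalIntegrable _ _)
    ((hcont'.intervalIntegrable _ _).const_mul _) fun x _ => ?_
  have h := pow_integral_le hq hcd (f := fun y => |x - y| ^ (-θ)) (fun y => by positivity)
    (intervalIntegrable_abs_sub_rpow hθ1 x c d)
    (by simpa only [abs_rpow_neg_pow] using intervalIntegrable_abs_sub_rpow hqθ x c d)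
  simpa only [abs_rpow_neg_pow] using h

/-! ### A regularization of the kernel, as a lower bound -/

/-- On each half-line the regularization is a shift by ε, so the primitive started at 0 loses at
most ∫₀^ε z^{-τ} dz. There are two endpoints, of arbitrary signs and order, hence the factor 2. -/
theorem integral_regularized_ge {τ ε : ℝ} (hτ0 : 0 ≤ τ) (hτ : τ < 1) (hε : 0 < ε) (u v : ℝ) :
    powPrim τ v - powPrim τ u - 2 * (ε ^ (1 - τ) / (1 - τ)) ≤ ∫ z in u..v, (|z| + ε) ^ (-τ) := by
  have h1τ : 0 < 1 - τ := by linarith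
  have hcont : Continuous fun z : ℝ => (|z| + ε) ^ (-τ) :=
    Continuous.rpow_const (by fun_prop) fun z => Or.inl (by positivity)
  have pos : ∀ v : ℝ, 0 ≤ v →
      powPrim τ v - ε ^ (1 - τ) / (1 - τ) ≤ ∫ z in (0 : ℝ)..v, (|z| + ε) ^ (-τ) := by
    intro v hv
    have e1 : ∫ z in (0 : ℝ)..v, (|z| + ε) ^ (-τ) = ∫ z in (0 : ℝ)..v, (z + ε) ^ (-τ) := by
      refine intervalIntegral.integral_congr fun z hz => ?_
      rw [uIcc_of_le hv] at hz
      simp only [abs_of_nonneg hz.1]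
    rw [e1, intervalIntegral.integral_comp_add_right (fun z : ℝ => z ^ (-τ)),
      integral_rpow (Or.inl (by linarith)), powPrim_of_nonneg hτ hv, zero_add,
      show -τ + 1 = 1 - τ by ring, ← sub_div]
    refine div_le_div_of_nonneg_right ?_ h1τ.le
    have := Real.rpow_le_rpow hv (by linarith : v ≤ v + ε) h1τ.le
    linarith
  have upper : ∀ v : ℝ, 0 ≤ v → ∫ z in (0 : ℝ)..v, (|z| + ε) ^ (-τ) ≤ powPrim τ v := by
    intro v hv
    rw [← (intervalIntegrable_abs_rpow_and_integral hτ v).2]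
    refine intervalIntegral.integral_mono_on_of_le_Ioo hv (hcont.intervalIntegrable _ _)
      (intervalIntegrable_abs_rpow_and_integral hτ v).1 fun z hz => ?_
    exact Real.rpow_le_rpow_of_nonpos (abs_pos.2 hz.1.ne') (by linarith) (by linarith)
  have odd : ∀ v : ℝ, ∫ z in (0 : ℝ)..(-v), (|z| + ε) ^ (-τ) = -∫ z in (0 : ℝ)..v, (|z| + ε) ^ (-τ) := by
    intro v
    have h4 := intervalIntegral.integral_comp_neg (a := 0) (b := v) (fun z : ℝ => (|z| + ε) ^ (-τ))
    simp only [abs_neg, neg_zero] at h4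
    rw [h4, intervalIntegral.integral_symm]
  have hE : 0 ≤ ε ^ (1 - τ) / (1 - τ) := by positivity
  have abs_diff : ∀ v : ℝ, |(∫ z in (0 : ℝ)..v, (|z| + ε) ^ (-τ)) - powPrim τ v|
      ≤ ε ^ (1 - τ) / (1 - τ) := by
    intro v
    rcases le_total 0 v with hv | hv
    · rw [abs_le]; constructor <;> linarith [pos v hv, upper v hv]
    · have h1 := pos (-v) (by linarith)
      have h2 := upper (-v) (by linarith)
      rw [odd, powPrim_neg] at h1 h2
      rw [abs_le]; constructor <;> linarith
  rw [← intervalIntegral.integral_interval_sub_left (hcont.intervalIntegrable 0 v)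
    (hcont.intervalIntegrable 0 u)]
  have h1 := abs_le.1 (abs_diff v)
  have h2 := abs_le.1 (abs_diff u)
  linarith

theorem continuous_regularized {τ ε : ℝ} (hε : 0 < ε) :
    Continuous fun p : ℝ × ℝ => (|p.1 - p.2| + ε) ^ (-τ) :=
  Continuous.rpow_const (by fun_prop) fun z => Or.inl (by positivity)

theorem rieszRect_le_integral_regularized {τ ε : ℝ} (hτ0 : 0 ≤ τ) (hτ : τ < 1) (hε : 0 < ε)
    {a b : ℝ} (hab : a ≤ b) (c d : ℝ) :
    rieszRect τ a b c d - (b - a) * (2 * (ε ^ (1 - τ) / (1 - τ))) ≤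
      ∫ x in a..b, ∫ y in c..d, (|x - y| + ε) ^ (-τ) := by
  have h1 := continuous_integral_abs_sub_rpow hτ c d
  have h2 : Continuous fun x => ∫ y in c..d, (|x - y| + ε) ^ (-τ) :=
    intervalIntegral.continuous_parametric_intervalIntegral_of_continuous'
      (continuous_regularized hε) c d
  have h3 : ∫ x in a..b, ((∫ y in c..d, |x - y| ^ (-τ)) - 2 * (ε ^ (1 - τ) / (1 - τ))) ≤
      ∫ x in a..b, ∫ y in c..d, (|x - y| + ε) ^ (-τ) := by
    refine intervalIntegral.integral_mono_on hab ((h1.sub continuous_const).intervalIntegrable a b)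
      (h2.intervalIntegrable a b) fun x _ => ?_
    have h := integral_regularized_ge hτ0 hτ hε (x - d) (x - c)
    rw [← intervalIntegral.integral_comp_sub_left (fun z : ℝ => (|z| + ε) ^ (-τ)) x] at h
    rw [← integral_abs_sub_rpow hτ] at h
    exact h
  rw [intervalIntegral.integral_sub (h1.intervalIntegrable a b) intervalIntegrable_const,
    integral_integral_abs_sub_rpow hτ] at h3
  refine le_trans (le_of_eq ?_) h3
  simp only [intervalIntegral.integral_const, smul_eq_mul]

/-- Moving both points inside their cells changes their distance by at most ε. So the integral of
|x-y|^{-θ} over the product of the cells is at least its area times the regularized kernel at any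
chosen point; raise this to the power `q` and average over the point. -/
theorem le_rieszRect_pow {θ ε : ℝ} {q : ℕ} (hq : 1 ≤ q) (hθ : 0 ≤ θ) (hθ1 : θ < 1) (hε : 0 < ε)
    {a b c d : ℝ} (hab : a ≤ b) (hcd : c ≤ d) (hab' : b - a + (d - c) ≤ ε) :
    (b - a) ^ (q - 1) * ((d - c) ^ (q - 1) *
      ∫ x in a..b, ∫ y in c..d, (|x - y| + ε) ^ (-(q * θ))) ≤ rieszRect θ a b c d ^ q := by
  have hpt : ∀ x ∈ Icc a b, ∀ y ∈ Icc c d,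
      ((b - a) * ((d - c) * (|x - y| + ε) ^ (-θ))) ≤ rieszRect θ a b c d := by
    intro x hx y hy
    rw [← integral_integral_abs_sub_rpow hθ1]
    have e : (b - a) * ((d - c) * (|x - y| + ε) ^ (-θ)) =
        ∫ _ in a..b, ∫ _ in c..d, (|x - y| + ε) ^ (-θ) := by
      simp only [intervalIntegral.integral_const, smul_eq_mul]
    rw [e]
    refine intervalIntegral.integral_mono_on hab intervalIntegrable_const
      ((continuous_integral_abs_sub_rpow hθ1 c d).intervalIntegrable _ _) fun x' hx' => ?_
    refine intervalIntegral.integral_mono_ae_restrict hcd intervalIntegrable_const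
      (intervalIntegrable_abs_sub_rpow hθ1 x' c d) ?_
    -- On the diagonal |0|^{-θ} is 0 by convention when θ ≠ 0, instead of infinite, so the
    -- comparison fails there; the diagonal point is a null set.
    have hne : ∀ᵐ y' ∂(volume.restrict (Icc c d)), y' ≠ x' :=
      ae_restrict_of_ae (by simp [ae_iff, measure_singleton])
    filter_upwards [hne, ae_restrict_mem measurableSet_Icc] with y' hne hy'
    refine Real.rpow_le_rpow_of_nonpos (abs_pos.2 (sub_ne_zero.2 hne.symm)) ?_ (by linarith)
    have h1 : |x' - x| ≤ b - a := abs_le.2 ⟨by linarith [hx.2, hx'.1], by linarith [hx.1, hx'.2]⟩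
    have h2 : |y - y'| ≤ d - c := abs_le.2 ⟨by linarith [hy.1, hy'.2], by linarith [hy.2, hy'.1]⟩
    calc |x' - y'| = |(x' - x) + (x - y) + (y - y')| := by congr 1; ring
      _ ≤ |x' - x| + |x - y| + |y - y'| := abs_add_three _ _ _
      _ ≤ |x - y| + ε := by linarith
  have hba : 0 ≤ b - a := sub_nonneg.2 hab
  have hdc : 0 ≤ d - c := sub_nonneg.2 hcd
  have hpt' : ∀ x ∈ Icc a b, ∀ y ∈ Icc c d,
      (b - a) ^ q * ((d - c) ^ q * (|x - y| + ε) ^ (-(q * θ))) ≤ rieszRect θ a b c d ^ q := by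
    intro x hx y hy
    have hx0 : 0 ≤ |x - y| + ε := by positivity
    refine le_trans (le_of_eq ?_) (pow_le_pow_left₀ (by positivity) (hpt x hx y hy) q)
    rw [mul_pow, mul_pow, ← Real.rpow_mul_natCast hx0]
    congr 4; ring
  -- Degenerate cells are set apart because the areas are divided out below.
  rcases hba.eq_or_lt with h0 | h0
  · rw [← h0, show b = a by linarith]
    simp only [intervalIntegral.integral_same, mul_zero]
    exact pow_nonneg (rieszRect_nonneg hθ1 le_rfl hcd) _
  rcases hdc.eq_or_lt with h0' | h0'
  · rw [← h0', show d = c by linarith]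
    simp only [intervalIntegral.integral_same, intervalIntegral.integral_zero, mul_zero]
    exact pow_nonneg (rieszRect_nonneg hθ1 hab le_rfl) _
  obtain ⟨p, rfl⟩ : ∃ p, q = p + 1 := ⟨q - 1, by omega⟩
  simp only [Nat.add_sub_cancel]
  set τ : ℝ := ((p + 1 : ℕ) : ℝ) * θ
  have h2 : Continuous fun x => ∫ y in c..d, (|x - y| + ε) ^ (-τ) :=
    intervalIntegral.continuous_parametric_intervalIntegral_of_continuous'
      (continuous_regularized hε) c d
  set A := rieszRect θ a b c d ^ (p + 1) / ((b - a) ^ (p + 1) * (d - c) ^ (p + 1)) with hA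
  have hint : ∫ x in a..b, ∫ y in c..d, (|x - y| + ε) ^ (-τ) ≤ ∫ _ in a..b, ∫ _ in c..d, A := by
    refine intervalIntegral.integral_mono_on hab (h2.intervalIntegrable _ _)
      intervalIntegrable_const fun x hx => ?_
    have h3 : Continuous fun y : ℝ => (|x - y| + ε) ^ (-τ) :=
      (continuous_regularized (τ := τ) hε).comp (by fun_prop : Continuous fun y : ℝ => (x, y))
    refine intervalIntegral.integral_mono_on hcd
      (h3.intervalIntegrable _ _) intervalIntegrable_const fun y hy => ?_
    rw [hA, le_div_iff₀ (by positivity)]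
    refine le_trans (le_of_eq (by ring)) (hpt' x hx y hy)
  simp only [intervalIntegral.integral_const, smul_eq_mul] at hint
  have h4 : (b - a) ^ p * ((d - c) ^ p * ((b - a) * ((d - c) * A)))
      = rieszRect θ a b c d ^ (p + 1) := by
    rw [hA]; field_simp; ring
  rw [← h4]
  gcongr

/-! ### Sums over grids -/

/-- The covariance of the increments over `[a,b]` and `[c,d]` of a fractional Brownian motion. -/
def fbmIncr (γ a b c d : ℝ) : ℝ :=
  fbmCov γ b d - fbmCov γ a d - fbmCov γ b c + fbmCov γ a c

/-- The powers of one variable cancel in the double difference, and |z|^{2γ}/2 is γ(2γ-1) times the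
second antiderivative of |z|^{2γ-2}. -/
theorem fbmIncr_eq {γ : ℝ} (hγ : 1 / 2 < γ) (a b c d : ℝ) :
    fbmIncr γ a b c d = γ * (2 * γ - 1) * rieszRect (2 - 2 * γ) a b c d := by
  have h1 : 2 * γ - 1 ≠ 0 := by linarith
  have h2 : γ ≠ 0 := by linarith
  simp only [fbmIncr, fbmCov, rieszRect, powPrimTwo, show 2 - (2 - 2 * γ) = 2 * γ by ring,
    show 1 - (2 - 2 * γ) = 2 * γ - 1 by ring]
  field_simp
  ring

theorem rieszRect_self_left (τ a c d : ℝ) : rieszRect τ a a c d = 0 := by simp [rieszRect]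

theorem rieszRect_self_right (τ a b c : ℝ) : rieszRect τ a b c c = 0 := by simp [rieszRect]

theorem sum_rieszRect (τ a δ c δ' : ℝ) (n m : ℕ) :
    ∑ i ∈ Finset.range n, ∑ j ∈ Finset.range m,
      rieszRect τ (a + i * δ) (a + (i + 1) * δ) (c + j * δ') (c + (j + 1) * δ') =
    rieszRect τ a (a + n * δ) c (c + m * δ') := by
  have inner : ∀ x y : ℝ, ∑ j ∈ Finset.range m, rieszRect τ x y (c + j * δ') (c + (j + 1) * δ') =
      rieszRect τ x y c (c + m * δ') := by
    intro x y
    have := Finset.sum_range_sub (fun j : ℕ => powPrimTwo τ (x - (c + j * δ')) -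
      powPrimTwo τ (y - (c + j * δ'))) m
    simp only [Nat.cast_add, Nat.cast_one, Nat.cast_zero, zero_mul, add_zero] at this
    rw [rieszRect, show ∀ A B C D : ℝ, A - B - C + D = D - C - (B - A) by intros; ring, ← this]
    exact Finset.sum_congr rfl fun j _ => by rw [rieszRect]; ring
  simp only [inner]
  have := Finset.sum_range_sub (fun i : ℕ => powPrimTwo τ (a + i * δ - c) -
      powPrimTwo τ (a + i * δ - (c + m * δ'))) n
  simp only [Nat.cast_add, Nat.cast_one, Nat.cast_zero, zero_mul, add_zero] at this
  rw [rieszRect, show ∀ A B C D : ℝ, A - B - C + D = A - C - (B - D) by intros; ring, ← this]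
  exact Finset.sum_congr rfl fun j _ => by rw [rieszRect]; ring

theorem sum_integral_regularized {τ ε : ℝ} (hε : 0 < ε) (a δ c δ' : ℝ) (n m : ℕ) :
    ∑ i ∈ Finset.range n, ∑ j ∈ Finset.range m, ∫ x in (a + i * δ)..(a + (i + 1) * δ),
      ∫ y in (c + j * δ')..(c + (j + 1) * δ'), (|x - y| + ε) ^ (-τ) =
    ∫ x in a..(a + n * δ), ∫ y in c..(c + m * δ'), (|x - y| + ε) ^ (-τ) := by
  have h2 : ∀ c d : ℝ, Continuous fun x => ∫ y in c..d, (|x - y| + ε) ^ (-τ) := fun c d =>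
    intervalIntegral.continuous_parametric_intervalIntegral_of_continuous'
      (continuous_regularized hε) c d
  have h3 : ∀ x : ℝ, Continuous fun y : ℝ => (|x - y| + ε) ^ (-τ) := fun x =>
    (continuous_regularized (τ := τ) hε).comp (by fun_prop : Continuous fun y : ℝ => (x, y))
  have inner : ∀ x : ℝ, ∑ j ∈ Finset.range m,
      ∫ y in (c + j * δ')..(c + (j + 1) * δ'), (|x - y| + ε) ^ (-τ) =
      ∫ y in c..(c + m * δ'), (|x - y| + ε) ^ (-τ) := by
    intro x
    have := intervalIntegral.sum_integral_adjacent_intervals (f := fun y => (|x - y| + ε) ^ (-τ))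
      (a := fun j : ℕ => c + j * δ') (n := m) (μ := volume) fun j _ =>
        (h3 x).intervalIntegrable _ _
    simpa using this
  have step : ∀ i ∈ Finset.range n, ∑ j ∈ Finset.range m,
      ∫ x in (a + i * δ)..(a + (i + 1) * δ),
        ∫ y in (c + j * δ')..(c + (j + 1) * δ'), (|x - y| + ε) ^ (-τ) =
      ∫ x in (a + i * δ)..(a + (i + 1) * δ), ∫ y in c..(c + m * δ'), (|x - y| + ε) ^ (-τ) := by
    intro i _
    rw [← intervalIntegral.integral_finsetSum fun j _ => (h2 _ _).intervalIntegrable _ _]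
    simp only [inner]
  rw [Finset.sum_congr rfl step]
  have := intervalIntegral.sum_integral_adjacent_intervals
    (f := fun x => ∫ y in c..(c + m * δ'), (|x - y| + ε) ^ (-τ))
    (a := fun i : ℕ => a + i * δ) (n := n) (μ := volume) fun j _ =>
      (h2 _ _).intervalIntegrable _ _
  simpa using this

/-- The normalized sum of the `q`-th powers of the covariances of the increments over the cells of
two grids: the cells `[a + iδ, a + (i+1)δ]`, `i < n`, and `[c + jδ', c + (j+1)δ']`, `j < m`. -/
def gridSum (q : ℕ) (γ a δ : ℝ) (n : ℕ) (c δ' : ℝ) (m : ℕ) : ℝ :=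
  δ⁻¹ ^ (q - 1) * δ'⁻¹ ^ (q - 1) * ∑ i ∈ Finset.range n, ∑ j ∈ Finset.range m,
    fbmIncr γ (a + i * δ) (a + (i + 1) * δ) (c + j * δ') (c + (j + 1) * δ') ^ q

/-- Mesh zero has to be allowed: it occurs for the uniform grids of a degenerate rectangle. The
cells are then points and the covariances vanish. -/
theorem gridSum_eq_zero {q : ℕ} (hq : 1 ≤ q) {γ : ℝ} (hγ : 1 / 2 < γ) (a c : ℝ) {δ δ' : ℝ}
    (n m : ℕ) (h : δ = 0 ∨ δ' = 0) : gridSum q γ a δ n c δ' m = 0 := by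
  have hq0 : q ≠ 0 := by omega
  rcases h with rfl | rfl <;>
    simp [gridSum, fbmIncr_eq hγ, rieszRect_self_left, rieszRect_self_right, hq0]

theorem inv_pow_mul_inv_pow_mul {x y : ℝ} (hx : x ≠ 0) (hy : y ≠ 0) (p : ℕ) (C X : ℝ) :
    x⁻¹ ^ p * y⁻¹ ^ p * C * (x ^ p * (y ^ p * X)) = C * X := by
  rw [inv_pow, inv_pow]
  field_simp

/-- In `rieszRect_pow_le` the powers of the side lengths are exactly cancelled by the normalization,
and what remains is additive over cells. -/
theorem gridSum_le {q : ℕ} (hq : 1 ≤ q) {γ : ℝ} (hγ : 1 / 2 < γ) (hqγ : q * (2 - 2 * γ) < 1)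
    (a c : ℝ) {δ δ' : ℝ} (hδ : 0 ≤ δ) (hδ' : 0 ≤ δ') (n m : ℕ) :
    gridSum q γ a δ n c δ' m ≤ (γ * (2 * γ - 1)) ^ q *
      rieszRect (q * (2 - 2 * γ)) a (a + n * δ) c (c + m * δ') := by
  have hC : 0 ≤ γ * (2 * γ - 1) := mul_nonneg (by linarith) (by linarith)
  by_cases h0 : δ = 0 ∨ δ' = 0
  · rw [gridSum_eq_zero hq hγ a c n m h0]
    exact mul_nonneg (pow_nonneg hC _) (rieszRect_nonneg hqγ (by nlinarith [n.cast_nonneg (α := ℝ)])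
      (by nlinarith [m.cast_nonneg (α := ℝ)]))
  push Not at h0
  have hδp : 0 < δ := hδ.lt_of_ne' h0.1
  have hδp' : 0 < δ' := hδ'.lt_of_ne' h0.2
  rw [gridSum, ← sum_rieszRect, Finset.mul_sum, Finset.mul_sum]
  refine Finset.sum_le_sum fun i _ => ?_
  rw [Finset.mul_sum, Finset.mul_sum]
  refine Finset.sum_le_sum fun j _ => ?_
  have h := rieszRect_pow_le hq hqγ (a := a + i * δ) (b := a + (i + 1) * δ) (c := c + j * δ')
    (d := c + (j + 1) * δ') (by linarith) (by linarith)
  rw [fbmIncr_eq hγ, mul_pow (γ * (2 * γ - 1)) _ q]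
  have h' := mul_le_mul_of_nonneg_left h (by positivity :
    0 ≤ (δ⁻¹ ^ (q - 1) * δ'⁻¹ ^ (q - 1)) * (γ * (2 * γ - 1)) ^ q)
  rw [show a + (i + 1) * δ - (a + i * δ) = δ by ring,
    show c + (j + 1) * δ' - (c + j * δ') = δ' by ring] at h'
  refine le_trans (le_of_eq (by ring)) (h'.trans (le_of_eq ?_))
  exact inv_pow_mul_inv_pow_mul hδp.ne' hδp'.ne' _ _ _

theorem le_gridSum {q : ℕ} (hq : 1 ≤ q) {γ : ℝ} (hγ : 1 / 2 < γ) (hγ1 : γ < 1)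
    (hqγ : q * (2 - 2 * γ) < 1)
    (a c : ℝ) {δ δ' : ℝ} (hδ : 0 ≤ δ) (hδ' : 0 ≤ δ') (n m : ℕ) :
    (γ * (2 * γ - 1)) ^ q *
      (rieszRect (q * (2 - 2 * γ)) a (a + n * δ) c (c + m * δ') -
        n * δ * (2 * ((δ + δ') ^ (1 - q * (2 - 2 * γ)) / (1 - q * (2 - 2 * γ))))) ≤
      gridSum q γ a δ n c δ' m := by
  have hC : 0 ≤ γ * (2 * γ - 1) := mul_nonneg (by linarith) (by linarith)
  have hτ : 0 < 1 - q * (2 - 2 * γ) := by linarith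
  by_cases h0 : δ = 0 ∨ δ' = 0
  · rw [gridSum_eq_zero hq hγ a c n m h0]
    refine mul_nonpos_of_nonneg_of_nonpos (pow_nonneg hC _) ?_
    have : rieszRect (q * (2 - 2 * γ)) a (a + n * δ) c (c + m * δ') = 0 := by
      rcases h0 with rfl | rfl <;> simp [rieszRect_self_left, rieszRect_self_right]
    rw [this, zero_sub, neg_nonpos]
    positivity
  push Not at h0
  have hδp : 0 < δ := hδ.lt_of_ne' h0.1
  have hδp' : 0 < δ' := hδ'.lt_of_ne' h0.2
  -- The regularization parameter is the sum of the two meshes, the least value allowed by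
  -- `le_rieszRect_pow`.
  have hε : 0 < δ + δ' := by positivity
  have hL := rieszRect_le_integral_regularized (τ := q * (2 - 2 * γ)) (mul_nonneg (by positivity) (by linarith))
    hqγ hε (a := a) (b := a + n * δ) (le_add_of_nonneg_right (by positivity)) c (c + m * δ')
  rw [add_sub_cancel_left] at hL
  refine (mul_le_mul_of_nonneg_left hL (pow_nonneg hC q)).trans ?_
  rw [gridSum, ← sum_integral_regularized hε, Finset.mul_sum, Finset.mul_sum]
  refine Finset.sum_le_sum fun i _ => ?_
  rw [Finset.mul_sum, Finset.mul_sum]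
  refine Finset.sum_le_sum fun j _ => ?_
  have hγ2 : 2 - 2 * γ < 1 := by linarith
  have h := le_rieszRect_pow hq (by linarith : 0 ≤ 2 - 2 * γ) hγ2 hε
    (a := a + i * δ) (b := a + (i + 1) * δ) (c := c + j * δ')
    (d := c + (j + 1) * δ') (by linarith) (by linarith) (by linarith)
  rw [fbmIncr_eq hγ, mul_pow (γ * (2 * γ - 1)) _ q]
  have h' := mul_le_mul_of_nonneg_left h (by positivity :
    0 ≤ (δ⁻¹ ^ (q - 1) * δ'⁻¹ ^ (q - 1)) * (γ * (2 * γ - 1)) ^ q)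
  rw [show a + (i + 1) * δ - (a + i * δ) = δ by ring,
    show c + (j + 1) * δ' - (c + j * δ') = δ' by ring] at h'
  refine le_trans (le_of_eq ?_) (h'.trans (le_of_eq (by ring)))
  exact (inv_pow_mul_inv_pow_mul hδp.ne' hδp'.ne' _ _ _).symm

/-- With H = q(γ-1)+1 one has 2-2H = q(2-2γ), and the denominator of κ_γ is H(2H-1): κ_γ is the
factor that turns the limit of the Riemann sums into a fractional covariance of index H. -/
theorem kappa_mul_fbmIncr {q : ℕ} {γ : ℝ} (hqγ : q * (2 - 2 * γ) < 1) (a b c d : ℝ) :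
    kappa q γ * fbmIncr (q * (γ - 1) + 1) a b c d =
      (γ * (2 * γ - 1)) ^ q * rieszRect (q * (2 - 2 * γ)) a b c d := by
  rw [fbmIncr_eq (by linarith), kappa, show 2 - 2 * ((q : ℝ) * (γ - 1) + 1) = q * (2 - 2 * γ) by ring,
    mul_pow]
  have h1 : γ * q - q + 1 ≠ 0 := by nlinarith
  have h2 : 2 * γ * q - 2 * q + 1 ≠ 0 := by nlinarith
  rw [show (q : ℝ) * (γ - 1) + 1 = γ * q - q + 1 by ring,
    show 2 * (γ * q - q + 1) - 1 = 2 * γ * q - 2 * q + 1 by ring]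
  generalize γ * q - q + 1 = x at *
  generalize 2 * γ * q - 2 * q + 1 = y at *
  generalize rieszRect _ a b c d = z
  field_simp

/-- Squeezing between the two cellwise bounds. The error term vanishes because n·δ converges to b -
a, while (δ+δ') is raised to the positive power 1 - q(2-2γ). -/
theorem tendsto_gridSum {q : ℕ} (hq : 1 ≤ q) {γ : ℝ} (hγ : 1 / 2 < γ) (hγ1 : γ < 1)
    (hqγ : q * (2 - 2 * γ) < 1) {ι : Type*} {l : Filter ι} {a b c d : ℝ} {δ δ' : ι → ℝ}
    {n m : ι → ℕ} (hδ0 : ∀ᶠ k in l, 0 ≤ δ k) (hδ0' : ∀ᶠ k in l, 0 ≤ δ' k)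
    (hδ : Tendsto δ l (𝓝 0)) (hδ' : Tendsto δ' l (𝓝 0))
    (hn : Tendsto (fun k => a + n k * δ k) l (𝓝 b))
    (hm : Tendsto (fun k => c + m k * δ' k) l (𝓝 d)) :
    Tendsto (fun k => gridSum q γ a (δ k) (n k) c (δ' k) (m k)) l
      (𝓝 (kappa q γ * fbmIncr (q * (γ - 1) + 1) a b c d)) := by
  rw [kappa_mul_fbmIncr hqγ]
  have hG := continuous_powPrimTwo hqγ
  have hR : Tendsto (fun k => rieszRect (q * (2 - 2 * γ)) a (a + n k * δ k) c (c + m k * δ' k)) l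
      (𝓝 (rieszRect (q * (2 - 2 * γ)) a b c d)) := by
    exact ((((hG.tendsto _).comp (hn.sub_const c)).sub_const _).sub
      ((hG.tendsto _).comp (hn.sub hm))).add ((hG.tendsto _).comp (hm.const_sub a))
  have hE : Tendsto (fun k => n k * δ k * (2 * ((δ k + δ' k) ^ (1 - q * (2 - 2 * γ)) /
      (1 - q * (2 - 2 * γ))))) l (𝓝 0) := by
    have h1 : Tendsto (fun k => (n k : ℝ) * δ k) l (𝓝 (b - a)) := by
      simpa using hn.sub_const a
    have h2 : Tendsto (fun k => (δ k + δ' k) ^ (1 - q * (2 - 2 * γ))) l (𝓝 0) := by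
      have h := (hδ.add hδ').rpow_const (p := 1 - q * (2 - 2 * γ)) (Or.inr (by linarith))
      rwa [add_zero, Real.zero_rpow (by linarith)] at h
    simpa using h1.mul ((h2.div_const (1 - q * (2 - 2 * γ))).const_mul 2)
  refine tendsto_of_tendsto_of_tendsto_of_le_of_le' (g := fun k => (γ * (2 * γ - 1)) ^ q *
      (rieszRect (q * (2 - 2 * γ)) a (a + n k * δ k) c (c + m k * δ' k) -
        n k * δ k * (2 * ((δ k + δ' k) ^ (1 - q * (2 - 2 * γ)) / (1 - q * (2 - 2 * γ))))))
      (h := fun k => (γ * (2 * γ - 1)) ^ q *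
      rieszRect (q * (2 - 2 * γ)) a (a + n k * δ k) c (c + m k * δ' k)) ?_ (hR.const_mul _) ?_ ?_
  · simpa using (hR.sub hE).const_mul ((γ * (2 * γ - 1)) ^ q)
  · filter_upwards [hδ0, hδ0'] with k h h'
    exact le_gridSum hq hγ hγ1 hqγ a c h h' _ _
  · filter_upwards [hδ0, hδ0'] with k h h'
    exact gridSum_le hq hγ hqγ a c h h' _ _

/-! ### Functions with moments of all orders -/

/-- All moments of `f` are finite. -/
def HasMoments {X F : Type*} [MeasurableSpace X] [NormedAddCommGroup F] (f : X → F)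
    (μ : Measure X) : Prop :=
  ∀ p : ENNReal, p ≠ ⊤ → MemLp f p μ

namespace HasMoments

variable {X F : Type*} [MeasurableSpace X] {μ : Measure X}

theorem integrable [NormedAddCommGroup F] {f : X → F} (h : HasMoments f μ) : Integrable f μ :=
  memLp_one_iff_integrable.1 (h 1 (by simp))

theorem add [NormedAddCommGroup F] {f g : X → F} (hf : HasMoments f μ) (hg : HasMoments g μ) :
    HasMoments (fun x => f x + g x) μ := fun p hp => (hf p hp).add (hg p hp)

/-- Cauchy–Schwarz doubles the exponent, which costs nothing when all exponents are available. This
stability under products settles the integrability of every polynomial in Gaussian variables below.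
-/
theorem mul [NormedRing F] {f g : X → F} (hf : HasMoments f μ) (hg : HasMoments g μ) :
    HasMoments (fun x => f x * g x) μ := by
  intro p hp
  have hp2 : 2 * p ≠ ⊤ := ENNReal.mul_ne_top (by simp) hp
  have : ENNReal.HolderTriple (2 * p) (2 * p) p := ⟨by
    rw [ENNReal.mul_inv (Or.inl (by simp)) (Or.inl (by simp)), ← add_mul, ENNReal.inv_two_add_inv_two,
      one_mul]⟩
  exact (hg _ hp2).mul (hf _ hp2)

theorem const [IsFiniteMeasure μ] [NormedAddCommGroup F] (c : F) :
    HasMoments (fun _ : X => c) μ := fun _ _ => memLp_const c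

theorem prod [IsFiniteMeasure μ] {ι : Type*} [NormedCommRing F] {f : ι → X → F} (S : Finset ι)
    (h : ∀ k, HasMoments (f k) μ) : HasMoments (fun x => ∏ k ∈ S, f k x) μ := by
  classical
  induction S using Finset.induction_on with
  | empty => simpa using const (1 : F)
  | insert a S ha ih => simpa [Finset.prod_insert ha] using (h a).mul ih

theorem sum [NormedAddCommGroup F] {ι : Type*} {f : ι → X → F} (S : Finset ι)
    (h : ∀ k, HasMoments (f k) μ) : HasMoments (fun x => ∑ k ∈ S, f k x) μ :=
  fun p hp => memLp_finsetSum _ fun k _ => h k p hp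

theorem pow [IsFiniteMeasure μ] [NormedCommRing F] {f : X → F} (hf : HasMoments f μ) (n : ℕ) :
    HasMoments (fun x => f x ^ n) μ := by
  simpa using prod (μ := μ) (Finset.range n) (f := fun _ => f) fun _ => hf

theorem polynomial [IsFiniteMeasure μ] {R : Type*} [CommSemiring R] [NormedCommRing F] [Algebra R F]
    {f : X → F} (hf : HasMoments f μ) (p : Polynomial R) :
    HasMoments (fun x => Polynomial.aeval (f x) p) μ := by
  simp only [Polynomial.aeval_eq_sum_range, Algebra.smul_def]
  exact sum _ fun k => (const _).mul (hf.pow k)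

theorem ofReal {f : X → ℝ} (hf : HasMoments f μ) : HasMoments (fun x => (f x : ℂ)) μ :=
  fun p hp => (hf p hp).ofReal

end HasMoments

theorem hasMoments_id_gaussianReal (v : NNReal) : HasMoments (fun x : ℝ => x) (gaussianReal 0 v) :=
  fun p hp => memLp_id_gaussianReal' p hp

/-! ### Gaussian integration by parts for polynomials -/

/-- Integration by parts against the density, whose derivative is -x/v times itself. For n = 0 the
truncated exponent n - 1 is harmless, since the factor n vanishes; for v = 0 the measure is the
Dirac mass at 0. -/
theorem integral_pow_gaussianReal (v : NNReal) (n : ℕ) :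
    ∫ x, x ^ (n + 1) ∂gaussianReal 0 v = v * (n * ∫ x, x ^ (n - 1) ∂gaussianReal 0 v) := by
  rcases eq_or_ne v 0 with rfl | hv
  · simp
  have hv' : (v : ℝ) ≠ 0 := by exact_mod_cast hv
  have hint : ∀ k : ℕ, Integrable (fun x => x ^ k * gaussianPDFReal 0 v x) := by
    intro k
    have h := ((hasMoments_id_gaussianReal v).pow k).integrable
    rw [gaussianReal_of_var_ne_zero _ hv, integrable_withDensity_iff_integrable_smul'
      (measurable_gaussianPDF 0 v) (ae_of_all _ fun x => gaussianPDF_lt_top)] at h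
    simpa [toReal_gaussianPDF, mul_comm] using h
  have hder : ∀ x, HasDerivAt (gaussianPDFReal 0 v) (-(x / v) * gaussianPDFReal 0 v x) x := by
    intro x
    have h1 : HasDerivAt (fun x : ℝ => -(x - 0) ^ 2 / (2 * v)) (-(x / v)) x := by
      refine HasDerivAt.congr_deriv
        ((((hasDerivAt_id x).sub_const 0).pow 2).neg.div_const (2 * (v : ℝ))) ?_
      simp only [id, sub_zero]
      field_simp
      simp
    have h2 := h1.exp.const_mul (√(2 * Real.pi * v))⁻¹
    rw [gaussianPDFReal_def]
    refine h2.congr_deriv ?_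
    ring
  have key := integral_mul_deriv_eq_deriv_mul_of_integrable (u := fun x : ℝ => x ^ n)
    (u' := fun x => n * x ^ (n - 1)) (v := gaussianPDFReal 0 v)
    (v' := fun x => -(x / v) * gaussianPDFReal 0 v x)
    (fun x _ => by simpa using hasDerivAt_pow n x) (fun x _ => hder x)
    (((hint (n + 1)).const_mul (-(1 / (v : ℝ)))).congr (ae_of_all _ fun x => by
      simp [pow_succ]; ring))
    (((hint (n - 1)).const_mul (n : ℝ)).congr (ae_of_all _ fun x => by
      simp; ring))
    (hint n)
  rw [integral_gaussianReal_eq_integral_smul hv, integral_gaussianReal_eq_integral_smul hv]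
  have e1 : ∫ x : ℝ, x ^ n * (-(x / v) * gaussianPDFReal 0 v x) =
      -(1 / v) * ∫ x, gaussianPDFReal 0 v x • x ^ (n + 1) := by
    rw [← integral_const_mul]
    refine integral_congr_ae (ae_of_all _ fun x => ?_)
    simp [pow_succ]; ring
  have e2 : ∫ x : ℝ, n * x ^ (n - 1) * gaussianPDFReal 0 v x =
      n * ∫ x, gaussianPDFReal 0 v x • x ^ (n - 1) := by
    rw [← integral_const_mul]
    refine integral_congr_ae (ae_of_all _ fun x => ?_)
    simp; ring
  rw [e1, e2] at key
  field_simp at key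
  linarith

theorem integral_mul_eval_gaussianReal (v : NNReal) (p : Polynomial ℂ) :
    ∫ x : ℝ, (x : ℂ) * p.eval (x : ℂ) ∂gaussianReal 0 v =
      v * ∫ x : ℝ, p.derivative.eval (x : ℂ) ∂gaussianReal 0 v := by
  have hx := (hasMoments_id_gaussianReal v).ofReal
  have hm : ∀ p : Polynomial ℂ, HasMoments (fun x : ℝ => p.eval (x : ℂ)) (gaussianReal 0 v) :=
    fun p => by simpa using hx.polynomial p
  have hi := fun p => (hm p).integrable
  have hi' := fun p => (hx.mul (hm p)).integrable
  induction p using Polynomial.induction_on' with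
  | add p r hp hr =>
    simp only [Polynomial.eval_add, Polynomial.derivative_add, mul_add]
    rw [integral_add (hi' p) (hi' r), integral_add (hi _) (hi _), hp, hr, mul_add]
  | monomial n a =>
    simp only [Polynomial.eval_monomial, Polynomial.derivative_monomial]
    have h := congrArg (fun x : ℝ => (x : ℂ)) (integral_pow_gaussianReal v n)
    simp only [Complex.ofReal_mul, Complex.ofReal_natCast, ← integral_complex_ofReal,
      Complex.ofReal_pow] at h
    have e : ∀ x : ℝ, (x : ℂ) * (a * (x : ℂ) ^ n) = a * (x : ℂ) ^ (n + 1) := fun x => by ring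
    simp only [e]
    rw [integral_const_mul, integral_const_mul, h]
    ring

theorem integral_mul_prod_gaussianReal (v : NNReal) {κ : Type*} [DecidableEq κ] (S : Finset κ)
    (c r : κ → ℂ) :
    ∫ x : ℝ, (x : ℂ) * ∏ k ∈ S, (c k * x + r k) ∂gaussianReal 0 v =
      ∑ k ∈ S, v * c k * ∫ x : ℝ, ∏ j ∈ S.erase k, (c j * x + r j) ∂gaussianReal 0 v := by
  have h := integral_mul_eval_gaussianReal v
    (∏ k ∈ S, (Polynomial.C (c k) * Polynomial.X + Polynomial.C (r k)))
  rw [Polynomial.derivative_prod_finset] at h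
  simp only [Polynomial.eval_prod, Polynomial.eval_add, Polynomial.eval_mul, Polynomial.eval_C,
    Polynomial.eval_X, Polynomial.eval_finsetSum, Polynomial.derivative_add,
    Polynomial.derivative_C_mul_X, Polynomial.derivative_C, add_zero] at h
  rw [h, integral_finsetSum _ fun k _ => ?_, Finset.mul_sum]
  · refine Finset.sum_congr rfl fun k _ => ?_
    rw [integral_mul_const]; ring
  · refine Integrable.mul_const ?_ _
    exact (HasMoments.prod _ fun j => ((HasMoments.const (c j)).mul
      (hasMoments_id_gaussianReal v).ofReal).add (HasMoments.const (r j))).integrable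

/-! ### The Isserlis recursion -/

section Isserlis

variable {E : Type*} [NormedAddCommGroup E] [NormedSpace ℝ E] [MeasurableSpace E] [BorelSpace E]
  [SecondCountableTopology E] [CompleteSpace E] {μ : Measure E} [IsGaussian μ]

theorem hasMoments_clm {F : Type*} [NormedAddCommGroup F] [NormedSpace ℝ F] (L : E →L[ℝ] F) :
    HasMoments (fun x => L x) μ := fun p hp => L.comp_memLp' (IsGaussian.memLp_id μ p hp)

/-- Regress each `V k` on `L`: the remainders are jointly Gaussian with `L` and uncorrelated with
it, hence independent of it. With the remainders frozen, the claim is one-dimensional integration by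
parts for the polynomial ∏ (c_k t + r_k). If `L` has variance zero, both sides vanish. -/
theorem isserlis_real (hμ : ∀ L : StrongDual ℝ E, ∫ x, L x ∂μ = 0) {κ : Type*} [Fintype κ]
    [DecidableEq κ] (L : StrongDual ℝ E) (V : κ → E →L[ℝ] ℂ) :
    ∫ x, (L x : ℂ) * ∏ k, V k x ∂μ =
      ∑ k, (∫ x, (L x : ℂ) * V k x ∂μ) * ∫ x, ∏ j ∈ Finset.univ.erase k, V j x ∂μ := by
  have hL := hasMoments_clm (μ := μ) L
  have hV := fun k => hasMoments_clm (μ := μ) (V k)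
  set v : ℝ := ∫ x, L x ^ 2 ∂μ with hv
  have hv0 : 0 ≤ v := integral_nonneg fun x => sq_nonneg _
  rcases hv0.eq_or_lt with h0 | h0
  · have hz : (fun x => L x ^ 2) =ᵐ[μ] 0 :=
      (integral_eq_zero_iff_of_nonneg (fun x => sq_nonneg _) (hL.pow 2).integrable).1 h0.symm
    have hz' : ∀ᵐ x ∂μ, L x = 0 := hz.mono fun x hx => by simpa using hx
    have hz2 : ∀ g : E → ℂ, ∫ x, (L x : ℂ) * g x ∂μ = 0 := fun g => by
      rw [integral_eq_zero_of_ae]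
      exact hz'.mono fun x hx => by simp [hx]
    simp [hz2]
  have hlaw : μ.map L = gaussianReal 0 v.toNNReal := by
    rw [IsGaussian.map_eq_gaussianReal, hμ, variance_of_integral_eq_zero (by fun_prop) (hμ L)]
  set c : κ → ℂ := fun k => (∫ x, (L x : ℂ) * V k x ∂μ) / v with hc
  let R : E →L[ℝ] (κ → ℂ) := ContinuousLinearMap.pi fun k => V k - L.smulRight (c k)
  have hR : ∀ x k, R x k = V k x - L x * c k := fun x k => by simp [R]
  have hind : IndepFun L R μ := by
    have hpair : HasGaussianLaw (fun x => (L x, R x)) μ :=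
      (IsGaussian.hasGaussianLaw_id (μ := μ)).map_fun (L.prod R)
    refine hpair.indepFun_of_covariance_strongDual fun L₁ L₂ => ?_
    have hm1 : HasMoments (L₁ ∘ L) μ := hasMoments_clm (μ := μ) (L₁.comp L)
    have hm2 : HasMoments (L₂ ∘ R) μ := hasMoments_clm (μ := μ) (L₂.comp R)
    rw [covariance_eq_sub (hm1 2 (by simp)) (hm2 2 (by simp))]
    have e1 : ∫ x, (L₁ ∘ L) x ∂μ = 0 := hμ (L₁.comp L)
    rw [e1, zero_mul, sub_zero]
    have e2 : ∀ x, (L₁ ∘ L * L₂ ∘ R) x = L₁ 1 * L₂ (L x • R x) := by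
      intro x
      have : L₁ (L x) = L x * L₁ 1 := by
        rw [← smul_eq_mul, ← map_smul, smul_eq_mul, mul_one]
      simp only [Pi.mul_apply, Function.comp_apply, this, map_smul, smul_eq_mul]; ring
    have hint : Integrable (fun x => L x • R x) μ := by
      refine Integrable.of_eval fun k => ?_
      simp only [Pi.smul_apply, hR, Complex.real_smul]
      have := (hL.ofReal.mul ((hV k).add ((hL.ofReal.mul (HasMoments.const (c k))).mul
        (HasMoments.const (-1 : ℂ))))).integrable
      refine this.congr (ae_of_all _ fun x => ?_)
      simp only; ring
    simp only [e2]
    rw [integral_const_mul, L₂.integral_comp_comm hint]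
    have e3 : ∫ x, L x • R x ∂μ = 0 := by
      ext k
      rw [eval_integral fun k => hint.eval k]
      simp only [Pi.smul_apply, hR, Complex.real_smul, Pi.zero_apply]
      have e4 : ∀ x, (L x : ℂ) * (V k x - L x * c k) = L x * V k x - ((L x ^ 2 : ℝ) : ℂ) * c k := by
        intro x; push_cast; ring
      simp only [e4]
      rw [integral_sub (hL.ofReal.mul (hV k)).integrable (((hL.pow 2).ofReal.integrable).mul_const _),
        integral_mul_const, integral_complex_ofReal, ← hv, hc]
      have : (v : ℂ) ≠ 0 := by exact_mod_cast h0.ne'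
      field_simp
      ring
    rw [e3]; simp
  have hmeas : AEMeasurable L μ := by fun_prop
  have hmeas' : AEMeasurable R μ := by fun_prop
  have hprod := (indepFun_iff_map_prod_eq_prod_map_map hmeas hmeas').1 hind
  have : IsProbabilityMeasure (μ.map R) := Measure.isProbabilityMeasure_map hmeas'
  rw [hlaw] at hprod
  -- By independence, integrate over the value of `L` with the remainders fixed.
  have fub : ∀ f : ℝ × (κ → ℂ) → ℂ, Continuous f → Integrable (fun x => f (L x, R x)) μ →
      Integrable (fun r => ∫ t, f (t, r) ∂gaussianReal 0 v.toNNReal) (μ.map R) ∧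
      ∫ x, f (L x, R x) ∂μ = ∫ r, ∫ t, f (t, r) ∂gaussianReal 0 v.toNNReal ∂(μ.map R) := by
    intro f hf hi
    have hi2 : Integrable f ((gaussianReal 0 v.toNNReal).prod (μ.map R)) := by
      rw [← hprod]
      exact (integrable_map_measure hf.aestronglyMeasurable (hmeas.prodMk hmeas')).2 hi
    refine ⟨hi2.integral_prod_right, ?_⟩
    rw [← integral_prod_symm f hi2, ← hprod,
      integral_map (hmeas.prodMk hmeas') hf.aestronglyMeasurable]
  have hVR : ∀ x k, V k x = c k * L x + R x k := fun x k => by rw [hR]; ring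
  have hcont : ∀ S : Finset κ, Continuous fun z : ℝ × (κ → ℂ) => ∏ k ∈ S, (c k * z.1 + z.2 k) := by
    intro S
    fun_prop
  have hcv : ∀ k, ∫ x, (L x : ℂ) * V k x ∂μ = v * c k := by
    intro k
    have : (v : ℂ) ≠ 0 := by exact_mod_cast h0.ne'
    simp only [hc]; field_simp
  have hfub : ∀ k, _ := fun k => fub (fun z => ∏ j ∈ Finset.univ.erase k, (c j * z.1 + z.2 j)) (hcont _)
    (by simpa only [hVR] using (HasMoments.prod (Finset.univ.erase k) hV).integrable)
  have hmain := fub (fun z => (z.1 : ℂ) * ∏ k, (c k * z.1 + z.2 k))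
    ((Complex.continuous_ofReal.comp continuous_fst).mul (hcont _))
    (by simpa only [hVR] using (hL.ofReal.mul (HasMoments.prod Finset.univ hV)).integrable)
  have hV' : ∀ S : Finset κ, ∀ x, ∏ k ∈ S, V k x = ∏ k ∈ S, (c k * L x + R x k) :=
    fun S x => Finset.prod_congr rfl fun k _ => hVR x k
  simp only [hcv, hV']
  rw [hmain.2]
  simp only [integral_mul_prod_gaussianReal, Real.coe_toNNReal _ hv0]
  rw [integral_finsetSum _ fun k _ => (hfub k).1.const_mul _]
  refine Finset.sum_congr rfl fun k _ => ?_
  rw [(hfub k).2, integral_const_mul]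

/-- Both sides are complex linear in the distinguished form, so its real and imaginary parts can be
treated separately. -/
theorem isserlis (hμ : ∀ L : StrongDual ℝ E, ∫ x, L x ∂μ = 0) {κ : Type*} [Fintype κ]
    [DecidableEq κ] (U : E →L[ℝ] ℂ) (V : κ → E →L[ℝ] ℂ) :
    ∫ x, U x * ∏ k, V k x ∂μ =
      ∑ k, (∫ x, U x * V k x ∂μ) * ∫ x, ∏ j ∈ Finset.univ.erase k, V j x ∂μ := by
  have hV := fun k => hasMoments_clm (μ := μ) (V k)
  let L₁ : StrongDual ℝ E := Complex.reCLM.comp U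
  let L₂ : StrongDual ℝ E := Complex.imCLM.comp U
  have hU : ∀ x, U x = (L₁ x : ℂ) + Complex.I * (L₂ x : ℂ) := fun x => by
    simp only [L₁, L₂, ContinuousLinearMap.comp_apply, Complex.reCLM_apply, Complex.imCLM_apply]
    rw [mul_comm, Complex.re_add_im]
  have split : ∀ g : E → ℂ, HasMoments g μ → ∫ x, U x * g x ∂μ =
      ∫ x, (L₁ x : ℂ) * g x ∂μ + Complex.I * ∫ x, (L₂ x : ℂ) * g x ∂μ := by
    intro g hg
    have h1 := ((hasMoments_clm (μ := μ) L₁).ofReal.mul hg).integrable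
    have h2 := ((hasMoments_clm (μ := μ) L₂).ofReal.mul hg).integrable
    rw [← integral_const_mul, ← integral_add h1 (h2.const_mul _)]
    refine integral_congr_ae (ae_of_all _ fun x => ?_)
    simp only [hU]; ring
  rw [split _ (HasMoments.prod _ hV), isserlis_real hμ, isserlis_real hμ, Finset.mul_sum,
    ← Finset.sum_add_distrib]
  refine Finset.sum_congr rfl fun k _ => ?_
  rw [split _ (hV k)]; ring

/-- Wick's formula for the product of two families, the first of which has no internal
contractions. -/
theorem wick_fin (hμ : ∀ L : StrongDual ℝ E, ∫ x, L x ∂μ = 0) {n : ℕ}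
    (A B : Fin n → E →L[ℝ] ℂ) (hA : ∀ j k, ∫ x, A j x * A k x ∂μ = 0) :
    ∫ x, (∏ k, A k x) * ∏ k, B k x ∂μ =
      ∑ τ : Equiv.Perm (Fin n), ∏ k, ∫ x, A k x * B (τ k) x ∂μ := by
  induction n with
  | zero => simp
  | succ n ih =>
    -- Contract `A 0` with every other factor. By `hA` only the contractions with some `B p`
    -- survive, so `A 0` chooses its partner p.
    have h := isserlis (κ := Fin n ⊕ Fin (n + 1)) hμ (A 0) (Sum.elim (fun k => A k.succ) B)
    simp only [Fintype.prod_sum_type, Fintype.sum_sum_type, Sum.elim_inl, Sum.elim_inr, hA,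
      zero_mul, Finset.sum_const_zero, zero_add] at h
    have e1 : ∀ x, (∏ k, A k x) * ∏ k, B k x =
        A 0 x * ((∏ k : Fin n, A k.succ x) * ∏ k, B k x) := fun x => by
      rw [Fin.prod_univ_succ]; ring
    simp only [e1]
    rw [h, ← Equiv.sum_comp Equiv.Perm.decomposeFin.symm, Fintype.sum_prod_type]
    refine Finset.sum_congr rfl fun p _ => ?_
    have e2 : (Finset.univ : Finset (Fin n ⊕ Fin (n + 1))).erase (Sum.inr p) =
        Finset.univ.disjSum (Finset.univ.erase p) := by
      ext k; rcases k with k | k <;> simp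
    -- The forms left after deleting p are enumerated through the transposition of 0 and p, which is
    -- how `Equiv.Perm.decomposeFin` builds a permutation from its value at 0 and a permutation of
    -- the rest.
    have e3 : ∀ x, ∏ j ∈ Finset.univ.erase p, B j x =
        ∏ j : Fin n, B (Equiv.swap 0 p j.succ) x := by
      intro x
      have h1 : Finset.univ.erase p =
          (Finset.univ : Finset (Fin n)).image fun j => Equiv.swap 0 p j.succ := by
        ext k
        simp only [Finset.mem_erase, Finset.mem_univ, and_true, Finset.mem_image, true_and]
        constructor
        · intro hk
          have hne : Equiv.swap 0 p k ≠ 0 := fun h' => hk (by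
            rw [← Equiv.swap_apply_self 0 p k, h', Equiv.swap_apply_left])
          obtain ⟨j, hj⟩ := Fin.exists_succ_eq.2 hne
          exact ⟨j, by rw [hj, Equiv.swap_apply_self]⟩
        · rintro ⟨j, rfl⟩ h'
          have := congrArg (Equiv.swap 0 p) h'
          rw [Equiv.swap_apply_self, Equiv.swap_apply_right] at this
          exact Fin.succ_ne_zero j this
      rw [h1, Finset.prod_image]
      intro i _ j _ hij
      exact Fin.succ_injective _ ((Equiv.swap 0 p).injective hij)
    simp only [e2, Finset.prod_disjSum, Sum.elim_inl, Sum.elim_inr, e3]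
    rw [ih (fun k => A k.succ) (fun j => B (Equiv.swap 0 p j.succ)) fun j k => hA _ _,
      Finset.mul_sum]
    refine Finset.sum_congr rfl fun τ _ => ?_
    rw [Fin.prod_univ_succ, Equiv.Perm.decomposeFin_symm_apply_zero]
    simp only [Equiv.Perm.decomposeFin_symm_apply_succ]

theorem wick (hμ : ∀ L : StrongDual ℝ E, ∫ x, L x ∂μ = 0) {κ : Type*} [Fintype κ] [DecidableEq κ]
    (A B : κ → E →L[ℝ] ℂ) (hA : ∀ j k, ∫ x, A j x * A k x ∂μ = 0) :
    ∫ x, (∏ k, A k x) * ∏ k, B k x ∂μ =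
      ∑ τ : Equiv.Perm κ, ∏ k, ∫ x, A k x * B (τ k) x ∂μ := by
  let e := Fintype.equivFin κ
  have h := wick_fin hμ (fun k => A (e.symm k)) (fun k => B (e.symm k)) fun j k => hA _ _
  have e1 : ∀ f : κ → ℂ, ∏ k, f (e.symm k) = ∏ k, f k := fun f => Equiv.prod_comp e.symm f
  have e2 : ∀ x, (∏ k, A k x) * ∏ k, B k x = (∏ k, A (e.symm k) x) * ∏ k, B (e.symm k) x := by
    intro x; rw [e1 fun k => A k x, e1 fun k => B k x]
  simp only [e2]
  rw [h, ← Equiv.sum_comp e.permCongr]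
  refine Finset.sum_congr rfl fun τ _ => ?_
  rw [← Equiv.prod_comp e.symm fun k => ∫ x, A k x * B (τ k) x ∂μ]
  simp [Equiv.permCongr_apply]

end Isserlis

/-! ### Hermite polynomials of Gaussian variables -/

theorem derivative_hermite_succ (n : ℕ) :
    Polynomial.derivative (Polynomial.hermite (n + 1)) = (n + 1 : ℕ) * Polynomial.hermite n := by
  induction n with
  | zero => simp [Polynomial.hermite_zero]
  | succ n ih =>
    rw [Polynomial.hermite_succ (n + 1), Polynomial.derivative_sub, Polynomial.derivative_mul, ih,
      Polynomial.derivative_X, Polynomial.derivative_mul, Polynomial.derivative_natCast]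
    have := Polynomial.hermite_succ n
    rw [show Polynomial.derivative (Polynomial.hermite n) =
      Polynomial.X * Polynomial.hermite n - Polynomial.hermite (n + 1) by rw [this]; ring]
    push_cast
    ring

/-- `He_n(x)` is the mean of `(x + iY)^n`, `Y` a standard Gaussian variable. -/
theorem aeval_hermite_eq_integral (n : ℕ) (x : ℝ) :
    ((Polynomial.aeval x (Polynomial.hermite n) : ℝ) : ℂ) =
      ∫ y : ℝ, ((x : ℂ) + Complex.I * y) ^ n ∂gaussianReal 0 1 := by
  have hm : ∀ k, HasMoments (fun y : ℝ => ((x : ℂ) + Complex.I * y) ^ k) (gaussianReal 0 1) :=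
    fun k => ((HasMoments.const _).add ((HasMoments.const _).mul
      (hasMoments_id_gaussianReal 1).ofReal)).pow k
  -- Integrating by parts the factor iY in (x+iY)^{n+1} produces i² = -1 and hence the three-term
  -- recursion of the Hermite polynomials.
  have hrec : ∀ n : ℕ, ∫ y : ℝ, ((x : ℂ) + Complex.I * y) ^ (n + 1) ∂gaussianReal 0 1 =
      x * ∫ y : ℝ, ((x : ℂ) + Complex.I * y) ^ n ∂gaussianReal 0 1 -
        n * ∫ y : ℝ, ((x : ℂ) + Complex.I * y) ^ (n - 1) ∂gaussianReal 0 1 := by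
    intro n
    have h := integral_mul_eval_gaussianReal 1
      ((Polynomial.C (x : ℂ) + Polynomial.C Complex.I * Polynomial.X) ^ n)
    rw [Polynomial.derivative_pow] at h
    simp only [Polynomial.eval_pow, Polynomial.eval_add, Polynomial.eval_mul, Polynomial.eval_C,
      Polynomial.eval_X, Polynomial.derivative_add, Polynomial.derivative_C,
      Polynomial.derivative_C_mul_X, zero_add, NNReal.coe_one, Complex.ofReal_one, one_mul] at h
    rw [integral_mul_const, integral_const_mul] at h
    have e : ∀ y : ℝ, ((x : ℂ) + Complex.I * y) ^ (n + 1) =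
        x * ((x : ℂ) + Complex.I * y) ^ n + Complex.I * (y * ((x : ℂ) + Complex.I * y) ^ n) := by
      intro y; ring
    simp only [e]
    rw [integral_add ((hm n).integrable.const_mul _)
      (((hasMoments_id_gaussianReal 1).ofReal.mul (hm n)).integrable.const_mul _),
      integral_const_mul, integral_const_mul, h]
    linear_combination (n * ∫ y : ℝ, ((x : ℂ) + Complex.I * y) ^ (n - 1) ∂gaussianReal 0 1) *
      Complex.I_mul_I
  induction n using Nat.strong_induction_on with
  | _ n ih =>
    match n with
    | 0 => simp [Polynomial.hermite_zero]
    | 1 => rw [hrec 0]; simp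
    | n + 2 =>
      rw [hrec (n + 1), ← ih (n + 1) (by omega), Nat.add_sub_cancel, ← ih n (by omega),
        Polynomial.hermite_succ (n + 1), derivative_hermite_succ]
      simp

/-- He_{k+1} = x·He_k - He_k', whose two terms have equal means by Gaussian integration by parts. -/
theorem integral_hermite_gaussianReal {n : ℕ} (hn : 1 ≤ n) :
    ∫ x : ℝ, Polynomial.aeval x (Polynomial.hermite n) ∂gaussianReal 0 1 = 0 := by
  obtain ⟨k, rfl⟩ : ∃ k, n = k + 1 := ⟨n - 1, by omega⟩
  have hx := hasMoments_id_gaussianReal 1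
  have h := integral_mul_eval_gaussianReal 1
    ((Polynomial.hermite k).map (algebraMap ℤ ℂ))
  rw [Polynomial.derivative_map] at h
  simp only [Polynomial.eval_map_algebraMap, NNReal.coe_one, Complex.ofReal_one, one_mul] at h
  have e : ∀ (p : Polynomial ℤ) (x : ℝ), Polynomial.aeval (x : ℂ) p = ((Polynomial.aeval x p : ℝ) : ℂ) :=
    fun p x => by
      have := Polynomial.aeval_algebraMap_apply ℂ x p
      simpa using this
  simp only [e, ← Complex.ofReal_mul, integral_complex_ofReal] at h
  have h' := Complex.ofReal_injective h
  simp only [Polynomial.hermite_succ, map_sub, map_mul, Polynomial.aeval_X]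
  rw [integral_sub (hx.mul (hx.polynomial _)).integrable (hx.polynomial _).integrable, h', sub_self]

/-! ### Linear forms on products of centered Gaussian measures -/

section Product

variable {E F : Type*} [NormedAddCommGroup E] [NormedSpace ℝ E] [MeasurableSpace E] [BorelSpace E]
  [SecondCountableTopology E] [CompleteSpace E] {μ : Measure E} [IsGaussian μ]
  [NormedAddCommGroup F] [NormedSpace ℝ F] [MeasurableSpace F] [BorelSpace F]
  [SecondCountableTopology F] [CompleteSpace F] {ν : Measure F} [IsGaussian ν]

theorem integral_clm_complex (hμ : ∀ L : StrongDual ℝ E, ∫ x, L x ∂μ = 0) (f : E →L[ℝ] ℂ) :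
    ∫ x, f x ∂μ = 0 := by
  have hf := (hasMoments_clm (μ := μ) f).integrable
  have h1 := hμ (Complex.reCLM.comp f)
  have h2 := hμ (Complex.imCLM.comp f)
  simp only [ContinuousLinearMap.comp_apply] at h1 h2
  rw [Complex.reCLM.integral_comp_comm hf] at h1
  rw [Complex.imCLM.integral_comp_comm hf] at h2
  exact Complex.ext h1 h2

/-- The cross terms factor by Fubini and contain the mean of a form under `μ`, which is zero. -/
theorem integral_coprod_mul_coprod (hμ : ∀ L : StrongDual ℝ E, ∫ x, L x ∂μ = 0)
    (f f' : E →L[ℝ] ℂ) (g g' : F →L[ℝ] ℂ) :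
    ∫ z, f.coprod g z * f'.coprod g' z ∂(μ.prod ν) =
      ∫ x, f x * f' x ∂μ + ∫ y, g y * g' y ∂ν := by
  have hf := fun f : E →L[ℝ] ℂ => hasMoments_clm (μ := μ.prod ν) (f.comp (ContinuousLinearMap.fst ℝ E F))
  have hg := fun g : F →L[ℝ] ℂ => hasMoments_clm (μ := μ.prod ν) (g.comp (ContinuousLinearMap.snd ℝ E F))
  simp only [ContinuousLinearMap.comp_apply, ContinuousLinearMap.coe_fst',
    ContinuousLinearMap.coe_snd'] at hf hg
  have e : ∀ z : E × F, f.coprod g z * f'.coprod g' z =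
      (f z.1 * f' z.1) * 1 + (1 * (g z.2 * g' z.2) + (f z.1 * g' z.2 + f' z.1 * g z.2)) := by
    intro z; simp only [ContinuousLinearMap.coprod_apply]; ring
  have h1 : HasMoments (fun _ : E × F => (1 : ℂ)) (μ.prod ν) := HasMoments.const _
  simp only [e]
  rw [integral_add (((hf f).mul (hf f')).mul h1).integrable
      ((h1.mul ((hg g).mul (hg g'))).add (((hf f).mul (hg g')).add ((hf f').mul (hg g)))).integrable,
    integral_add (h1.mul ((hg g).mul (hg g'))).integrable
      (((hf f).mul (hg g')).add ((hf f').mul (hg g))).integrable,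
    integral_add ((hf f).mul (hg g')).integrable ((hf f').mul (hg g)).integrable,
    integral_prod_mul (fun x => f x * f' x) (fun _ => (1 : ℂ)),
    integral_prod_mul (fun _ => (1 : ℂ)) (fun y => g y * g' y),
    integral_prod_mul (fun x => f x) (fun y => g' y), integral_prod_mul (fun x => f' x) (fun y => g y),
    integral_clm_complex hμ, integral_clm_complex hμ]
  simp

theorem integral_dual_prod (hμ : ∀ L : StrongDual ℝ E, ∫ x, L x ∂μ = 0)
    (hν : ∀ L : StrongDual ℝ F, ∫ x, L x ∂ν = 0) (L : StrongDual ℝ (E × F)) :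
    ∫ z, L z ∂(μ.prod ν) = 0 := by
  have h1 := hasMoments_clm (μ := μ.prod ν)
    ((L.comp (ContinuousLinearMap.inl ℝ E F)).comp (ContinuousLinearMap.fst ℝ E F))
  have h2 := hasMoments_clm (μ := μ.prod ν)
    ((L.comp (ContinuousLinearMap.inr ℝ E F)).comp (ContinuousLinearMap.snd ℝ E F))
  have e : ∀ z : E × F, L z = L.comp (ContinuousLinearMap.inl ℝ E F) z.1 * 1 +
      1 * L.comp (ContinuousLinearMap.inr ℝ E F) z.2 := by
    intro z
    simp only [ContinuousLinearMap.comp_apply, mul_one, one_mul, ← map_add]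
    simp
  simp only [e]
  rw [integral_add (by simpa using h1.integrable) (by simpa using h2.integrable),
    integral_prod_mul (fun x => L.comp (ContinuousLinearMap.inl ℝ E F) x) (fun _ => (1 : ℝ)),
    integral_prod_mul (fun _ => (1 : ℝ)) (fun x => L.comp (ContinuousLinearMap.inr ℝ E F) x), hμ, hν]
  simp

end Product

/-! ### Real forms as complex-valued forms -/

section Forms

variable {E : Type*} [NormedAddCommGroup E] [NormedSpace ℝ E]

/-- A real linear form, with values in `ℂ`. -/
def ofRealForm (a : StrongDual ℝ E) : E →L[ℝ] ℂ := Complex.ofRealCLM.comp a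

/-- `i` times a real linear form. -/
def imagForm (a : StrongDual ℝ E) : E →L[ℝ] ℂ := Complex.I • ofRealForm a

theorem ofRealForm_apply (a : StrongDual ℝ E) (x : E) : ofRealForm a x = (a x : ℂ) := rfl

theorem imagForm_apply (a : StrongDual ℝ E) (x : E) : imagForm a x = Complex.I * (a x : ℂ) := rfl

theorem integral_ofRealForm_mul [MeasurableSpace E] {μ : Measure E} (a b : StrongDual ℝ E) :
    ∫ x, ofRealForm a x * ofRealForm b x ∂μ = ((∫ x, a x * b x ∂μ : ℝ) : ℂ) := by
  simp only [ofRealForm_apply, ← Complex.ofReal_mul, integral_complex_ofReal]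

theorem integral_imagForm_mul [MeasurableSpace E] {μ : Measure E} (a b : StrongDual ℝ E) :
    ∫ x, imagForm a x * imagForm b x ∂μ = -((∫ x, a x * b x ∂μ : ℝ) : ℂ) := by
  have e : ∀ x, imagForm a x * imagForm b x = -(((a x * b x : ℝ)) : ℂ) := by
    intro x
    simp only [imagForm_apply, Complex.ofReal_mul]
    linear_combination ((a x : ℂ) * b x) * Complex.I_mul_I
  simp only [e, integral_neg, integral_complex_ofReal]

theorem map_eq_gaussianReal_one [MeasurableSpace E] [BorelSpace E] {μ : Measure E} [IsGaussian μ]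
    (hμ : ∀ L : StrongDual ℝ E, ∫ x, L x ∂μ = 0) {a : StrongDual ℝ E}
    (ha : ∫ x, a x * a x ∂μ = 1) : μ.map a = gaussianReal 0 1 := by
  rw [IsGaussian.map_eq_gaussianReal, hμ, variance_of_integral_eq_zero (by fun_prop) (hμ a)]
  simp only [sq, ha, Real.toNNReal_one]

end Forms

/-! ### Covariances and moments of Hermite polynomials of Gaussian variables -/

section Hermite

variable {E : Type*} [NormedAddCommGroup E] [NormedSpace ℝ E] [MeasurableSpace E] [BorelSpace E]
  [SecondCountableTopology E] [CompleteSpace E] {μ : Measure E} [IsGaussian μ]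

omit [SecondCountableTopology E] [CompleteSpace E] in
theorem aeval_hermite_eq_integral_form (hμ : ∀ L : StrongDual ℝ E, ∫ x, L x ∂μ = 0)
    {a : StrongDual ℝ E} (ha : ∫ x, a x * a x ∂μ = 1) (n : ℕ) (x : ℝ) :
    ((Polynomial.aeval x (Polynomial.hermite n) : ℝ) : ℂ) =
      ∫ y, ((x : ℂ) + imagForm a y) ^ n ∂μ := by
  rw [aeval_hermite_eq_integral, ← map_eq_gaussianReal_one hμ ha, integral_map (by fun_prop)]
  · rfl
  · exact Continuous.aestronglyMeasurable (by fun_prop)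

/-- Write He_n(a(x)) and He_n(b(x)) as means of powers of A = a(x) + i·a(y) and B = b(x) + i·b(z),
with y, z independent copies. Then E[A²] = 0 and E[AB] = E[ab], so all n! pairings in Wick's formula
contribute the same power. -/
theorem integral_hermite_mul_hermite (hμ : ∀ L : StrongDual ℝ E, ∫ x, L x ∂μ = 0)
    {a b : StrongDual ℝ E} (ha : ∫ x, a x * a x ∂μ = 1) (hb : ∫ x, b x * b x ∂μ = 1) (n : ℕ) :
    ∫ x, Polynomial.aeval (a x) (Polynomial.hermite n) *
      Polynomial.aeval (b x) (Polynomial.hermite n) ∂μ = n.factorial * (∫ x, a x * b x ∂μ) ^ n := by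
  let A : E × (E × E) →L[ℝ] ℂ := (ofRealForm a).coprod ((imagForm a).coprod 0)
  let B : E × (E × E) →L[ℝ] ℂ := (ofRealForm b).coprod ((0 : E →L[ℝ] ℂ).coprod (imagForm b))
  have hμ2 := integral_dual_prod hμ hμ
  have hμ3 := integral_dual_prod hμ hμ2
  have hAA : ∫ z, A z * A z ∂(μ.prod (μ.prod μ)) = 0 := by
    simp only [A]
    rw [integral_coprod_mul_coprod hμ, integral_coprod_mul_coprod hμ, integral_ofRealForm_mul,
      integral_imagForm_mul]
    simp
  have hAB : ∫ z, A z * B z ∂(μ.prod (μ.prod μ)) = ((∫ x, a x * b x ∂μ : ℝ) : ℂ) := by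
    simp only [A, B]
    rw [integral_coprod_mul_coprod hμ, integral_coprod_mul_coprod hμ, integral_ofRealForm_mul]
    simp
  have hw := wick (κ := Fin n) hμ3 (fun _ => A) (fun _ => B) fun _ _ => hAA
  simp only [hAB, Finset.prod_const, Finset.card_univ, Fintype.card_fin, Finset.sum_const,
    Fintype.card_perm, nsmul_eq_mul] at hw
  apply Complex.ofReal_injective
  push_cast
  rw [← hw, ← integral_complex_ofReal]
  have hint : Integrable (fun z => A z ^ n * B z ^ n) (μ.prod (μ.prod μ)) :=
    (((hasMoments_clm A).pow n).mul ((hasMoments_clm B).pow n)).integrable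
  rw [integral_prod _ hint]
  refine integral_congr_ae (ae_of_all _ fun x => ?_)
  simp only
  rw [Complex.ofReal_mul, aeval_hermite_eq_integral_form hμ ha, aeval_hermite_eq_integral_form hμ hb,
    ← integral_prod_mul]
  simp [A, B, ofRealForm_apply]

theorem pow_norm_integral_le {X : Type*} [MeasurableSpace X] {ν : Measure X}
    [IsProbabilityMeasure ν] {f : X → ℂ} (hf : HasMoments f ν) (k : ℕ) :
    ‖∫ x, f x ∂ν‖ ^ k ≤ ∫ x, ‖f x‖ ^ k ∂ν := by
  have hfn : HasMoments (fun x => ‖f x‖) ν := fun p hp => (hf p hp).norm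
  calc ‖∫ x, f x ∂ν‖ ^ k ≤ (∫ x, ‖f x‖ ∂ν) ^ k :=
        pow_le_pow_left₀ (norm_nonneg _) (norm_integral_le_integral_norm _) k
    _ ≤ ∫ x, ‖f x‖ ^ k ∂ν :=
      (convexOn_pow k).map_integral_le (continuous_pow k).continuousOn isClosed_Ici
        (ae_of_all _ fun x => norm_nonneg _) hfn.integrable (hfn.pow k).integrable

/-- The left side is the scalar product of the `m`-fold tensor power of ∑ c_i φ_i^{⊗q} with the same
tensor after its mq slots are permuted by `τ`. Permuting slots preserves the norm, so Cauchy–Schwarz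
concludes. -/
theorem sum_prod_inner_perm_le {H : Type*} [NormedAddCommGroup H] [InnerProductSpace ℝ H]
    {ι : Type*} [Fintype ι] (φ : ι → H) (c : ι → ℝ) (m q : ℕ)
    (τ : Equiv.Perm (Fin m × Fin q)) :
    ∑ w : Fin m → ι, ∑ w' : Fin m → ι, (∏ l, c (w l)) * (∏ l, c (w' l)) *
      ∏ k : Fin m × Fin q, inner ℝ (φ (w k.1)) (φ (w' (τ k).1)) ≤
    ‖∑ i, c i • tensorPow q (φ i)‖ ^ (2 * m) := by
  classical
  let e : Fin m × Fin q ≃ Fin (m * q) := finProdFinEquiv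
  let T : Equiv.Perm (Fin m × Fin q) → (Fin m → ι) → TensorPower H (m * q) := fun τ w =>
    elemTensor fun k => φ (w (τ (e.symm k)).1)
  have hT : ∀ τ τ' w w', inner ℝ (T τ w) (T τ' w') =
      ∏ k : Fin m × Fin q, inner ℝ (φ (w (τ k).1)) (φ (w' (τ' k).1)) := by
    intro τ τ' w w'
    rw [inner_elemTensor]
    exact Equiv.prod_comp e.symm fun k => inner ℝ (φ (w (τ k).1)) (φ (w' (τ' k).1))
  let S : Equiv.Perm (Fin m × Fin q) → TensorPower H (m * q) := fun τ =>
    ∑ w : Fin m → ι, (∏ l, c (w l)) • T τ w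
  have hS : ∀ τ τ', inner ℝ (S τ) (S τ') = ∑ w : Fin m → ι, ∑ w' : Fin m → ι,
      (∏ l, c (w l)) * (∏ l, c (w' l)) *
        ∏ k : Fin m × Fin q, inner ℝ (φ (w (τ k).1)) (φ (w' (τ' k).1)) := by
    intro τ τ'
    simp only [S, sum_inner, inner_sum, real_inner_smul_left, real_inner_smul_right, hT]
    rw [Finset.sum_comm]
    exact Finset.sum_congr rfl fun w _ => Finset.sum_congr rfl fun w' _ => by ring
  have hdiag : ∀ τ, inner ℝ (S τ) (S τ) = ‖∑ i, c i • tensorPow q (φ i)‖ ^ (2 * m) := by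
    intro τ
    rw [hS, pow_mul, ← real_inner_self_eq_norm_sq]
    have h1 : inner ℝ (∑ i, c i • tensorPow q (φ i)) (∑ i, c i • tensorPow q (φ i)) =
        ∑ p : ι × ι, c p.1 * c p.2 * inner ℝ (φ p.1) (φ p.2) ^ q := by
      rw [Fintype.sum_prod_type]
      simp only [sum_inner, inner_sum, real_inner_smul_left, real_inner_smul_right, tensorPow,
        inner_elemTensor, Finset.prod_const, Finset.card_univ, Fintype.card_fin]
      rw [Finset.sum_comm]
      exact Finset.sum_congr rfl fun w _ => Finset.sum_congr rfl fun w' _ => by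
        rw [real_inner_comm]; ring
    rw [h1, Finset.sum_pow', Fintype.piFinset_univ,
      ← Equiv.sum_comp (Equiv.arrowProdEquivProdArrow (Fin m) (fun _ => ι) (fun _ => ι)).symm,
      Fintype.sum_prod_type]
    refine Finset.sum_congr rfl fun w _ => Finset.sum_congr rfl fun w' _ => ?_
    rw [Equiv.prod_comp τ fun k : Fin m × Fin q => inner ℝ (φ (w k.1)) (φ (w' k.1)),
      Fintype.prod_prod_type]
    simp [Finset.prod_mul_distrib, Equiv.arrowProdEquivProdArrow]
  have h := hS 1 τ
  simp only [Equiv.Perm.one_apply] at h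
  rw [← h]
  refine (real_inner_le_norm _ _).trans (le_of_eq ?_)
  have e1 : ‖S τ‖ = ‖S 1‖ := by
    rw [← sq_eq_sq₀ (norm_nonneg _) (norm_nonneg _), ← real_inner_self_eq_norm_sq,
      ← real_inner_self_eq_norm_sq, hdiag, hdiag]
  rw [e1, ← sq, ← real_inner_self_eq_norm_sq, hdiag]

/-- Moments of elements of a fixed Wiener chaos are controlled by the second moment. -/
theorem integral_sum_hermite_pow_le (hμ : ∀ L : StrongDual ℝ E, ∫ x, L x ∂μ = 0) {H : Type*}
    [NormedAddCommGroup H] [InnerProductSpace ℝ H] {ι : Type*} [Fintype ι]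
    (a : ι → StrongDual ℝ E) (φ : ι → H) (hφ : ∀ i j, ∫ x, a i x * a j x ∂μ = inner ℝ (φ i) (φ j))
    (h1 : ∀ i, ‖φ i‖ = 1) (c : ι → ℝ) (q m : ℕ) :
    ∫ x, (∑ i, c i * Polynomial.aeval (a i x) (Polynomial.hermite q)) ^ (2 * m) ∂μ ≤
      (m * q).factorial * 2 ^ (m * q) * ‖∑ i, c i • tensorPow q (φ i)‖ ^ (2 * m) := by
  classical
  have hone : ∀ i, ∫ x, a i x * a i x ∂μ = 1 := fun i => by
    rw [hφ, real_inner_self_eq_norm_sq, h1, one_pow]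
  -- The variables a_i(x) + i·a_i(y), and below their conjugates. The products U_i U_j have mean
  -- zero, while the mean of U_i times the conjugate of U_j is 2⟨φ_i,φ_j⟩: this 2 is the source of
  -- 2^{mq} in the bound.
  let U : ι → E × E →L[ℝ] ℂ := fun i => (ofRealForm (a i)).coprod (imagForm (a i))
  let U' : ι → E × E →L[ℝ] ℂ := fun i => (ofRealForm (a i)).coprod (-imagForm (a i))
  have hUU : ∀ i j, ∫ z, U i z * U j z ∂(μ.prod μ) = 0 := by
    intro i j
    simp only [U]
    rw [integral_coprod_mul_coprod hμ, integral_ofRealForm_mul, integral_imagForm_mul]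
    simp
  have hUU' : ∀ i j, ∫ z, U i z * U' j z ∂(μ.prod μ) = ((2 * inner ℝ (φ i) (φ j) : ℝ) : ℂ) := by
    intro i j
    simp only [U, U']
    rw [integral_coprod_mul_coprod hμ, integral_ofRealForm_mul]
    simp only [FunLike.coe_neg, Pi.neg_apply, mul_neg, integral_neg, integral_imagForm_mul, hφ]
    push_cast; ring
  have hconj : ∀ i z, U' i z = (starRingEnd ℂ) (U i z) := by
    intro i z
    simp [U, U', ofRealForm_apply, imagForm_apply]
  let Q : E × E → ℂ := fun z => ∑ i, (c i : ℂ) * U i z ^ q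
  let Q' : E × E → ℂ := fun z => ∑ i, (c i : ℂ) * U' i z ^ q
  have hQ : HasMoments Q (μ.prod μ) :=
    HasMoments.sum _ fun i => (HasMoments.const _).mul ((hasMoments_clm (U i)).pow q)
  have hQ' : ∀ z, Q' z = (starRingEnd ℂ) (Q z) := by
    intro z; simp [Q, Q', hconj]
  have hnorm : ∀ z, ((‖Q z‖ ^ (2 * m) : ℝ) : ℂ) = Q z ^ m * Q' z ^ m := by
    intro z
    rw [hQ', ← mul_pow, Complex.mul_conj', pow_mul]; push_cast; rfl
  have expand : ∀ (V : ι → E × E →L[ℝ] ℂ) z, (∑ i, (c i : ℂ) * V i z ^ q) ^ m =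
      ∑ w : Fin m → ι, (∏ l, (c (w l) : ℂ)) * ∏ k : Fin m × Fin q, V (w k.1) z := by
    intro V z
    rw [Finset.sum_pow', Fintype.piFinset_univ]
    refine Finset.sum_congr rfl fun w _ => ?_
    rw [Finset.prod_mul_distrib, Fintype.prod_prod_type]
    simp
  have hwick : ∀ w w' : Fin m → ι,
      ∫ z, (∏ k : Fin m × Fin q, U (w k.1) z) * ∏ k : Fin m × Fin q, U' (w' k.1) z ∂(μ.prod μ) =
      ((∑ τ : Equiv.Perm (Fin m × Fin q), 2 ^ (m * q) *
        ∏ k : Fin m × Fin q, inner ℝ (φ (w k.1)) (φ (w' (τ k).1)) : ℝ) : ℂ) := by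
    intro w w'
    rw [wick (integral_dual_prod hμ hμ) (fun k : Fin m × Fin q => U (w k.1))
      (fun k => U' (w' k.1)) fun j k => hUU _ _]
    push_cast
    refine Finset.sum_congr rfl fun τ _ => ?_
    simp only [hUU']
    push_cast
    rw [Finset.prod_mul_distrib]
    simp
  have hmain : ∫ z, ‖Q z‖ ^ (2 * m) ∂(μ.prod μ) ≤
      (m * q).factorial * 2 ^ (m * q) * ‖∑ i, c i • tensorPow q (φ i)‖ ^ (2 * m) := by
    -- Expand the `m`-th powers and apply Wick's formula: the pairings are the (mq)! permutations of
    -- the slots, and each is bounded by `sum_prod_inner_perm_le`.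
    have hval : ∫ z, ‖Q z‖ ^ (2 * m) ∂(μ.prod μ) = ∑ τ : Equiv.Perm (Fin m × Fin q), 2 ^ (m * q) *
        ∑ w : Fin m → ι, ∑ w' : Fin m → ι, (∏ l, c (w l)) * (∏ l, c (w' l)) *
        ∏ k : Fin m × Fin q, inner ℝ (φ (w k.1)) (φ (w' (τ k).1)) := by
      apply Complex.ofReal_injective
      rw [← integral_complex_ofReal]
      have e1 : ∀ z, ((‖Q z‖ ^ (2 * m) : ℝ) : ℂ) = ∑ w : Fin m → ι, ∑ w' : Fin m → ι,
          (∏ l, (c (w l) : ℂ)) * (∏ l, (c (w' l) : ℂ)) *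
          ((∏ k : Fin m × Fin q, U (w k.1) z) * ∏ k : Fin m × Fin q, U' (w' k.1) z) := by
        intro z
        rw [hnorm]
        simp only [Q, Q', expand]
        rw [Finset.sum_mul_sum]
        exact Finset.sum_congr rfl fun w _ => Finset.sum_congr rfl fun w' _ => by ring
      simp only [e1]
      have hi : ∀ w w' : Fin m → ι, Integrable (fun z => (∏ l, (c (w l) : ℂ)) * (∏ l, (c (w' l) : ℂ)) *
          ((∏ k : Fin m × Fin q, U (w k.1) z) * ∏ k : Fin m × Fin q, U' (w' k.1) z)) (μ.prod μ) :=
        fun w w' => ((HasMoments.prod _ fun k : Fin m × Fin q => hasMoments_clm (U (w k.1))).mul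
          (HasMoments.prod _ fun k : Fin m × Fin q => hasMoments_clm (U' (w' k.1)))).integrable.const_mul _
      rw [integral_finsetSum _ fun w _ => integrable_finsetSum _ fun w' _ => hi w w']
      simp only [integral_finsetSum _ fun w' _ => hi _ w', integral_const_mul, hwick]
      push_cast
      simp only [Finset.mul_sum]
      rw [Finset.sum_congr rfl fun w _ => Finset.sum_comm, Finset.sum_comm]
      refine Finset.sum_congr rfl fun τ _ => ?_
      exact Finset.sum_congr rfl fun w _ => Finset.sum_congr rfl fun w' _ => by ring
    rw [hval]
    have hcard : ((m * q).factorial : ℝ) = (Finset.univ : Finset (Equiv.Perm (Fin m × Fin q))).card := by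
      rw [Finset.card_univ, Fintype.card_perm]; simp
    rw [hcard, mul_assoc, ← nsmul_eq_mul]
    refine Finset.sum_le_card_nsmul _ _ _ fun τ _ => ?_
    exact mul_le_mul_of_nonneg_left (sum_prod_inner_perm_le φ c m q τ) (by positivity)
  -- The Hermite sum at x is the mean over y of `Q (x, y)`; Jensen's inequality gives the comparison
  -- of moments.
  refine le_trans ?_ hmain
  have hQi : Integrable (fun z => ‖Q z‖ ^ (2 * m)) (μ.prod μ) :=
    (HasMoments.pow (fun p hp => (hQ p hp).norm) (2 * m)).integrable
  rw [integral_prod _ hQi]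
  have hLint : HasMoments (fun x => ∑ i, c i * Polynomial.aeval (a i x) (Polynomial.hermite q)) μ :=
    HasMoments.sum _ fun i => (HasMoments.const _).mul ((hasMoments_clm (a i)).polynomial _)
  refine integral_mono (hLint.pow (2 * m)).integrable hQi.integral_prod_left fun x => ?_
  have hy : ∀ i, HasMoments (fun y => U i (x, y) ^ q) μ := fun i => by
    have : HasMoments (fun y => ((a i x : ℂ) + imagForm (a i) y)) μ :=
      (HasMoments.const _).add (hasMoments_clm _)
    simpa [U, ofRealForm_apply] using this.pow q
  have hQy : HasMoments (fun y => Q (x, y)) μ :=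
    HasMoments.sum _ fun i => (HasMoments.const _).mul (hy i)
  have e2 : ((∑ i, c i * Polynomial.aeval (a i x) (Polynomial.hermite q) : ℝ) : ℂ) =
      ∫ y, Q (x, y) ∂μ := by
    simp only [Q]
    rw [integral_finsetSum _ fun i _ => (hy i).integrable.const_mul _]
    push_cast
    refine Finset.sum_congr rfl fun i _ => ?_
    rw [integral_const_mul, aeval_hermite_eq_integral_form hμ (hone i)]
    simp [U, ofRealForm_apply]
  have h3 := pow_norm_integral_le hQy (2 * m)
  rw [← e2, Complex.norm_real, Real.norm_eq_abs, pow_mul, sq_abs, ← pow_mul] at h3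
  exact h3

end Hermite

/-! ### Characteristic functions of square integrable variables -/

section CharFun

variable {Ω : Type*} [MeasurableSpace Ω] {P : Measure Ω}

theorem coeFn_sum_smul {ι : Type*} (s : Finset ι) (c : ι → ℝ) (F : ι → Lp ℝ 2 P) :
    ((∑ i ∈ s, c i • F i : Lp ℝ 2 P) : Ω → ℝ) =ᵐ[P] fun ω => ∑ i ∈ s, c i * F i ω := by
  classical
  induction s using Finset.induction_on with
  | empty => simpa using! Lp.coeFn_zero ℝ 2 P
  | insert a s ha ih =>
    rw [Finset.sum_insert ha]
    filter_upwards [Lp.coeFn_add (c a • F a) (∑ i ∈ s, c i • F i), Lp.coeFn_smul (c a) (F a), ih]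
      with ω h1 h2 h3
    rw [h1, Pi.add_apply, h2, h3, Finset.sum_insert ha]
    simp

theorem aemeasurable_pi_Lp {ι : Type*} [Fintype ι] (F : ι → Lp ℝ 2 P) :
    AEMeasurable (fun ω i => F i ω) P :=
  aemeasurable_pi_lambda _ fun i => (Lp.aestronglyMeasurable (F i)).aemeasurable

theorem smul_sum_mem {H : Type*} [NormedAddCommGroup H] [InnerProductSpace ℝ H]
    {G : Submodule ℝ (H × Lp ℝ 2 P)} {ι : Type*} (s : Finset ι) (c : ι → ℝ) {x : ι → H × Lp ℝ 2 P}
    (hx : ∀ i, x i ∈ G) : (∑ i ∈ s, c i • (x i).1, ∑ i ∈ s, c i • (x i).2) ∈ G := by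
  have := G.sum_mem (t := s) fun i _ => G.smul_mem (c i) (hx i)
  convert this using 1
  ext1 <;> simp [Prod.fst_sum, Prod.snd_sum]

variable [IsProbabilityMeasure P]

/-- The characteristic function at `1` of an element of `L²`. -/
def expMean (F : Lp ℝ 2 P) : ℂ := ∫ ω, Complex.exp ((F ω : ℂ) * Complex.I) ∂P

theorem integrable_exp_mul_I {f : Ω → ℝ} (hf : AEStronglyMeasurable f P) :
    Integrable (fun ω => Complex.exp ((f ω : ℂ) * Complex.I)) P := by
  refine Integrable.of_bound (C := 1) ?_ (ae_of_all _ fun ω => by simp [Complex.norm_exp_ofReal_mul_I])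
  exact (by fun_prop : Continuous fun x : ℝ => Complex.exp ((x : ℂ) * Complex.I)).comp_aestronglyMeasurable hf

theorem norm_integral_le_norm_Lp (F : Lp ℝ 2 P) : ∫ ω, ‖F ω‖ ∂P ≤ ‖F‖ := by
  rw [integral_norm_eq_lintegral_enorm (Lp.aestronglyMeasurable F), Lp.norm_def]
  refine ENNReal.toReal_mono (Lp.eLpNorm_ne_top F) ?_
  rw [← eLpNorm_one_eq_lintegral_enorm]
  exact eLpNorm_le_eLpNorm_of_exponent_le (by norm_num) (Lp.aestronglyMeasurable F)

/-- The function e^{iu} is 1-Lipschitz, and on a probability space the L¹ norm is at most the L²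
norm. This continuity is what lets identities in law pass to L² limits. -/
theorem norm_expMean_sub_le (F G : Lp ℝ 2 P) : ‖expMean F - expMean G‖ ≤ ‖F - G‖ := by
  rw [expMean, expMean, ← integral_sub (integrable_exp_mul_I (Lp.aestronglyMeasurable F))
    (integrable_exp_mul_I (Lp.aestronglyMeasurable G))]
  refine (norm_integral_le_of_norm_le ((Lp.memLp (F - G)).integrable one_le_two).norm ?_).trans
    (norm_integral_le_norm_Lp (F - G))
  filter_upwards [Lp.coeFn_sub F G] with ω hω
  rw [hω, Pi.sub_apply]
  have e : Complex.exp ((F ω : ℂ) * Complex.I) - Complex.exp ((G ω : ℂ) * Complex.I) =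
      Complex.exp ((G ω : ℂ) * Complex.I) * (Complex.exp (Complex.I * ((F ω - G ω : ℝ) : ℂ)) - 1) := by
    rw [mul_sub, ← Complex.exp_add, mul_one]; congr 2; push_cast; ring
  rw [e, norm_mul, Complex.norm_exp_ofReal_mul_I, one_mul]
  exact Real.norm_exp_I_mul_ofReal_sub_one_le

theorem continuous_expMean : Continuous (expMean : Lp ℝ 2 P → ℂ) := by
  refine LipschitzWith.continuous (K := 1) (LipschitzWith.of_dist_le_mul fun F G => ?_)
  rw [dist_eq_norm, dist_eq_norm, NNReal.coe_one, one_mul]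
  exact norm_expMean_sub_le F G

omit [IsProbabilityMeasure P] in
theorem charFunDual_map_pi {ι : Type*} [Fintype ι] [DecidableEq ι] (F : ι → Lp ℝ 2 P)
    (L : StrongDual ℝ (ι → ℝ)) :
    charFunDual (P.map fun ω i => F i ω) L = expMean (∑ i, L (Pi.single i 1) • F i) := by
  have hm : AEMeasurable (fun ω i => F i ω) P :=
    aemeasurable_pi_lambda _ fun i => (Lp.aestronglyMeasurable (F i)).aemeasurable
  rw [charFunDual_apply, integral_map hm (by fun_prop), expMean]
  refine integral_congr_ae ?_
  filter_upwards [coeFn_sum_smul Finset.univ (fun i => L (Pi.single i 1)) F] with ω hω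
  rw [hω]
  congr 3
  conv_lhs => rw [pi_eq_sum_univ' (fun i => F i ω), map_sum]
  refine Finset.sum_congr rfl fun i _ => ?_
  rw [map_smul, smul_eq_mul, mul_comm]

/-- Finite families in `L²` whose linear combinations have the same characteristic functions are
identically distributed. -/
theorem identDistrib_of_expMean_eq {ι : Type*} [Fintype ι] {F G : ι → Lp ℝ 2 P}
    (h : ∀ c : ι → ℝ, expMean (∑ i, c i • F i) = expMean (∑ i, c i • G i)) :
    IdentDistrib (fun ω i => F i ω) (fun ω i => G i ω) P P := by
  classical
  refine ⟨aemeasurable_pi_Lp F, aemeasurable_pi_Lp G, ?_⟩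
  have := Measure.isProbabilityMeasure_map (aemeasurable_pi_Lp F)
  have := Measure.isProbabilityMeasure_map (aemeasurable_pi_Lp G)
  refine Measure.ext_of_charFunDual ?_
  ext L
  rw [charFunDual_map_pi, charFunDual_map_pi, h]

omit [IsProbabilityMeasure P] in
theorem expMean_eq_of_identDistrib {ι : Type*} [Fintype ι] {F G : ι → Lp ℝ 2 P}
    (h : IdentDistrib (fun ω i => F i ω) (fun ω i => G i ω) P P) (c : ι → ℝ) :
    expMean (∑ i, c i • F i) = expMean (∑ i, c i • G i) := by
  have hc : Measurable fun x : ι → ℝ => Complex.exp (((∑ i, c i * x i : ℝ) : ℂ) * Complex.I) := by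
    fun_prop
  have h1 := (h.comp hc).integral_eq
  have e : ∀ F : ι → Lp ℝ 2 P, expMean (∑ i, c i • F i) =
      ∫ ω, Complex.exp (((∑ i, c i * F i ω : ℝ) : ℂ) * Complex.I) ∂P := fun F => by
    refine integral_congr_ae ?_
    filter_upwards [coeFn_sum_smul Finset.univ c F] with ω hω
    rw [hω]
  rw [e, e]
  exact h1

/-- Equality in law passes to limits in `L²`. -/
theorem identDistrib_of_tendsto {ι κ : Type*} [Fintype ι] {l : Filter κ} [l.NeBot]
    {F G : ι → Lp ℝ 2 P} {Fn Gn : κ → ι → Lp ℝ 2 P}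
    (hF : ∀ i, Tendsto (fun n => Fn n i) l (𝓝 (F i)))
    (hG : ∀ i, Tendsto (fun n => Gn n i) l (𝓝 (G i)))
    (h : ∀ᶠ n in l, IdentDistrib (fun ω i => Fn n i ω) (fun ω i => Gn n i ω) P P) :
    IdentDistrib (fun ω i => F i ω) (fun ω i => G i ω) P P := by
  refine identDistrib_of_expMean_eq fun c => ?_
  have h1 : Tendsto (fun n => expMean (∑ i, c i • Fn n i)) l (𝓝 (expMean (∑ i, c i • F i))) :=
    (continuous_expMean.tendsto _).comp (tendsto_finsetSum _ fun i _ => (hF i).const_smul (c i))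
  have h2 : Tendsto (fun n => expMean (∑ i, c i • Gn n i)) l (𝓝 (expMean (∑ i, c i • G i))) :=
    (continuous_expMean.tendsto _).comp (tendsto_finsetSum _ fun i _ => (hG i).const_smul (c i))
  exact tendsto_nhds_unique_of_eventuallyEq h1 h2 (h.mono fun n hn => expMean_eq_of_identDistrib hn c)

end CharFun

/-! ### Gaussian subspaces -/

section GaussianGraph

variable {Ω : Type*} [MeasurableSpace Ω] {P : Measure Ω} [IsProbabilityMeasure P]
  {H : Type*} [NormedAddCommGroup H] [InnerProductSpace ℝ H]

/-- A linear space of pairs `(φ, F)` such that `F` is a centered Gaussian variable with variance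
`‖φ‖²`. -/
def IsGaussianGraph (G : Submodule ℝ (H × Lp ℝ 2 P)) : Prop :=
  ∀ x ∈ G, expMean x.2 = Complex.exp (-((‖x.1‖ ^ 2 : ℝ) : ℂ) / 2)

namespace IsGaussianGraph

variable {G : Submodule ℝ (H × Lp ℝ 2 P)}

/-- Both sides of the defining identity are continuous in the pair, so it survives closure. -/
theorem topologicalClosure (hG : IsGaussianGraph G) : IsGaussianGraph G.topologicalClosure := by
  have hc : IsClosed {x : H × Lp ℝ 2 P | expMean x.2 = Complex.exp (-((‖x.1‖ ^ 2 : ℝ) : ℂ) / 2)} :=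
    isClosed_eq (continuous_expMean.comp continuous_snd) (by fun_prop)
  exact fun x hx => closure_minimal hG hc hx

/-- The frequency 1 determines the whole characteristic function, because the space is stable under
multiplication by t. -/
theorem map_eq (hG : IsGaussianGraph G) {x : H × Lp ℝ 2 P} (hx : x ∈ G) :
    P.map x.2 = gaussianReal 0 (‖x.1‖ ^ 2).toNNReal := by
  have hm : AEMeasurable x.2 P := (Lp.aestronglyMeasurable x.2).aemeasurable
  have := Measure.isProbabilityMeasure_map hm
  refine Measure.ext_of_charFun ?_
  ext t
  rw [charFun_apply_real, charFun_gaussianReal, integral_map hm (by fun_prop)]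
  have h := hG _ (G.smul_mem t hx)
  have e : expMean (t • x).2 = ∫ ω, Complex.exp ((t : ℂ) * (x.2 ω : ℂ) * Complex.I) ∂P := by
    refine integral_congr_ae ?_
    filter_upwards [Lp.coeFn_smul t x.2] with ω hω
    rw [Prod.smul_snd, hω]
    simp
  rw [← e, h, Prod.smul_fst, norm_smul, Real.coe_toNNReal _ (by positivity)]
  congr 1
  rw [mul_pow, Real.norm_eq_abs, sq_abs]
  push_cast
  ring

theorem norm_eq (hG : IsGaussianGraph G) {x : H × Lp ℝ 2 P} (hx : x ∈ G) : ‖x.2‖ = ‖x.1‖ := by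
  have hm : AEMeasurable x.2 P := (Lp.aestronglyMeasurable x.2).aemeasurable
  have h1 : ‖x.2‖ ^ 2 = ‖x.1‖ ^ 2 := by
    rw [← real_inner_self_eq_norm_sq, L2.inner_def]
    have h2 := variance_fun_id_gaussianReal (μ := 0) (v := (‖x.1‖ ^ 2).toNNReal)
    rw [variance_of_integral_eq_zero (by fun_prop) (by simp), ← hG.map_eq hx,
      integral_map hm (by fun_prop), Real.coe_toNNReal _ (by positivity)] at h2
    rw [← h2]
    refine integral_congr_ae (ae_of_all _ fun ω => ?_)
    simp
  exact (sq_eq_sq₀ (norm_nonneg _) (norm_nonneg _)).1 h1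

theorem inner_eq (hG : IsGaussianGraph G) {x y : H × Lp ℝ 2 P} (hx : x ∈ G) (hy : y ∈ G) :
    inner ℝ x.2 y.2 = inner ℝ x.1 y.1 := by
  have h := hG.norm_eq (G.add_mem hx hy)
  simp only [Prod.snd_add, Prod.fst_add] at h
  rw [real_inner_eq_norm_add_mul_self_sub_norm_mul_self_sub_norm_mul_self_div_two, h, hG.norm_eq hx,
    hG.norm_eq hy, real_inner_eq_norm_add_mul_self_sub_norm_mul_self_sub_norm_mul_self_div_two]

theorem identDistrib (hG : IsGaussianGraph G) {ι : Type*} [Fintype ι] {x y : ι → H × Lp ℝ 2 P}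
    (hx : ∀ i, x i ∈ G) (hy : ∀ i, y i ∈ G)
    (h : ∀ i j, inner ℝ (x i).1 (x j).1 = inner ℝ (y i).1 (y j).1) :
    IdentDistrib (fun ω i => (x i).2 ω) (fun ω i => (y i).2 ω) P P := by
  refine identDistrib_of_expMean_eq fun c => ?_
  have h1 := hG _ (smul_sum_mem Finset.univ c hx)
  have h2 := hG _ (smul_sum_mem Finset.univ c hy)
  simp only at h1 h2
  have e : ‖∑ i, c i • (x i).1‖ ^ 2 = ‖∑ i, c i • (y i).1‖ ^ 2 := by
    rw [← real_inner_self_eq_norm_sq, ← real_inner_self_eq_norm_sq]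
    simp only [sum_inner, inner_sum, real_inner_smul_left, real_inner_smul_right, h]
  rw [h1, h2, e]

/-- A linear form of the vector is again the second component of an element of `G`, hence a centered
Gaussian variable. -/
theorem isGaussian_map (hG : IsGaussianGraph G) {ι : Type*} [Fintype ι] {x : ι → H × Lp ℝ 2 P}
    (hx : ∀ i, x i ∈ G) :
    IsGaussian (P.map fun ω i => (x i).2 ω) ∧
      (∀ L : StrongDual ℝ (ι → ℝ), ∫ v, L v ∂(P.map fun ω i => (x i).2 ω) = 0) ∧
      ∀ i j, ∫ v, ContinuousLinearMap.proj (R := ℝ) (φ := fun _ : ι => ℝ) i v *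
        ContinuousLinearMap.proj (R := ℝ) (φ := fun _ : ι => ℝ) j v ∂(P.map fun ω i => (x i).2 ω) =
        inner ℝ (x i).1 (x j).1 := by
  classical
  have hm := aemeasurable_pi_Lp fun i => (x i).2
  have key : ∀ L : StrongDual ℝ (ι → ℝ), ∃ v, (P.map fun ω i => (x i).2 ω).map L = gaussianReal 0 v := by
    intro L
    refine ⟨_, Eq.trans ?_ (hG.map_eq (smul_sum_mem Finset.univ (fun i => L (Pi.single i 1)) hx))⟩
    rw [AEMeasurable.map_map_of_aemeasurable (by fun_prop) hm]
    refine Measure.map_congr ?_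
    filter_upwards [coeFn_sum_smul Finset.univ (fun i => L (Pi.single i 1)) fun i => (x i).2] with ω hω
    rw [hω, Function.comp_apply]
    conv_lhs => rw [pi_eq_sum_univ' (fun i => (x i).2 ω), map_sum]
    refine Finset.sum_congr rfl fun i _ => ?_
    rw [map_smul, smul_eq_mul, mul_comm]
  refine ⟨isGaussian_of_map_eq_gaussianReal fun L => ⟨0, key L⟩, fun L => ?_, fun i j => ?_⟩
  · obtain ⟨v, hv⟩ := key L
    have h := integral_id_gaussianReal (μ := 0) (v := v)
    rw [← hv, integral_map (by fun_prop) (by fun_prop)] at h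
    exact h
  · rw [integral_map hm (by fun_prop), ← hG.inner_eq (hx i) (hx j), L2.inner_def]
    refine integral_congr_ae (ae_of_all _ fun ω => ?_)
    simp [mul_comm]

end IsGaussianGraph

end GaussianGraph

/-! ### The Wiener integral -/

section Wiener

variable {Ω : Type*} [MeasurableSpace Ω] {P : Measure Ω} {α β : Hurst} {W : ℝ → ℝ → Ω → ℝ}

theorem IsFractionalBrownianSheet.memLp {a b : ℝ} (hW : IsFractionalBrownianSheet a b W P)
    (p : I × I) : MemLp (W p.1 p.2) 2 P :=
  (hW.gaussian.hasGaussianLaw_eval p).memLp_two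

/-- It suffices to treat finite linear combinations of values of the sheet. These are centered
Gaussian, and their variance, computed from the covariance of the sheet, is the squared norm of the
same combination of boxes. -/
theorem isGaussianGraph_wienerGraph [IsProbabilityMeasure P] (hW : IsFractionalBrownianSheet α β W P) :
    IsGaussianGraph (wienerGraph α β W P) := by
  classical
  refine IsGaussianGraph.topologicalClosure ?_
  let v : I × I → CanonicalSpace α β × Lp ℝ 2 P := fun p => (box α β p, (hW.memLp p).toLp _)
  have hset : {x : CanonicalSpace α β × Lp ℝ 2 P |
      ∃ p : I × I, x.1 = box α β p ∧ x.2 =ᵐ[P] W p.1 p.2} ⊆ range v := by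
    rintro ⟨φ, F⟩ ⟨p, h1, h2⟩
    refine ⟨p, Prod.ext h1.symm ?_⟩
    exact Lp.ext ((hW.memLp p).coeFn_toLp.trans h2.symm)
  intro x hx
  obtain ⟨c, rfl⟩ := Finsupp.mem_span_range_iff_exists_finsupp.1 (Submodule.span_mono hset hx)
  have hlaw := hW.gaussian.hasGaussianLaw c.support
  let L : StrongDual ℝ (c.support → ℝ) := ∑ p : c.support, c p • ContinuousLinearMap.proj p
  have hL : HasGaussianLaw (fun ω => ∑ p ∈ c.support, c p * W p.1 p.2 ω) P := by
    have h := hlaw.map_fun L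
    refine h.congr (ae_of_all _ fun ω => ?_)
    simp only [L, sum_apply, smul_apply,
      ContinuousLinearMap.proj_apply, smul_eq_mul, Finset.restrict]
    exact Finset.sum_coe_sort c.support fun p => c p * W p.1 p.2 ω
  have hi : ∀ p : I × I, Integrable (W p.1 p.2) P := fun p => (hW.memLp p).integrable one_le_two
  have hmean : ∫ ω, ∑ p ∈ c.support, c p * W p.1 p.2 ω ∂P = 0 := by
    rw [integral_finsetSum _ fun p _ => (hi p).const_mul _]
    refine Finset.sum_eq_zero fun p _ => ?_
    rw [integral_const_mul, hW.centered _ p.1.2 _ p.2.2, mul_zero]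
  have hvar : Var[fun ω => ∑ p ∈ c.support, c p * W p.1 p.2 ω; P] =
      ‖(c.sum fun p a => a • v p).1‖ ^ 2 := by
    rw [variance_of_integral_eq_zero hL.aemeasurable hmean, ← real_inner_self_eq_norm_sq]
    have e1 : (c.sum fun p a => a • v p).1 = ∑ p ∈ c.support, c p • box α β p := by
      simp [Finsupp.sum, Prod.fst_sum, v]
    rw [e1]
    have hi2 : ∀ p r : I × I, Integrable (fun ω => W p.1 p.2 ω * W r.1 r.2 ω) P := fun p r =>
      (hW.memLp p).integrable_mul (hW.memLp r)
    have e2 : ∀ ω, (∑ p ∈ c.support, c p * W p.1 p.2 ω) ^ 2 =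
        ∑ p ∈ c.support, ∑ r ∈ c.support, c p * c r * (W p.1 p.2 ω * W r.1 r.2 ω) := by
      intro ω
      rw [sq, Finset.sum_mul_sum]
      exact Finset.sum_congr rfl fun p _ => Finset.sum_congr rfl fun r _ => by ring
    simp only [e2]
    rw [integral_finsetSum _ fun p _ => integrable_finsetSum _ fun r _ => (hi2 p r).const_mul _]
    simp only [sum_inner, inner_sum, real_inner_smul_left, real_inner_smul_right, inner_box]
    rw [Finset.sum_comm]
    refine Finset.sum_congr rfl fun p _ => ?_
    rw [integral_finsetSum _ fun r _ => (hi2 p r).const_mul _]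
    refine Finset.sum_congr rfl fun r _ => ?_
    rw [integral_const_mul, hW.covariance _ p.1.2 _ p.2.2 _ r.1.2 _ r.2.2]
    ring
  have hmap := hL.map_eq_gaussianReal
  rw [hmean, hvar] at hmap
  have hch := congrArg (fun μ => charFun μ 1) hmap
  rw [charFun_gaussianReal, charFun_apply_real, integral_map hL.aemeasurable (by fun_prop), Real.coe_toNNReal _ (by positivity)] at hch
  have e3 : ((c.sum fun p a => a • v p).2 : Ω → ℝ) =ᵐ[P] fun ω => ∑ p ∈ c.support, c p * W p.1 p.2 ω := by
    have e4 : (c.sum fun p a => a • v p).2 = ∑ p ∈ c.support, c p • (hW.memLp p).toLp _ := by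
      simp [Finsupp.sum, Prod.snd_sum, v]
    rw [e4]
    refine (coeFn_sum_smul _ _ _).trans ?_
    have := (Finset.eventually_all c.support).2 fun p _ => (hW.memLp p).coeFn_toLp
    filter_upwards [this] with ω hω
    exact Finset.sum_congr rfl fun p hp => by rw [hω p hp]
  rw [expMean]
  calc ∫ ω, Complex.exp ((((c.sum fun p a => a • v p).2 : Ω → ℝ) ω : ℂ) * Complex.I) ∂P
      = ∫ ω, Complex.exp (((1 : ℝ) : ℂ) * ((∑ p ∈ c.support, c p * W p.1 p.2 ω : ℝ) : ℂ) * Complex.I) ∂P := by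
        refine integral_congr_ae ?_
        filter_upwards [e3] with ω hω
        rw [hω]; simp
    _ = _ := by
        rw [hch]; congr 1; simp; ring

theorem exists_box_mem_wienerGraph (hW : IsFractionalBrownianSheet α β W P) (p : I × I) :
    ∃ F, (box α β p, F) ∈ wienerGraph α β W P :=
  ⟨(hW.memLp p).toLp _, Submodule.le_topologicalClosure _
    (Submodule.subset_span ⟨p, rfl, (hW.memLp p).coeFn_toLp⟩)⟩

theorem exists_rect_mem_wienerGraph (hW : IsFractionalBrownianSheet α β W P) (a b c d : ℝ) :
    ∃ F, (rect α β a b c d, F) ∈ wienerGraph α β W P := by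
  choose F hF using exists_box_mem_wienerGraph hW
  let x : ℝ → I := projIcc 0 1 zero_le_one
  exact ⟨F (x b, x d) - F (x a, x d) - F (x b, x c) + F (x a, x c),
    Submodule.add_mem _ (Submodule.sub_mem _ (Submodule.sub_mem _ (hF _) (hF _)) (hF _)) (hF _)⟩

end Wiener

/-! ### Multiple integrals -/

theorem inner_tensorPow {E : Type*} [NormedAddCommGroup E] [InnerProductSpace ℝ E] (q : ℕ)
    (x y : E) : inner ℝ (tensorPow q x) (tensorPow q y) = inner ℝ x y ^ q := by
  simp [tensorPow, inner_elemTensor]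

/-- Elementary tensors are known through their scalar products, so an identity between them is
checked by expanding the squared norm of the difference. -/
theorem tensorPow_smul {E : Type*} [NormedAddCommGroup E] [InnerProductSpace ℝ E] (q : ℕ)
    (c : ℝ) (x : E) : tensorPow q (c • x) = c ^ q • tensorPow q x := by
  rw [← sub_eq_zero, ← inner_self_eq_zero (𝕜 := ℝ)]
  simp only [inner_sub_left, inner_sub_right, real_inner_smul_left, real_inner_smul_right,
    inner_tensorPow, mul_pow]
  ring

theorem factorial_mul_hermitePoly (q : ℕ) (x : ℝ) :
    (q.factorial : ℝ) * hermitePoly q x = Polynomial.aeval x (Polynomial.hermite q) := by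
  rw [hermitePoly, ← mul_assoc, mul_inv_cancel₀ (by positivity), one_mul]

section MultipleIntegral

variable {Ω : Type*} [MeasurableSpace Ω] {P : Measure Ω} [IsProbabilityMeasure P] {α β : Hurst}
  {W : ℝ → ℝ → Ω → ℝ}

theorem IsGaussianGraph.hasMoments {H : Type*} [NormedAddCommGroup H] [InnerProductSpace ℝ H]
    {G : Submodule ℝ (H × Lp ℝ 2 P)} (hG : IsGaussianGraph G) {x : H × Lp ℝ 2 P} (hx : x ∈ G) :
    HasMoments (fun ω => x.2 ω) P := by
  intro p hp
  have hm : AEMeasurable x.2 P := (Lp.aestronglyMeasurable x.2).aemeasurable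
  have h := memLp_id_gaussianReal' (μ := 0) (v := (‖x.1‖ ^ 2).toNNReal) p hp
  rw [← hG.map_eq hx, memLp_map_measure_iff aestronglyMeasurable_id hm] at h
  exact h

omit [IsProbabilityMeasure P] in
/-- An element of the span of the Hermite polynomials `He_q(F)`, `F` standard Gaussian, with the
corresponding tensor, in an explicit form. -/
theorem exists_of_mem_span {q : ℕ} {x : TensorPower (CanonicalSpace α β) q × Lp ℝ 2 P}
    (hx : x ∈ Submodule.span ℝ {x : TensorPower (CanonicalSpace α β) q × Lp ℝ 2 P |
      ∃ (φ : CanonicalSpace α β) (F : Lp ℝ 2 P), (φ, F) ∈ wienerGraph α β W P ∧ ‖φ‖ = 1 ∧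
        x.1 = tensorPow q φ ∧ x.2 =ᵐ[P] fun ω => (q.factorial : ℝ) * hermitePoly q (F ω)}) :
    ∃ (n : ℕ) (c : Fin n → ℝ) (y : Fin n → CanonicalSpace α β × Lp ℝ 2 P)
      (T : Fin n → Lp ℝ 2 P), (∀ i, y i ∈ wienerGraph α β W P) ∧ (∀ i, ‖(y i).1‖ = 1) ∧
      (∀ i, T i =ᵐ[P] fun ω => Polynomial.aeval ((y i).2 ω) (Polynomial.hermite q)) ∧
      x.1 = ∑ i, c i • tensorPow q (y i).1 ∧ x.2 = ∑ i, c i • T i := by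
  obtain ⟨n, c, g, rfl⟩ := Submodule.mem_span_set'.1 hx
  choose φ F hG h1 h2 h3 using fun i => (g i).2
  refine ⟨n, c, fun i => (φ i, F i), fun i => (g i).1.2, hG, h1, fun i => ?_, ?_, ?_⟩
  · simpa only [factorial_mul_hermitePoly] using h3 i
  · simp [Prod.fst_sum, h2]
  · simp [Prod.snd_sum]

theorem inner_hermite {G : Submodule ℝ (CanonicalSpace α β × Lp ℝ 2 P)} (hG : IsGaussianGraph G)
    {q n : ℕ} {y : Fin n → CanonicalSpace α β × Lp ℝ 2 P} {T : Fin n → Lp ℝ 2 P}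
    (hy : ∀ i, y i ∈ G) (h1 : ∀ i, ‖(y i).1‖ = 1)
    (hT : ∀ i, T i =ᵐ[P] fun ω => Polynomial.aeval ((y i).2 ω) (Polynomial.hermite q))
    (i j : Fin n) : inner ℝ (T i) (T j) = q.factorial * inner ℝ (y i).1 (y j).1 ^ q := by
  obtain ⟨hg, h0, hcov⟩ := hG.isGaussian_map hy
  have hone : ∀ i, _ = (1 : ℝ) := fun i => (hcov i i).trans
    (by rw [real_inner_self_eq_norm_sq, h1, one_pow])
  have h := integral_hermite_mul_hermite h0 (hone i) (hone j) q
  rw [hcov, integral_map (aemeasurable_pi_Lp fun i => (y i).2)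
    (Continuous.aestronglyMeasurable (by fun_prop))] at h
  rw [← h, L2.inner_def]
  refine integral_congr_ae ?_
  filter_upwards [hT i, hT j] with ω hi hj
  rw [hi, hj]
  simp [mul_comm]

/-- The Itô isometry. The relation is closed, so it is enough to verify it on finite combinations of
Hermite polynomials, where it follows from their covariances. It makes the graph single-valued with
a closed domain. -/
theorem norm_sq_of_mem_multipleIntegralGraph (hW : IsFractionalBrownianSheet α β W P) {q : ℕ}
    {x : TensorPower (CanonicalSpace α β) q × Lp ℝ 2 P} (hx : x ∈ multipleIntegralGraph α β q W P) :
    ‖x.2‖ ^ 2 = q.factorial * ‖x.1‖ ^ 2 := by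
  have hc : IsClosed {x : TensorPower (CanonicalSpace α β) q × Lp ℝ 2 P |
      ‖x.2‖ ^ 2 = q.factorial * ‖x.1‖ ^ 2} := isClosed_eq (by fun_prop) (by fun_prop)
  refine closure_minimal (fun x hx => ?_) hc hx
  obtain ⟨n, c, y, T, hy, h1, hT, hx1, hx2⟩ := exists_of_mem_span hx
  have hin := inner_hermite (isGaussianGraph_wienerGraph hW) hy h1 hT
  rw [mem_ofPred_eq, hx1, hx2, ← real_inner_self_eq_norm_sq, ← real_inner_self_eq_norm_sq]
  simp only [sum_inner, inner_sum, real_inner_smul_left, real_inner_smul_right, hin, inner_tensorPow,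
    Finset.mul_sum]
  exact Finset.sum_congr rfl fun i _ => Finset.sum_congr rfl fun j _ => by ring

theorem inner_of_mem_multipleIntegralGraph (hW : IsFractionalBrownianSheet α β W P) {q : ℕ}
    {x y : TensorPower (CanonicalSpace α β) q × Lp ℝ 2 P}
    (hx : x ∈ multipleIntegralGraph α β q W P) (hy : y ∈ multipleIntegralGraph α β q W P) :
    inner ℝ x.2 y.2 = q.factorial * inner ℝ x.1 y.1 := by
  have h := norm_sq_of_mem_multipleIntegralGraph hW (Submodule.add_mem _ hx hy)
  have h1 := norm_sq_of_mem_multipleIntegralGraph hW hx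
  have h2 := norm_sq_of_mem_multipleIntegralGraph hW hy
  simp only [Prod.snd_add, Prod.fst_add] at h
  rw [norm_add_sq_real, norm_add_sq_real] at h
  linarith

theorem integral_of_mem_multipleIntegralGraph (hW : IsFractionalBrownianSheet α β W P) {q : ℕ}
    (hq : 1 ≤ q) {x : TensorPower (CanonicalSpace α β) q × Lp ℝ 2 P}
    (hx : x ∈ multipleIntegralGraph α β q W P) : ∫ ω, x.2 ω ∂P = 0 := by
  have hG := isGaussianGraph_wienerGraph hW
  -- The mean is the scalar product with the constant 1, hence continuous on L².
  have e : ∀ F : Lp ℝ 2 P, ∫ ω, F ω ∂P =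
      inner ℝ (indicatorConstLp 2 MeasurableSet.univ (measure_ne_top P univ) (1 : ℝ)) F := fun F => by
    rw [L2.inner_indicatorConstLp_one]; simp
  have hc : IsClosed {x : TensorPower (CanonicalSpace α β) q × Lp ℝ 2 P | ∫ ω, x.2 ω ∂P = 0} := by
    simp only [e]
    exact isClosed_eq (by fun_prop) (by fun_prop)
  refine closure_minimal (fun x hx => ?_) hc hx
  obtain ⟨n, c, y, T, hy, h1, hT, hx1, hx2⟩ := exists_of_mem_span hx
  rw [mem_ofPred_eq, hx2, e, inner_sum]
  refine Finset.sum_eq_zero fun i _ => ?_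
  rw [inner_smul_right, ← e, integral_congr_ae (hT i)]
  have h := integral_hermite_gaussianReal hq
  have hmap := hG.map_eq (hy i)
  rw [h1, one_pow, Real.toNNReal_one] at hmap
  rw [← hmap, integral_map (Lp.aestronglyMeasurable _).aemeasurable
    (Continuous.aestronglyMeasurable (by fun_prop))] at h
  rw [h, mul_zero]

/-- On the span this is the chaos moment bound. L² limits are reached by Fatou's lemma along an
almost surely convergent subsequence. -/
theorem lintegral_pow_of_mem_multipleIntegralGraph (hW : IsFractionalBrownianSheet α β W P)
    {q : ℕ} (m : ℕ) {x : TensorPower (CanonicalSpace α β) q × Lp ℝ 2 P}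
    (hx : x ∈ multipleIntegralGraph α β q W P) :
    ∫⁻ ω, ENNReal.ofReal (x.2 ω ^ (2 * m)) ∂P ≤
      ENNReal.ofReal ((m * q).factorial * 2 ^ (m * q) * ‖x.1‖ ^ (2 * m)) := by
  have hG := isGaussianGraph_wienerGraph hW
  obtain ⟨u, hu, hlim⟩ := mem_closure_iff_seq_limit.1 (show x ∈ closure _ from hx)
  have hspan : ∀ k, ∫⁻ ω, ENNReal.ofReal ((u k).2 ω ^ (2 * m)) ∂P ≤
      ENNReal.ofReal ((m * q).factorial * 2 ^ (m * q) * ‖(u k).1‖ ^ (2 * m)) := by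
    intro k
    obtain ⟨n, c, y, T, hy, h1, hT, hx1, hx2⟩ := exists_of_mem_span (hu k)
    obtain ⟨hg, h0, hcov⟩ := hG.isGaussian_map hy
    have h := integral_sum_hermite_pow_le h0 _ (fun i => (y i).1) hcov h1 c q m
    rw [integral_map (aemeasurable_pi_Lp fun i => (y i).2)
      (Continuous.aestronglyMeasurable (by fun_prop)), ← hx1] at h
    have hcongr : (fun ω => (u k).2 ω ^ (2 * m)) =ᵐ[P] fun ω =>
        (∑ i, c i * Polynomial.aeval ((y i).2 ω) (Polynomial.hermite q)) ^ (2 * m) := by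
      rw [hx2]
      filter_upwards [coeFn_sum_smul Finset.univ c T, ae_all_iff.2 hT] with ω h2 h3
      simp only [h2, h3]
    have hint : Integrable (fun ω => (u k).2 ω ^ (2 * m)) P :=
      ((HasMoments.sum _ fun i => (HasMoments.const (c i)).mul
        ((hG.hasMoments (hy i)).polynomial (Polynomial.hermite q))).pow (2 * m)).integrable.congr
        hcongr.symm
    rw [← ofReal_integral_eq_lintegral_ofReal hint
      (ae_of_all _ fun ω => (even_two_mul m).pow_nonneg _)]
    refine ENNReal.ofReal_le_ofReal ?_
    rw [integral_congr_ae hcongr]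
    exact h
  have hlim2 : Tendsto (fun k => (u k).2) atTop (𝓝 x.2) := (continuous_snd.tendsto x).comp hlim
  have hlim1 : Tendsto (fun k => (u k).1) atTop (𝓝 x.1) := (continuous_fst.tendsto x).comp hlim
  obtain ⟨ns, hns, hae⟩ := (tendstoInMeasure_of_tendsto_Lp hlim2).exists_seq_tendsto_ae
  have hmeas : ∀ k, Measurable fun ω => ENNReal.ofReal ((u (ns k)).2 ω ^ (2 * m)) := fun k =>
    ENNReal.measurable_ofReal.comp ((Lp.stronglyMeasurable _).measurable.pow_const _)
  calc ∫⁻ ω, ENNReal.ofReal (x.2 ω ^ (2 * m)) ∂P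
      = ∫⁻ ω, liminf (fun k => ENNReal.ofReal ((u (ns k)).2 ω ^ (2 * m))) atTop ∂P := by
        refine lintegral_congr_ae ?_
        filter_upwards [hae] with ω hω
        exact ((ENNReal.tendsto_ofReal (hω.pow (2 * m))).liminf_eq).symm
    _ ≤ liminf (fun k => ∫⁻ ω, ENNReal.ofReal ((u (ns k)).2 ω ^ (2 * m)) ∂P) atTop :=
        lintegral_liminf_le hmeas
    _ ≤ liminf (fun k => ENNReal.ofReal ((m * q).factorial * 2 ^ (m * q) *
          ‖(u (ns k)).1‖ ^ (2 * m))) atTop := liminf_le_liminf (Eventually.of_forall fun k => hspan _)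
    _ = _ := by
        refine Tendsto.liminf_eq (ENNReal.tendsto_ofReal (Tendsto.const_mul _ ?_))
        exact (hlim1.norm.pow (2 * m)).comp hns.tendsto_atTop

theorem norm_sub_of_mem_multipleIntegralGraph (hW : IsFractionalBrownianSheet α β W P) {q : ℕ}
    {x y : TensorPower (CanonicalSpace α β) q} {F G : Lp ℝ 2 P}
    (hx : (x, F) ∈ multipleIntegralGraph α β q W P)
    (hy : (y, G) ∈ multipleIntegralGraph α β q W P) :
    ‖F - G‖ = √(q.factorial * ‖x - y‖ ^ 2) := by
  have h1 := norm_sq_of_mem_multipleIntegralGraph hW hx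
  have h2 := norm_sq_of_mem_multipleIntegralGraph hW hy
  have h3 := inner_of_mem_multipleIntegralGraph hW hx hy
  dsimp only at h1 h2 h3
  rw [← Real.sqrt_sq (norm_nonneg (F - G)), norm_sub_sq_real, norm_sub_sq_real, h1, h2, h3]
  congr 1
  ring

theorem tendsto_of_mem_multipleIntegralGraph (hW : IsFractionalBrownianSheet α β W P) {q : ℕ}
    {κ : Type*} {l : Filter κ} {f : κ → TensorPower (CanonicalSpace α β) q} {g : κ → Lp ℝ 2 P}
    {x : TensorPower (CanonicalSpace α β) q} {F : Lp ℝ 2 P}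
    (hfg : ∀ n, (f n, g n) ∈ multipleIntegralGraph α β q W P)
    (hx : (x, F) ∈ multipleIntegralGraph α β q W P) (hf : Tendsto f l (𝓝 x)) :
    Tendsto g l (𝓝 F) := by
  rw [tendsto_iff_norm_sub_tendsto_zero] at hf ⊢
  have h : ∀ n, ‖g n - F‖ = √(q.factorial * ‖f n - x‖ ^ 2) := fun n =>
    norm_sub_of_mem_multipleIntegralGraph hW (hfg n) hx
  simp only [h]
  have := ((hf.pow 2).const_mul (q.factorial : ℝ)).sqrt
  simpa using this

/-- By the isometry the integrals are Cauchy when the kernels are; the graph is closed, so their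
limit is the integral of the limit kernel. -/
theorem exists_mem_multipleIntegralGraph_of_tendsto (hW : IsFractionalBrownianSheet α β W P)
    {q : ℕ} {κ : Type*} {l : Filter κ} [l.NeBot] {f : κ → TensorPower (CanonicalSpace α β) q}
    {g : κ → Lp ℝ 2 P} {x : TensorPower (CanonicalSpace α β) q}
    (hfg : ∀ n, (f n, g n) ∈ multipleIntegralGraph α β q W P) (hf : Tendsto f l (𝓝 x)) :
    ∃ F, (x, F) ∈ multipleIntegralGraph α β q W P := by
  have hcf : Cauchy (map f l) := hf.cauchy_map
  have hcg : Cauchy (map g l) := by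
    rw [cauchy_map_iff, tendsto_uniformity_iff_dist_tendsto_zero] at hcf ⊢
    refine ⟨hcf.1, ?_⟩
    have h : ∀ p : κ × κ, dist (g p.1) (g p.2) = √(q.factorial * dist (f p.1) (f p.2) ^ 2) := by
      intro p
      rw [dist_eq_norm, dist_eq_norm]
      exact norm_sub_of_mem_multipleIntegralGraph hW (hfg p.1) (hfg p.2)
    simp only [h]
    have := ((hcf.2.pow 2).const_mul (q.factorial : ℝ)).sqrt
    simpa using this
  obtain ⟨F, hF⟩ := CompleteSpace.complete hcg
  refine ⟨F, ?_⟩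
  have hclosed : IsClosed (multipleIntegralGraph α β q W P :
    Set (TensorPower (CanonicalSpace α β) q × Lp ℝ 2 P)) := Submodule.isClosed_topologicalClosure _
  exact hclosed.mem_of_tendsto (hf.prodMk_nhds hF) (Eventually.of_forall hfg)

theorem eq_of_mem_multipleIntegralGraph (hW : IsFractionalBrownianSheet α β W P) {q : ℕ}
    {x : TensorPower (CanonicalSpace α β) q} {F F' : Lp ℝ 2 P}
    (h : (x, F) ∈ multipleIntegralGraph α β q W P)
    (h' : (x, F') ∈ multipleIntegralGraph α β q W P) : F = F' := by
  have := norm_sub_of_mem_multipleIntegralGraph hW h h'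
  simpa [sub_eq_zero] using this

/-- The multiple integral of `φ^{⊗q}` is `‖φ‖^q He_q(W(φ)/‖φ‖)`. -/
theorem exists_tensorPow_mem_multipleIntegralGraph (hW : IsFractionalBrownianSheet α β W P) {q : ℕ}
    (hq : 1 ≤ q) {φ : CanonicalSpace α β} {F : Lp ℝ 2 P} (hφ : (φ, F) ∈ wienerGraph α β W P) :
    ∃ T, (tensorPow q φ, T) ∈ multipleIntegralGraph α β q W P ∧
      T =ᵐ[P] fun ω => ‖φ‖ ^ q * Polynomial.aeval (F ω / ‖φ‖) (Polynomial.hermite q) := by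
  have hq0 : q ≠ 0 := by omega
  -- The normalization of φ fails at 0; there both the tensor power and the factor ‖φ‖^q vanish,
  -- because q ≥ 1.
  rcases eq_or_ne φ 0 with rfl | h0
  · refine ⟨0, ?_, ?_⟩
    · have : tensorPow q (0 : CanonicalSpace α β) = 0 := by
        have := tensorPow_smul q 0 (0 : CanonicalSpace α β)
        simpa [hq0] using this
      rw [this]
      exact Submodule.zero_mem _
    · filter_upwards [Lp.coeFn_zero ℝ 2 P] with ω _
      simp [hq0]
  have hn : ‖φ‖ ≠ 0 := norm_ne_zero_iff.2 h0
  have hunit := Submodule.smul_mem _ ‖φ‖⁻¹ hφ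
  rw [Prod.smul_mk] at hunit
  have hmem := (isGaussianGraph_wienerGraph hW).hasMoments hunit
  have hL : MemLp (fun ω => Polynomial.aeval ((‖φ‖⁻¹ • F : Lp ℝ 2 P) ω) (Polynomial.hermite q)) 2 P :=
    hmem.polynomial _ 2 (by simp)
  have hgen : (tensorPow q (‖φ‖⁻¹ • φ), hL.toLp _) ∈ multipleIntegralGraph α β q W P := by
    refine Submodule.le_topologicalClosure _ (Submodule.subset_span ⟨_, _, hunit, ?_, rfl, ?_⟩)
    · rw [norm_smul, norm_inv, norm_norm, inv_mul_cancel₀ hn]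
    · simpa only [factorial_mul_hermitePoly] using hL.coeFn_toLp
  refine ⟨‖φ‖ ^ q • hL.toLp _, ?_, ?_⟩
  · have h := Submodule.smul_mem _ (‖φ‖ ^ q) hgen
    rw [Prod.smul_mk, ← tensorPow_smul, smul_smul, mul_inv_cancel₀ hn, one_smul] at h
    exact h
  · filter_upwards [Lp.coeFn_smul (‖φ‖ ^ q) (hL.toLp _), hL.coeFn_toLp, Lp.coeFn_smul ‖φ‖⁻¹ F]
      with ω h1 h2 h3
    rw [h1, Pi.smul_apply, h2, h3, Pi.smul_apply, smul_eq_mul, smul_eq_mul, inv_mul_eq_div]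

end MultipleIntegral

/-! ### Grid kernels and their limits -/

/-- Only differences of times remain, which makes translation invariance and homogeneity of degree
2γ visible. -/
theorem fbmIncr_eq_abs (γ a b c d : ℝ) : fbmIncr γ a b c d =
    (|a - d| ^ (2 * γ) + |b - c| ^ (2 * γ) - |b - d| ^ (2 * γ) - |a - c| ^ (2 * γ)) / 2 := by
  simp only [fbmIncr, fbmCov]; ring

theorem fbmIncr_add (γ x a b c d : ℝ) :
    fbmIncr γ (x + a) (x + b) (x + c) (x + d) = fbmIncr γ a b c d := by
  simp only [fbmIncr_eq_abs, add_sub_add_left_eq_sub]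

theorem fbmIncr_mul (γ : ℝ) {r : ℝ} (hr : 0 ≤ r) (a b c d : ℝ) :
    fbmIncr γ (r * a) (r * b) (r * c) (r * d) = r ^ (2 * γ) * fbmIncr γ a b c d := by
  simp only [fbmIncr_eq_abs, ← mul_sub, abs_mul, abs_of_nonneg hr, Real.mul_rpow hr (abs_nonneg _)]
  ring

theorem fbmCov_zero_left {γ x : ℝ} (hγ : 0 < γ) (hx : 0 ≤ x) : fbmCov γ 0 x = 0 := by
  simp [fbmCov, abs_of_nonneg hx, Real.zero_rpow (by positivity : (2 * γ) ≠ 0)]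

theorem fbmCov_zero_right {γ x : ℝ} (hγ : 0 < γ) (hx : 0 ≤ x) : fbmCov γ x 0 = 0 := by
  simp [fbmCov, abs_of_nonneg hx, Real.zero_rpow (by positivity : (2 * γ) ≠ 0)]

theorem inner_rect (α β : Hurst) {a b c d a' b' c' d' : ℝ} (ha : a ∈ I) (hb : b ∈ I) (hc : c ∈ I)
    (hd : d ∈ I) (ha' : a' ∈ I) (hb' : b' ∈ I) (hc' : c' ∈ I) (hd' : d' ∈ I) :
    inner ℝ (rect α β a b c d) (rect α β a' b' c' d') =
      fbmIncr α a b a' b' * fbmIncr β c d c' d' := by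
  simp only [rect, inner_add_left, inner_sub_left, inner_add_right, inner_sub_right, inner_box,
    projIcc_of_mem zero_le_one ha, projIcc_of_mem zero_le_one hb, projIcc_of_mem zero_le_one hc,
    projIcc_of_mem zero_le_one hd, projIcc_of_mem zero_le_one ha', projIcc_of_mem zero_le_one hb',
    projIcc_of_mem zero_le_one hc', projIcc_of_mem zero_le_one hd', fbmIncr]
  ring

/-- The normalized sum of the tensor powers of the cells of the grid with origin `(a,c)`, meshes
`δ`, `δ'` and `n × m` cells. -/
def gridKernel (α β : Hurst) (q : ℕ) (a δ : ℝ) (n : ℕ) (c δ' : ℝ) (m : ℕ) :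
    TensorPower (CanonicalSpace α β) q :=
  ((q.factorial : ℝ)⁻¹ * √(q.factorial / (kappa q α * kappa q β)) *
      (δ⁻¹ ^ (q - 1) * δ'⁻¹ ^ (q - 1))) •
    ∑ i ∈ Finset.range n, ∑ j ∈ Finset.range m,
      tensorPow q (rect α β (a + i * δ) (a + (i + 1) * δ) (c + j * δ') (c + (j + 1) * δ'))

/-- The kernels of the statement are grids with origin 0 and meshes 1/N, 1/M. General grids are
needed to compare them with translated and dilated ones. -/
theorem approxKernel_eq_gridKernel (α β : Hurst) (q : ℕ) (s t : ℝ) (N M : ℕ) :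
    approxKernel α β q s t N M = gridKernel α β q 0 (N : ℝ)⁻¹ (⌊((N : ℝ) - 1) * s⌋₊ + 1)
      0 (M : ℝ)⁻¹ (⌊((M : ℝ) - 1) * t⌋₊ + 1) := by
  simp only [approxKernel, gridKernel, normalization, div_eq_mul_inv, zero_add, inv_inv, mul_assoc]

theorem grid_mem {a δ : ℝ} {n i : ℕ} (ha : 0 ≤ a) (hδ : 0 ≤ δ) (h : a + n * δ ≤ 1) (hi : i < n) :
    a + i * δ ∈ I ∧ a + (i + 1) * δ ∈ I := by
  have h1 : ((i : ℝ) + 1) * δ ≤ n * δ := mul_le_mul_of_nonneg_right (by exact_mod_cast hi) hδ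
  have h2 : (0 : ℝ) ≤ i * δ := by positivity
  exact ⟨⟨by linarith, by linarith⟩, ⟨by linarith, by linarith⟩⟩

/-- The covariance of two cells is a product over the coordinates, so the fourfold sum splits. The
grids must stay in the unit square because `rect` projects coordinates onto it. -/
theorem inner_gridKernel {α β : Hurst} {q : ℕ} (hκ : 0 < kappa q α * kappa q β)
    {a δ c δ' a₂ δ₂ c₂ δ₂' : ℝ} {n m n₂ m₂ : ℕ} (ha : 0 ≤ a) (hδ : 0 ≤ δ) (hn : a + n * δ ≤ 1)
    (hc : 0 ≤ c) (hδ' : 0 ≤ δ') (hm : c + m * δ' ≤ 1) (ha₂ : 0 ≤ a₂) (hδ₂ : 0 ≤ δ₂)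
    (hn₂ : a₂ + n₂ * δ₂ ≤ 1) (hc₂ : 0 ≤ c₂) (hδ₂' : 0 ≤ δ₂') (hm₂ : c₂ + m₂ * δ₂' ≤ 1) :
    inner ℝ (gridKernel α β q a δ n c δ' m) (gridKernel α β q a₂ δ₂ n₂ c₂ δ₂' m₂) =
      (q.factorial : ℝ)⁻¹ * (kappa q α * kappa q β)⁻¹ *
        (gridSum q α a δ n a₂ δ₂ n₂ * gridSum q β c δ' m c₂ δ₂' m₂) := by
  have hsum : inner ℝ (∑ i ∈ Finset.range n, ∑ j ∈ Finset.range m, tensorPow q (rect α β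
        (a + i * δ) (a + (i + 1) * δ) (c + j * δ') (c + (j + 1) * δ')))
      (∑ i ∈ Finset.range n₂, ∑ j ∈ Finset.range m₂, tensorPow q (rect α β
        (a₂ + i * δ₂) (a₂ + (i + 1) * δ₂) (c₂ + j * δ₂') (c₂ + (j + 1) * δ₂'))) =
      (∑ i ∈ Finset.range n, ∑ i' ∈ Finset.range n₂,
        fbmIncr α (a + i * δ) (a + (i + 1) * δ) (a₂ + i' * δ₂) (a₂ + (i' + 1) * δ₂) ^ q) *
      ∑ j ∈ Finset.range m, ∑ j' ∈ Finset.range m₂,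
        fbmIncr β (c + j * δ') (c + (j + 1) * δ') (c₂ + j' * δ₂') (c₂ + (j' + 1) * δ₂') ^ q := by
    simp only [sum_inner]
    simp only [inner_sum]
    rw [Finset.sum_mul_sum]
    refine Finset.sum_congr rfl fun i hi => Finset.sum_congr rfl fun j hj => ?_
    rw [Finset.sum_mul_sum]
    refine Finset.sum_congr rfl fun i' hi' => Finset.sum_congr rfl fun j' hj' => ?_
    have h1 := grid_mem ha hδ hn (Finset.mem_range.1 hi)
    have h2 := grid_mem hc hδ' hm (Finset.mem_range.1 hj)
    have h3 := grid_mem ha₂ hδ₂ hn₂ (Finset.mem_range.1 hi')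
    have h4 := grid_mem hc₂ hδ₂' hm₂ (Finset.mem_range.1 hj')
    rw [inner_tensorPow, inner_rect α β h1.1 h1.2 h2.1 h2.2 h3.1 h3.2 h4.1 h4.2, mul_pow]
  have hsq : √(q.factorial / (kappa q α * kappa q β)) * √(q.factorial / (kappa q α * kappa q β)) =
      q.factorial / (kappa q α * kappa q β) := Real.mul_self_sqrt (by positivity)
  have hf : (q.factorial : ℝ)⁻¹ * q.factorial = 1 := inv_mul_cancel₀ (by positivity)
  rw [gridKernel, gridKernel, real_inner_smul_left, real_inner_smul_right, hsum, gridSum, gridSum]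
  calc _ = (q.factorial : ℝ)⁻¹ * (q.factorial : ℝ)⁻¹ *
        (√(q.factorial / (kappa q α * kappa q β)) * √(q.factorial / (kappa q α * kappa q β))) *
        ((δ⁻¹ ^ (q - 1) * δ₂⁻¹ ^ (q - 1) * ∑ i ∈ Finset.range n, ∑ i' ∈ Finset.range n₂,
          fbmIncr α (a + i * δ) (a + (i + 1) * δ) (a₂ + i' * δ₂) (a₂ + (i' + 1) * δ₂) ^ q) *
        (δ'⁻¹ ^ (q - 1) * δ₂'⁻¹ ^ (q - 1) * ∑ j ∈ Finset.range m, ∑ j' ∈ Finset.range m₂,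
          fbmIncr β (c + j * δ') (c + (j + 1) * δ') (c₂ + j' * δ₂') (c₂ + (j' + 1) * δ₂') ^ q)) := by
        ring
    _ = _ := by
        rw [hsq, div_eq_mul_inv]
        linear_combination (q.factorial : ℝ)⁻¹ * (kappa q α * kappa q β)⁻¹ *
          ((δ⁻¹ ^ (q - 1) * δ₂⁻¹ ^ (q - 1) * ∑ i ∈ Finset.range n, ∑ i' ∈ Finset.range n₂,
          fbmIncr α (a + i * δ) (a + (i + 1) * δ) (a₂ + i' * δ₂) (a₂ + (i' + 1) * δ₂) ^ q) *
        (δ'⁻¹ ^ (q - 1) * δ₂'⁻¹ ^ (q - 1) * ∑ j ∈ Finset.range m, ∑ j' ∈ Finset.range m₂,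
          fbmIncr β (c + j * δ') (c + (j + 1) * δ') (c₂ + j' * δ₂') (c₂ + (j' + 1) * δ₂') ^ q)) * hf

/-- Partitions of intervals `[a, a + nδ] ⊆ [0,1]` into `n` intervals of length `δ`, with `δ → 0` and
`a + nδ → b` along `l`. -/
structure IsMesh {ι : Type*} (l : Filter ι) (a b : ℝ) (δ : ι → ℝ) (n : ι → ℕ) : Prop where
  nonneg : 0 ≤ a
  step_nonneg : ∀ᶠ k in l, 0 ≤ δ k
  step : Tendsto δ l (𝓝 0)
  le_one : ∀ᶠ k in l, a + n k * δ k ≤ 1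
  endpoint : Tendsto (fun k => a + n k * δ k) l (𝓝 b)

theorem IsMesh.comp {ι κ : Type*} {l : Filter ι} {l' : Filter κ} {a b : ℝ} {δ : ι → ℝ} {n : ι → ℕ}
    (h : IsMesh l a b δ n) {f : κ → ι} (hf : Tendsto f l' l) : IsMesh l' a b (δ ∘ f) (n ∘ f) where
  nonneg := h.nonneg
  step_nonneg := hf.eventually h.step_nonneg
  step := h.step.comp hf
  le_one := hf.eventually h.le_one
  endpoint := h.endpoint.comp hf

theorem isMesh_uniform {a b : ℝ} (ha : 0 ≤ a) (hab : a ≤ b) (hb : b ≤ 1) :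
    IsMesh atTop a b (fun n : ℕ => (b - a) / n) (fun n => n) := by
  have h : ∀ᶠ n : ℕ in atTop, a + n * ((b - a) / n) = b := by
    filter_upwards [eventually_ge_atTop 1] with n hn
    have : (n : ℝ) ≠ 0 := by positivity
    field_simp; ring
  exact ⟨ha, Eventually.of_forall fun n => div_nonneg (by linarith) (by positivity),
    tendsto_const_div_atTop_nhds_zero_nat _, h.mono fun n hn => hn.trans_le hb,
    tendsto_const_nhds.congr' (h.mono fun n hn => hn.symm)⟩

/-- The right endpoint lies between s - s/N and s + (1-s)/N. The factor N - 1 inside the integer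
part compensates the extra cell and keeps the grid inside [0,1]. -/
theorem isMesh_floor {s : ℝ} (hs : s ∈ I) :
    IsMesh atTop 0 s (fun N : ℕ => (N : ℝ)⁻¹) (fun N => ⌊((N : ℝ) - 1) * s⌋₊ + 1) := by
  have h0 : ∀ᶠ N : ℕ in atTop, (1 : ℝ) ≤ N := by
    filter_upwards [eventually_ge_atTop 1] with N hN using by exact_mod_cast hN
  have hinv : Tendsto (fun N : ℕ => (N : ℝ)⁻¹) atTop (𝓝 0) := tendsto_inv_atTop_nhds_zero_nat
  refine ⟨le_rfl, Eventually.of_forall fun N => by positivity, hinv, ?_, ?_⟩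
  · filter_upwards [h0] with N hN
    have h1 : (⌊((N : ℝ) - 1) * s⌋₊ : ℝ) ≤ (N - 1) * s :=
      Nat.floor_le (mul_nonneg (by linarith) hs.1)
    have h2 : ((N : ℝ) - 1) * s ≤ N - 1 := mul_le_of_le_one_right (by linarith) hs.2
    push_cast
    rw [zero_add, ← div_eq_mul_inv, div_le_one (by linarith)]
    linarith
  · have hl : Tendsto (fun N : ℕ => s - s * (N : ℝ)⁻¹) atTop (𝓝 s) := by
      simpa using (hinv.const_mul s).const_sub s
    have hu : Tendsto (fun N : ℕ => s + (1 - s) * (N : ℝ)⁻¹) atTop (𝓝 s) := by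
      simpa using (hinv.const_mul (1 - s)).const_add s
    refine tendsto_of_tendsto_of_tendsto_of_le_of_le' hl hu ?_ ?_
    · filter_upwards [h0] with N hN
      have h1 := (Nat.lt_floor_add_one (((N : ℝ) - 1) * s)).le
      have h2 := mul_le_mul_of_nonneg_right h1 (by positivity : (0 : ℝ) ≤ (N : ℝ)⁻¹)
      have h3 : (N : ℝ) * (N : ℝ)⁻¹ = 1 := mul_inv_cancel₀ (by positivity)
      have h4 : ((N : ℝ) - 1) * s * (N : ℝ)⁻¹ = s - s * (N : ℝ)⁻¹ := by linear_combination s * h3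
      push_cast
      linarith
    · filter_upwards [h0] with N hN
      have h1 : (⌊((N : ℝ) - 1) * s⌋₊ : ℝ) ≤ (N - 1) * s :=
        Nat.floor_le (mul_nonneg (by linarith) hs.1)
      have h2 := mul_le_mul_of_nonneg_right h1 (by positivity : (0 : ℝ) ≤ (N : ℝ)⁻¹)
      have h3 : (N : ℝ) * (N : ℝ)⁻¹ = 1 := mul_inv_cancel₀ (by positivity)
      have h4 : ((N : ℝ) - 1) * s * (N : ℝ)⁻¹ = s - s * (N : ℝ)⁻¹ := by linear_combination s * h3
      push_cast
      linarith

/-! ### Admissible Hurst indices -/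

section Hurst

variable {q : ℕ} {γ : ℝ}

/-- This is the local integrability of |z|^{-q(2-2γ)}, the form in which the lower bound on γ is
used. -/
theorem mul_two_sub_lt_one (hq : 1 ≤ q) (hγ : 1 - 1 / (2 * (q : ℝ)) < γ) :
    q * (2 - 2 * γ) < 1 := by
  have h0 : (0 : ℝ) < q := by exact_mod_cast hq
  have h1 : 1 - γ < 1 / (2 * (q : ℝ)) := by linarith
  rw [lt_div_iff₀ (by positivity)] at h1
  linarith

theorem one_half_lt (hq : 1 ≤ q) (hγ : 1 - 1 / (2 * (q : ℝ)) < γ) : 1 / 2 < γ := by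
  have h0 : (1 : ℝ) ≤ q := by exact_mod_cast hq
  have h1 : 1 / (2 * (q : ℝ)) ≤ 1 / 2 := one_div_le_one_div_of_le (by norm_num) (by linarith)
  linarith

theorem hermiteHurst_mem (hq : 1 ≤ q) (hγ : 1 - 1 / (2 * (q : ℝ)) < γ) (hγ1 : γ < 1) :
    q * (γ - 1) + 1 ∈ Ioo (0 : ℝ) 1 := by
  have h0 : (0 : ℝ) < q := by exact_mod_cast hq
  have h1 := mul_two_sub_lt_one hq hγ
  have h2 : q * (γ - 1) < 0 := mul_neg_of_pos_of_neg h0 (by linarith)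
  exact ⟨by linarith, by linarith⟩

theorem kappa_pos (hq : 1 ≤ q) (hγ : 1 - 1 / (2 * (q : ℝ)) < γ) : 0 < kappa q γ := by
  have h1 := mul_two_sub_lt_one hq hγ
  have h2 := one_half_lt hq hγ
  have h3 : 0 < γ := by linarith
  have h4 : 0 < 2 * γ - 1 := by linarith
  have h5 : 0 < γ * q - q + 1 := by nlinarith
  have h6 : 0 < 2 * γ * q - 2 * q + 1 := by nlinarith
  unfold kappa
  positivity

end Hurst

theorem tendsto_sub_zero_of_tendsto_inner {E ι : Type*} [NormedAddCommGroup E]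
    [InnerProductSpace ℝ E] {l : Filter ι} {x y : ι → E} {v : ℝ}
    (hxx : Tendsto (fun k => inner ℝ (x k) (x k)) l (𝓝 v))
    (hxy : Tendsto (fun k => inner ℝ (x k) (y k)) l (𝓝 v))
    (hyy : Tendsto (fun k => inner ℝ (y k) (y k)) l (𝓝 v)) :
    Tendsto (fun k => x k - y k) l (𝓝 0) := by
  rw [tendsto_zero_iff_norm_tendsto_zero]
  have h : ∀ k, ‖x k - y k‖ =
      √(inner ℝ (x k) (x k) - 2 * inner ℝ (x k) (y k) + inner ℝ (y k) (y k)) := fun k => by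
    rw [← Real.sqrt_sq (norm_nonneg (x k - y k)), norm_sub_sq_real, real_inner_self_eq_norm_sq,
      real_inner_self_eq_norm_sq]
  simp only [h]
  have := ((hxx.sub (hxy.const_mul 2)).add hyy).sqrt
  rwa [show v - 2 * v + v = 0 by ring, Real.sqrt_zero] at this

/-! ### Convergence of the grid kernels -/

section Limit

variable {α β : Hurst} {q : ℕ} (hq : 1 ≤ q) (hα : 1 - 1 / (2 * (q : ℝ)) < α)
  (hβ : 1 - 1 / (2 * (q : ℝ)) < β)

include hq hα hβ

theorem tendsto_inner_gridKernel {ι : Type*} {l : Filter ι} {a b c d a₂ b₂ c₂ d₂ : ℝ}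
    {δ δ' δ₂ δ₂' : ι → ℝ} {n m n₂ m₂ : ι → ℕ} (h₁ : IsMesh l a b δ n) (h₂ : IsMesh l c d δ' m)
    (h₃ : IsMesh l a₂ b₂ δ₂ n₂) (h₄ : IsMesh l c₂ d₂ δ₂' m₂) :
    Tendsto (fun k => inner ℝ (gridKernel α β q a (δ k) (n k) c (δ' k) (m k))
      (gridKernel α β q a₂ (δ₂ k) (n₂ k) c₂ (δ₂' k) (m₂ k))) l
      (𝓝 ((q.factorial : ℝ)⁻¹ * (fbmIncr (q * ((α : ℝ) - 1) + 1) a b a₂ b₂ *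
        fbmIncr (q * ((β : ℝ) - 1) + 1) c d c₂ d₂))) := by
  have hκα := kappa_pos hq hα
  have hκβ := kappa_pos hq hβ
  have hS := tendsto_gridSum hq (one_half_lt hq hα) α.2.2 (mul_two_sub_lt_one hq hα)
    h₁.step_nonneg h₃.step_nonneg h₁.step h₃.step h₁.endpoint h₃.endpoint
  have hT := tendsto_gridSum hq (one_half_lt hq hβ) β.2.2 (mul_two_sub_lt_one hq hβ)
    h₂.step_nonneg h₄.step_nonneg h₂.step h₄.step h₂.endpoint h₄.endpoint
  have h := (hS.mul hT).const_mul ((q.factorial : ℝ)⁻¹ * (kappa q α * kappa q β)⁻¹)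
  have e : ∀ x y : ℝ, (q.factorial : ℝ)⁻¹ * (kappa q α * kappa q β)⁻¹ *
      (kappa q α * x * (kappa q β * y)) = (q.factorial : ℝ)⁻¹ * (x * y) := fun x y => by
    field_simp
  rw [e] at h
  refine h.congr' ?_
  filter_upwards [h₁.step_nonneg, h₂.step_nonneg, h₃.step_nonneg, h₄.step_nonneg, h₁.le_one,
    h₂.le_one, h₃.le_one, h₄.le_one] with k k1 k2 k3 k4 k5 k6 k7 k8
  exact (inner_gridKernel (mul_pos hκα hκβ) h₁.nonneg k1 k5 h₂.nonneg k2 k6 h₃.nonneg k3 k7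
    h₄.nonneg k4 k8).symm

theorem tendsto_gridKernel_sub {ι : Type*} {l : Filter ι} {a b c d : ℝ}
    {δ δ' δ₂ δ₂' : ι → ℝ} {n m n₂ m₂ : ι → ℕ} (h₁ : IsMesh l a b δ n) (h₂ : IsMesh l c d δ' m)
    (h₃ : IsMesh l a b δ₂ n₂) (h₄ : IsMesh l c d δ₂' m₂) :
    Tendsto (fun k => gridKernel α β q a (δ k) (n k) c (δ' k) (m k) -
      gridKernel α β q a (δ₂ k) (n₂ k) c (δ₂' k) (m₂ k)) l (𝓝 0) :=
  tendsto_sub_zero_of_tendsto_inner (tendsto_inner_gridKernel hq hα hβ h₁ h₂ h₁ h₂)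
    (tendsto_inner_gridKernel hq hα hβ h₁ h₂ h₃ h₄) (tendsto_inner_gridKernel hq hα hβ h₃ h₄ h₃ h₄)

omit hq hα hβ in
/-- The limit of the grid kernels on the rectangle `[a,b] × [c,d]`. -/
def limitKernel (α β : Hurst) (q : ℕ) (a b c d : ℝ) : TensorPower (CanonicalSpace α β) q :=
  limUnder atTop fun n : ℕ => gridKernel α β q a ((b - a) / n) n c ((d - c) / n) n

theorem tendsto_uniform_gridKernel {a b c d : ℝ} (ha : 0 ≤ a) (hab : a ≤ b) (hb : b ≤ 1)
    (hc : 0 ≤ c) (hcd : c ≤ d) (hd : d ≤ 1) :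
    Tendsto (fun n : ℕ => gridKernel α β q a ((b - a) / n) n c ((d - c) / n) n) atTop
      (𝓝 (limitKernel α β q a b c d)) := by
  have h1 := isMesh_uniform ha hab hb
  have h2 := isMesh_uniform hc hcd hd
  refine tendsto_nhds_limUnder (CompleteSpace.complete (f := map _ atTop) ?_)
  rw [cauchy_map_iff, uniformity_eq_comap_nhds_zero_swapped, tendsto_comap_iff]
  refine ⟨inferInstance, ?_⟩
  -- The Cauchy property compares the grids of two independent indices, that is, two meshes along
  -- the product filter.
  exact tendsto_gridKernel_sub hq hα hβ (h1.comp tendsto_fst) (h2.comp tendsto_fst)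
    (h1.comp tendsto_snd) (h2.comp tendsto_snd)

/-- The index of the given mesh is unrelated to that of the uniform grid, so the two are compared
along the product filter and the result is projected back to `l`. -/
theorem tendsto_gridKernel {ι : Type*} {l : Filter ι} {a b c d : ℝ} {δ δ' : ι → ℝ} {n m : ι → ℕ}
    (h₁ : IsMesh l a b δ n) (h₂ : IsMesh l c d δ' m) (hab : a ≤ b) (hb : b ≤ 1) (hcd : c ≤ d)
    (hd : d ≤ 1) :
    Tendsto (fun k => gridKernel α β q a (δ k) (n k) c (δ' k) (m k)) l
      (𝓝 (limitKernel α β q a b c d)) := by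
  have h3 := isMesh_uniform h₁.nonneg hab hb
  have h4 := isMesh_uniform h₂.nonneg hcd hd
  have hu := tendsto_uniform_gridKernel hq hα hβ h₁.nonneg hab hb h₂.nonneg hcd hd
  have h := tendsto_gridKernel_sub hq hα hβ (h₁.comp (tendsto_snd (f := atTop (α := ℕ))))
    (h₂.comp tendsto_snd) (h3.comp tendsto_fst) (h4.comp tendsto_fst)
  have h' := h.add (hu.comp (tendsto_fst (g := l)))
  simp only [Function.comp_apply, sub_add_cancel, zero_add] at h'
  rw [Tendsto, ← map_snd_prod (atTop : Filter ℕ) l, map_map]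
  exact h'

theorem tendsto_approxKernel {s t : ℝ} (hs : s ∈ I) (ht : t ∈ I) :
    Tendsto (fun n : ℕ × ℕ => approxKernel α β q s t n.1 n.2) (atTop ×ˢ atTop)
      (𝓝 (limitKernel α β q 0 s 0 t)) := by
  simp only [approxKernel_eq_gridKernel]
  exact tendsto_gridKernel hq hα hβ ((isMesh_floor hs).comp tendsto_fst)
    ((isMesh_floor ht).comp tendsto_snd) hs.1 hs.2 ht.1 ht.2

theorem inner_limitKernel {a b c d a₂ b₂ c₂ d₂ : ℝ} (ha : 0 ≤ a) (hab : a ≤ b) (hb : b ≤ 1)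
    (hc : 0 ≤ c) (hcd : c ≤ d) (hd : d ≤ 1) (ha₂ : 0 ≤ a₂) (hab₂ : a₂ ≤ b₂) (hb₂ : b₂ ≤ 1)
    (hc₂ : 0 ≤ c₂) (hcd₂ : c₂ ≤ d₂) (hd₂ : d₂ ≤ 1) :
    inner ℝ (limitKernel α β q a b c d) (limitKernel α β q a₂ b₂ c₂ d₂) =
      (q.factorial : ℝ)⁻¹ * (fbmIncr (q * ((α : ℝ) - 1) + 1) a b a₂ b₂ *
        fbmIncr (q * ((β : ℝ) - 1) + 1) c d c₂ d₂) :=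
  tendsto_nhds_unique
    ((tendsto_uniform_gridKernel hq hα hβ ha hab hb hc hcd hd).inner
      (tendsto_uniform_gridKernel hq hα hβ ha₂ hab₂ hb₂ hc₂ hcd₂ hd₂))
    (tendsto_inner_gridKernel hq hα hβ (isMesh_uniform ha hab hb) (isMesh_uniform hc hcd hd)
      (isMesh_uniform ha₂ hab₂ hb₂) (isMesh_uniform hc₂ hcd₂ hd₂))

/-- The Gram matrix of the limits is known, and expanding the squared norm of the difference gives
zero. No common refinement of grids is needed. -/
theorem limitKernel_eq {a b c d : ℝ} (ha : 0 ≤ a) (hab : a ≤ b) (hb : b ≤ 1)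
    (hc : 0 ≤ c) (hcd : c ≤ d) (hd : d ≤ 1) :
    limitKernel α β q a b c d = limitKernel α β q 0 b 0 d - limitKernel α β q 0 a 0 d -
      limitKernel α β q 0 b 0 c + limitKernel α β q 0 a 0 c := by
  have hb0 := ha.trans hab
  have hd0 := hc.trans hcd
  have ha1 := hab.trans hb
  have hc1 := hcd.trans hd
  have hH₁ := (hermiteHurst_mem hq hα α.2.2).1
  have hH₂ := (hermiteHurst_mem hq hβ β.2.2).1
  rw [← sub_eq_zero, ← inner_self_eq_zero (𝕜 := ℝ)]
  simp only [inner_sub_left, inner_sub_right, inner_add_left, inner_add_right]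
  simp only [inner_limitKernel hq hα hβ, ha, hab, hb, hc, hcd, hd, hb0, hd0, ha1, hc1, le_refl]
  simp only [fbmIncr, fbmCov_zero_left hH₁, fbmCov_zero_right hH₁, fbmCov_zero_left hH₂,
    fbmCov_zero_right hH₂, ha, hb0, hc, hd0, le_refl]
  ring

end Limit

/-! ### Laws of the multiple integrals of grid kernels -/

/-- The normalization scales like r^{-(q-1)} and a tensor power of a cell like r^{γq}: together they
give the Hermite index. -/
theorem inv_pow_mul_rpow_pow {q : ℕ} (hq : 1 ≤ q) {r : ℝ} (hr : 0 < r) (γ : ℝ) :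
    r⁻¹ ^ (q - 1) * (r ^ γ) ^ q = r ^ (q * (γ - 1) + 1) := by
  rw [← Real.rpow_neg_one, ← Real.rpow_natCast, ← Real.rpow_natCast, ← Real.rpow_mul hr.le,
    ← Real.rpow_mul hr.le, ← Real.rpow_add hr]
  push_cast [hq]
  congr 1
  ring

section Law

variable {Ω : Type*} [MeasurableSpace Ω] {P : Measure Ω} [IsProbabilityMeasure P] {α β : Hurst}
  {W : ℝ → ℝ → Ω → ℝ} (hW : IsFractionalBrownianSheet α β W P) {q : ℕ} (hq : 1 ≤ q)

include hW hq

theorem exists_gridKernel_mem_ae_eq {a δ c δ' : ℝ} (n m : ℕ) {F : ℕ → ℕ → Lp ℝ 2 P}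
    (hF : ∀ i j : ℕ, (rect α β (a + i * δ) (a + (i + 1) * δ) (c + j * δ') (c + (j + 1) * δ'), F i j) ∈
      wienerGraph α β W P) :
    ∃ T, (gridKernel α β q a δ n c δ' m, T) ∈ multipleIntegralGraph α β q W P ∧
      T =ᵐ[P] fun ω => ((q.factorial : ℝ)⁻¹ * √(q.factorial / (kappa q α * kappa q β)) *
        (δ⁻¹ ^ (q - 1) * δ'⁻¹ ^ (q - 1))) * ∑ i : Fin n, ∑ j : Fin m,
        ‖rect α β (a + i * δ) (a + (i + 1) * δ) (c + j * δ') (c + (j + 1) * δ')‖ ^ q *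
          Polynomial.aeval (F i j ω /
            ‖rect α β (a + i * δ) (a + (i + 1) * δ) (c + j * δ') (c + (j + 1) * δ')‖)
            (Polynomial.hermite q) := by
  choose T hT hTF using fun i j => exists_tensorPow_mem_multipleIntegralGraph hW hq (hF i j)
  set C := (q.factorial : ℝ)⁻¹ * √(q.factorial / (kappa q α * kappa q β)) *
    (δ⁻¹ ^ (q - 1) * δ'⁻¹ ^ (q - 1)) with hC
  have hmem := smul_sum_mem (Finset.range n ×ˢ Finset.range m) (fun _ => C) fun p : ℕ × ℕ =>
    hT p.1 p.2
  refine ⟨∑ p ∈ Finset.range n ×ˢ Finset.range m, C • T p.1 p.2, ?_, ?_⟩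
  · convert hmem using 2
    rw [gridKernel, ← hC, ← Finset.smul_sum, Finset.sum_product]
  · filter_upwards [coeFn_sum_smul (Finset.range n ×ˢ Finset.range m) (fun _ => C)
      (fun p : ℕ × ℕ => T p.1 p.2), ae_all_iff.2 fun i => ae_all_iff.2 (hTF i)] with ω h1 h2
    rw [h1, ← Finset.mul_sum, Finset.sum_product, Finset.sum_range]
    simp only [Finset.sum_range, h2]

theorem exists_gridKernel_mem (a δ c δ' : ℝ) (n m : ℕ) :
    ∃ T, (gridKernel α β q a δ n c δ' m, T) ∈ multipleIntegralGraph α β q W P := by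
  choose F hF using fun i j : ℕ => exists_rect_mem_wienerGraph hW (a + i * δ) (a + (i + 1) * δ)
    (c + j * δ') (c + (j + 1) * δ')
  obtain ⟨T, hT, -⟩ := exists_gridKernel_mem_ae_eq hW hq n m hF
  exact ⟨T, hT⟩

/-- Both grids have the same number of cells, so cells correspond one to one. Translation and
dilation multiply all their scalar products, jointly in `k`, by the square of s = r^α ρ^β. The
vector of Wiener integrals of the cells is thus multiplied by s in law, and the integrals of the
kernels are the same Hermite function of it, up to the change of normalization. -/
theorem identDistrib_gridKernel {κ : Type*} [Fintype κ] {a c a' c' r ρ : ℝ} {N : ℕ}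
    {δ δ' : κ → ℝ} (ha : 0 ≤ a) (hc : 0 ≤ c) (ha' : 0 ≤ a') (hc' : 0 ≤ c') (hr : 0 < r) (hρ : 0 < ρ)
    (hδ : ∀ k, 0 ≤ δ k) (hδ' : ∀ k, 0 ≤ δ' k) (h1 : ∀ k, a + N * δ k ≤ 1)
    (h2 : ∀ k, c + N * δ' k ≤ 1) (h3 : ∀ k, a' + N * (r * δ k) ≤ 1)
    (h4 : ∀ k, c' + N * (ρ * δ' k) ≤ 1) {T T' : κ → Lp ℝ 2 P}
    (hT : ∀ k, (gridKernel α β q a (δ k) N c (δ' k) N, T k) ∈ multipleIntegralGraph α β q W P)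
    (hT' : ∀ k, (gridKernel α β q a' (r * δ k) N c' (ρ * δ' k) N, T' k) ∈
      multipleIntegralGraph α β q W P) :
    IdentDistrib (fun ω k => T' k ω) (fun ω k => ((r ^ (q * ((α : ℝ) - 1) + 1) *
      ρ ^ (q * ((β : ℝ) - 1) + 1)) • T k : Lp ℝ 2 P) ω) P P := by
  choose F hF using fun (k : κ) (i j : ℕ) => exists_rect_mem_wienerGraph hW (a + i * δ k)
    (a + (i + 1) * δ k) (c + j * δ' k) (c + (j + 1) * δ' k)
  choose F' hF' using fun (k : κ) (i j : ℕ) => exists_rect_mem_wienerGraph hW (a' + i * (r * δ k))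
    (a' + (i + 1) * (r * δ k)) (c' + j * (ρ * δ' k)) (c' + (j + 1) * (ρ * δ' k))
  choose S hS hSF using fun k => exists_gridKernel_mem_ae_eq hW hq N N (hF k)
  choose S' hS' hSF' using fun k => exists_gridKernel_mem_ae_eq hW hq N N (hF' k)
  obtain rfl : S = T := funext fun k => eq_of_mem_multipleIntegralGraph hW (hS k) (hT k)
  obtain rfl : S' = T' := funext fun k => eq_of_mem_multipleIntegralGraph hW (hS' k) (hT' k)
  set φ : κ → ℕ → ℕ → CanonicalSpace α β := fun k i j => rect α β (a + i * δ k)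
    (a + (i + 1) * δ k) (c + j * δ' k) (c + (j + 1) * δ' k) with hφ
  set φ' : κ → ℕ → ℕ → CanonicalSpace α β := fun k i j => rect α β (a' + i * (r * δ k))
    (a' + (i + 1) * (r * δ k)) (c' + j * (ρ * δ' k)) (c' + (j + 1) * (ρ * δ' k)) with hφ'
  set s : ℝ := r ^ (α : ℝ) * ρ ^ (β : ℝ) with hs
  have hs0 : 0 < s := by positivity
  have hgram : ∀ (k k' : κ) (i j i' j' : Fin N), inner ℝ (φ' k i j) (φ' k' i' j') =
      inner ℝ (s • φ k i j) (s • φ k' i' j') := by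
    intro k k' i j i' j'
    have g1 := fun (k : κ) (i : Fin N) => grid_mem ha (hδ k) (h1 k) i.2
    have g2 := fun (k : κ) (i : Fin N) => grid_mem hc (hδ' k) (h2 k) i.2
    have g3 := fun (k : κ) (i : Fin N) => grid_mem ha' (mul_nonneg hr.le (hδ k)) (h3 k) i.2
    have g4 := fun (k : κ) (i : Fin N) => grid_mem hc' (mul_nonneg hρ.le (hδ' k)) (h4 k) i.2
    rw [real_inner_smul_left, real_inner_smul_right, hφ, hφ']
    simp only
    rw [inner_rect α β (g1 k i).1 (g1 k i).2 (g2 k j).1 (g2 k j).2 (g1 k' i').1 (g1 k' i').2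
      (g2 k' j').1 (g2 k' j').2, inner_rect α β (g3 k i).1 (g3 k i).2 (g4 k j).1 (g4 k j).2
      (g3 k' i').1 (g3 k' i').2 (g4 k' j').1 (g4 k' j').2]
    simp only [fbmIncr_add, mul_left_comm _ r, mul_left_comm _ ρ, fbmIncr_mul _ hr.le,
      fbmIncr_mul _ hρ.le, hs]
    rw [mul_comm 2 (α : ℝ), mul_comm 2 (β : ℝ), Real.rpow_mul hr.le, Real.rpow_mul hρ.le,
      Real.rpow_two, Real.rpow_two]
    ring
  have hnorm : ∀ (k : κ) (i j : Fin N), ‖φ' k i j‖ = s * ‖φ k i j‖ := fun k i j => by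
    have := hgram k k i j i j
    rw [real_inner_self_eq_norm_sq, real_inner_self_eq_norm_sq, norm_smul,
      Real.norm_of_nonneg hs0.le] at this
    exact (pow_left_inj₀ (norm_nonneg _) (by positivity) two_ne_zero).1 this
  have hid := (isGaussianGraph_wienerGraph hW).identDistrib
    (x := fun p : κ × Fin N × Fin N => (φ' p.1 p.2.1 p.2.2, F' p.1 p.2.1 p.2.2))
    (y := fun p : κ × Fin N × Fin N => (s • φ p.1 p.2.1 p.2.2, s • F p.1 p.2.1 p.2.2))
    (fun p => hF' _ _ _) (fun p => Submodule.smul_mem _ s (hF _ _ _))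
    (fun p p' => hgram _ _ _ _ _ _)
  -- The family of integrals of the dilated grid kernels as one measurable function of the Gaussian
  -- vector of its cells. Applied to s times the other vector, it gives the other family up to the
  -- scaling factor.
  let g : (κ × Fin N × Fin N → ℝ) → κ → ℝ := fun v k =>
    ((q.factorial : ℝ)⁻¹ * √(q.factorial / (kappa q α * kappa q β)) *
        ((r * δ k)⁻¹ ^ (q - 1) * (ρ * δ' k)⁻¹ ^ (q - 1))) * ∑ i : Fin N, ∑ j : Fin N,
      ‖φ' k i j‖ ^ q * Polynomial.aeval (v (k, i, j) / ‖φ' k i j‖) (Polynomial.hermite q)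
  have hg : Measurable g := by
    refine Continuous.measurable ?_
    fun_prop
  have hid' := hid.comp hg
  have e' : (fun ω => g fun p => F' p.1 p.2.1 p.2.2 ω) =ᵐ[P] fun ω k => S' k ω := by
    filter_upwards [ae_all_iff.2 hSF'] with ω h
    funext k
    rw [h k]
  have e : (fun ω => g fun p => (s • F p.1 p.2.1 p.2.2 : Lp ℝ 2 P) ω) =ᵐ[P] fun ω k =>
      ((r ^ (q * ((α : ℝ) - 1) + 1) * ρ ^ (q * ((β : ℝ) - 1) + 1)) • S k : Lp ℝ 2 P) ω := by
    have hsm : ∀ᵐ ω ∂P, ∀ (k : κ) (i j : ℕ), (s • F k i j : Lp ℝ 2 P) ω = s * F k i j ω :=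
      ae_all_iff.2 fun k => ae_all_iff.2 fun i => ae_all_iff.2 fun j => Lp.coeFn_smul s (F k i j)
    filter_upwards [ae_all_iff.2 hSF, hsm, ae_all_iff.2 fun k => Lp.coeFn_smul
      (r ^ (q * ((α : ℝ) - 1) + 1) * ρ ^ (q * ((β : ℝ) - 1) + 1)) (S k)] with ω k1 k2 k3
    funext k
    rw [k3 k, Pi.smul_apply, smul_eq_mul, k1 k]
    simp only [g, k2, hnorm, mul_div_mul_left _ _ hs0.ne', mul_pow, mul_assoc, ← Finset.mul_sum]
    rw [← inv_pow_mul_rpow_pow hq hr, ← inv_pow_mul_rpow_pow hq hρ, hs]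
    simp only [mul_inv, mul_pow]
    ring
  exact (IdentDistrib.of_ae_eq (hid'.aemeasurable_fst.congr e') e'.symm).trans
    (hid'.trans (IdentDistrib.of_ae_eq hid'.aemeasurable_snd e))

variable (hα : 1 - 1 / (2 * (q : ℝ)) < α) (hβ : 1 - 1 / (2 * (q : ℝ)) < β)

include hα hβ

theorem exists_limitKernel_mem {a b c d : ℝ} (ha : 0 ≤ a) (hab : a ≤ b) (hb : b ≤ 1)
    (hc : 0 ≤ c) (hcd : c ≤ d) (hd : d ≤ 1) :
    ∃ F, (limitKernel α β q a b c d, F) ∈ multipleIntegralGraph α β q W P := by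
  choose T hT using fun n : ℕ => exists_gridKernel_mem hW hq a ((b - a) / n) c ((d - c) / n) n n
  exact exists_mem_multipleIntegralGraph_of_tendsto hW hT
    (tendsto_uniform_gridKernel hq hα hβ ha hab hb hc hcd hd)

/-- Uniform grids with n × n cells on both sides have corresponding laws for each n ≥ 1.
Self-similarity is the case of origins 0, stationarity of increments the case r = ρ = 1. -/
theorem identDistrib_limitKernel {κ : Type*} [Fintype κ] {a c a' c' r ρ : ℝ}
    {x y : κ → ℝ} (ha : 0 ≤ a) (hc : 0 ≤ c) (ha' : 0 ≤ a') (hc' : 0 ≤ c') (hr : 0 < r) (hρ : 0 < ρ)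
    (hx : ∀ k, 0 ≤ x k) (hy : ∀ k, 0 ≤ y k) (h1 : ∀ k, a + x k ≤ 1)
    (h2 : ∀ k, c + y k ≤ 1) (h3 : ∀ k, a' + r * x k ≤ 1)
    (h4 : ∀ k, c' + ρ * y k ≤ 1) {F F' : κ → Lp ℝ 2 P}
    (hF : ∀ k, (limitKernel α β q a (a + x k) c (c + y k), F k) ∈ multipleIntegralGraph α β q W P)
    (hF' : ∀ k, (limitKernel α β q a' (a' + r * x k) c' (c' + ρ * y k), F' k) ∈
      multipleIntegralGraph α β q W P) :
    IdentDistrib (fun ω k => F' k ω) (fun ω k => ((r ^ (q * ((α : ℝ) - 1) + 1) *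
      ρ ^ (q * ((β : ℝ) - 1) + 1)) • F k : Lp ℝ 2 P) ω) P P := by
  choose T hT using fun (n : ℕ) (k : κ) => exists_gridKernel_mem hW hq a (x k / n) c (y k / n) n n
  choose T' hT' using fun (n : ℕ) (k : κ) =>
    exists_gridKernel_mem hW hq a' (r * (x k / n)) c' (ρ * (y k / n)) n n
  have hlim : ∀ k, Tendsto (fun n => T n k) atTop (𝓝 (F k)) := fun k => by
    have := tendsto_uniform_gridKernel hq hα hβ ha (le_add_of_nonneg_right (hx k)) (h1 k) hc
      (le_add_of_nonneg_right (hy k)) (h2 k)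
    simp only [add_sub_cancel_left] at this
    exact tendsto_of_mem_multipleIntegralGraph hW (fun n => hT n k) (hF k) this
  have hlim' : ∀ k, Tendsto (fun n => T' n k) atTop (𝓝 (F' k)) := fun k => by
    have := tendsto_uniform_gridKernel hq hα hβ ha'
      (le_add_of_nonneg_right (mul_nonneg hr.le (hx k))) (h3 k) hc'
      (le_add_of_nonneg_right (mul_nonneg hρ.le (hy k))) (h4 k)
    simp only [add_sub_cancel_left, mul_div_assoc] at this
    exact tendsto_of_mem_multipleIntegralGraph hW (fun n => hT' n k) (hF' k) this
  refine identDistrib_of_tendsto hlim' (fun k => (hlim k).const_smul _) ?_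
  filter_upwards [eventually_ge_atTop 1] with n hn
  have hn0 : (n : ℝ) ≠ 0 := by positivity
  have e : ∀ z : ℝ, n * (z / n) = z := fun z => mul_div_cancel₀ z hn0
  exact identDistrib_gridKernel hW hq ha hc ha' hc' hr hρ (fun k => div_nonneg (hx k) (by positivity))
    (fun k => div_nonneg (hy k) (by positivity)) (fun k => by rw [e]; exact h1 k)
    (fun k => by rw [e]; exact h2 k) (fun k => by rw [mul_left_comm, e]; exact h3 k)
    (fun k => by rw [mul_left_comm, e]; exact h4 k) (hT n) (hT' n)

/-! ### Covariance, self-similarity and stationarity of the Hermite sheet -/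

theorem exists_isHermiteSheet : ∃ Z : ℝ → ℝ → Ω → ℝ, IsHermiteSheet α β q W P Z := by
  have h : ∀ s t : ℝ, ∃ F : Lp ℝ 2 P, s ∈ I → t ∈ I →
      (limitKernel α β q 0 s 0 t, F) ∈ multipleIntegralGraph α β q W P := fun s t => by
    by_cases hst : s ∈ I ∧ t ∈ I
    · obtain ⟨F, hF⟩ := exists_limitKernel_mem hW hq hα hβ le_rfl hst.1.1 hst.1.2 le_rfl hst.2.1
        hst.2.2
      exact ⟨F, fun _ _ => hF⟩
    · exact ⟨0, fun hs ht => absurd ⟨hs, ht⟩ hst⟩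
  choose F hF using h
  exact ⟨fun s t => F s t, fun s hs t ht => ⟨_, F s t, tendsto_approxKernel hq hα hβ hs ht,
    hF s t hs ht, ae_eq_refl _⟩⟩

variable {Z : ℝ → ℝ → Ω → ℝ} (hZ : IsHermiteSheet α β q W P Z)

include hZ

omit hW [IsProbabilityMeasure P] in
theorem IsHermiteSheet.exists_mem {s t : ℝ} (hs : s ∈ I) (ht : t ∈ I) :
    ∃ F : Lp ℝ 2 P, (limitKernel α β q 0 s 0 t, F) ∈ multipleIntegralGraph α β q W P ∧
      Z s t =ᵐ[P] F := by
  obtain ⟨μ, F, h1, h2, h3⟩ := hZ s hs t ht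
  obtain rfl := tendsto_nhds_unique h1 (tendsto_approxKernel hq hα hβ hs ht)
  exact ⟨F, h2, h3⟩

-- By additivity of the limit kernels, an increment of the sheet is the multiple integral of the
-- kernel of its own rectangle.
omit hW [IsProbabilityMeasure P] in
theorem IsHermiteSheet.exists_rectIncrement_mem {a b c d : ℝ} (ha : 0 ≤ a) (hab : a ≤ b)
    (hb : b ≤ 1) (hc : 0 ≤ c) (hcd : c ≤ d) (hd : d ≤ 1) :
    ∃ F : Lp ℝ 2 P, (limitKernel α β q a b c d, F) ∈ multipleIntegralGraph α β q W P ∧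
      (fun ω => rectIncrement (fun u v => Z u v ω) a b c d) =ᵐ[P] F := by
  have ha' : a ∈ I := ⟨ha, hab.trans hb⟩
  have hb' : b ∈ I := ⟨ha.trans hab, hb⟩
  have hc' : c ∈ I := ⟨hc, hcd.trans hd⟩
  have hd' : d ∈ I := ⟨hc.trans hcd, hd⟩
  obtain ⟨F₁, m₁, e₁⟩ := hZ.exists_mem hq hα hβ hb' hd'
  obtain ⟨F₂, m₂, e₂⟩ := hZ.exists_mem hq hα hβ ha' hd'
  obtain ⟨F₃, m₃, e₃⟩ := hZ.exists_mem hq hα hβ hb' hc'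
  obtain ⟨F₄, m₄, e₄⟩ := hZ.exists_mem hq hα hβ ha' hc'
  refine ⟨F₁ - F₂ - F₃ + F₄, ?_, ?_⟩
  · rw [limitKernel_eq hq hα hβ ha hab hb hc hcd hd]
    exact Submodule.add_mem _ (Submodule.sub_mem _ (Submodule.sub_mem _ m₁ m₂) m₃) m₄
  · filter_upwards [e₁, e₂, e₃, e₄, Lp.coeFn_add (F₁ - F₂ - F₃) F₄, Lp.coeFn_sub (F₁ - F₂) F₃,
      Lp.coeFn_sub F₁ F₂] with ω h1 h2 h3 h4 h5 h6 h7
    rw [h5, Pi.add_apply, h6, Pi.sub_apply, h7, Pi.sub_apply, rectIncrement, h1, h2, h3, h4]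

theorem IsHermiteSheet.memLp_integral {s t : ℝ} (hs : s ∈ I) (ht : t ∈ I) :
    MemLp (Z s t) 2 P ∧ ∫ ω, Z s t ω ∂P = 0 := by
  obtain ⟨F, hF, e⟩ := hZ.exists_mem hq hα hβ hs ht
  exact ⟨(memLp_congr_ae e).2 (Lp.memLp F),
    (integral_congr_ae e).trans (integral_of_mem_multipleIntegralGraph hW hq hF)⟩

theorem IsHermiteSheet.integral_mul {s t u v : ℝ} (hs : s ∈ I) (ht : t ∈ I) (hu : u ∈ I)
    (hv : v ∈ I) : ∫ ω, Z s t ω * Z u v ω ∂P =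
      fbmCov (q * ((α : ℝ) - 1) + 1) s u * fbmCov (q * ((β : ℝ) - 1) + 1) t v := by
  obtain ⟨F, hF, e⟩ := hZ.exists_mem hq hα hβ hs ht
  obtain ⟨G, hG, e'⟩ := hZ.exists_mem hq hα hβ hu hv
  have h := inner_of_mem_multipleIntegralGraph hW hG hF
  have hH₁ := (hermiteHurst_mem hq hα α.2.2).1
  have hH₂ := (hermiteHurst_mem hq hβ β.2.2).1
  have hc : ∀ γ x y : ℝ, fbmCov γ x y = fbmCov γ y x := fun γ x y => by
    simp only [fbmCov, abs_sub_comm x y]; ring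
  simp only [inner_limitKernel hq hα hβ le_rfl hu.1 hu.2 le_rfl hv.1 hv.2 le_rfl hs.1 hs.2 le_rfl
    ht.1 ht.2, fbmIncr, fbmCov_zero_left hH₁, fbmCov_zero_right hH₁, fbmCov_zero_left hH₂,
    fbmCov_zero_right hH₂, hs.1, ht.1, hu.1, hv.1, le_refl, sub_zero, add_zero] at h
  rw [← mul_assoc, mul_inv_cancel₀ (by positivity), one_mul, L2.inner_def] at h
  rw [hc _ s, hc _ t, ← h]
  refine integral_congr_ae ?_
  filter_upwards [e, e'] with ω h1 h2
  rw [h1, h2]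
  simp

theorem IsHermiteSheet.isSelfSimilar :
    IsSelfSimilar (q * ((α : ℝ) - 1) + 1) (q * ((β : ℝ) - 1) + 1) Z P := by
  intro r hr ρ hρ n s t hst
  choose F hF eF using fun k => hZ.exists_mem hq hα hβ (hst k).1 (hst k).2.1
  choose F' hF' eF' using fun k => hZ.exists_mem hq hα hβ (hst k).2.2.1 (hst k).2.2.2
  have h := identDistrib_limitKernel hW hq hα hβ le_rfl le_rfl le_rfl le_rfl hr hρ
    (fun k => (hst k).1.1) (fun k => (hst k).2.1.1)
    (fun k => (zero_add (s k)).trans_le (hst k).1.2)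
    (fun k => (zero_add (t k)).trans_le (hst k).2.1.2)
    (fun k => (zero_add (r * s k)).trans_le (hst k).2.2.1.2)
    (fun k => (zero_add (ρ * t k)).trans_le (hst k).2.2.2.2) (F := F) (F' := F')
    (by simpa only [zero_add] using hF) (by simpa only [zero_add] using hF')
  have e' : (fun ω k => F' k ω) =ᵐ[P] fun ω k => Z (r * s k) (ρ * t k) ω := by
    filter_upwards [ae_all_iff.2 eF'] with ω hω
    funext k
    rw [hω k]
  have e : (fun ω k => ((r ^ (q * ((α : ℝ) - 1) + 1) *
      ρ ^ (q * ((β : ℝ) - 1) + 1)) • F k : Lp ℝ 2 P) ω) =ᵐ[P] fun ω k =>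
      r ^ (q * ((α : ℝ) - 1) + 1) * ρ ^ (q * ((β : ℝ) - 1) + 1) * Z (s k) (t k) ω := by
    filter_upwards [ae_all_iff.2 eF, ae_all_iff.2 fun k => Lp.coeFn_smul
      (r ^ (q * ((α : ℝ) - 1) + 1) * ρ ^ (q * ((β : ℝ) - 1) + 1)) (F k)] with ω k1 k2
    funext k
    rw [k1 k, k2 k, Pi.smul_apply, smul_eq_mul]
  exact (IdentDistrib.of_ae_eq (h.aemeasurable_fst.congr e') e'.symm).trans
    (h.trans (IdentDistrib.of_ae_eq h.aemeasurable_snd e))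

theorem IsHermiteSheet.hasStationaryIncrements : HasStationaryIncrements Z P := by
  intro n x y hxy s hs t ht s' hs' t' ht' hk
  choose F hF eF using fun k => hZ.exists_rectIncrement_mem hq hα hβ hs'.1
    (le_add_of_nonneg_right (hxy k).1.1) (hk k).2.2.1.2 ht'.1
    (le_add_of_nonneg_right (hxy k).2.1) (hk k).2.2.2.2
  choose F' hF' eF' using fun k => hZ.exists_rectIncrement_mem hq hα hβ hs.1
    (le_add_of_nonneg_right (hxy k).1.1) (hk k).1.2 ht.1
    (le_add_of_nonneg_right (hxy k).2.1) (hk k).2.1.2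
  have h := identDistrib_limitKernel hW hq hα hβ hs'.1 ht'.1 hs.1 ht.1 one_pos one_pos
    (fun k => (hxy k).1.1) (fun k => (hxy k).2.1) (fun k => (hk k).2.2.1.2)
    (fun k => (hk k).2.2.2.2) (fun k => by rw [one_mul]; exact (hk k).1.2)
    (fun k => by rw [one_mul]; exact (hk k).2.1.2) hF (F' := F')
    (by simpa only [one_mul] using hF')
  simp only [Real.one_rpow, mul_one, one_smul] at h
  have e' : (fun ω k => F' k ω) =ᵐ[P] fun ω k =>
      rectIncrement (fun u v => Z u v ω) s (s + x k) t (t + y k) := by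
    filter_upwards [ae_all_iff.2 eF'] with ω hω
    funext k
    exact (hω k).symm
  have e : (fun ω k => F k ω) =ᵐ[P] fun ω k =>
      rectIncrement (fun u v => Z u v ω) s' (s' + x k) t' (t' + y k) := by
    filter_upwards [ae_all_iff.2 eF] with ω hω
    funext k
    exact (hω k).symm
  exact (IdentDistrib.of_ae_eq (h.aemeasurable_fst.congr e') e'.symm).trans
    (h.trans (IdentDistrib.of_ae_eq h.aemeasurable_snd e))

/-- Moment bound for the rectangular increments. -/
theorem IsHermiteSheet.lintegral_rectIncrement_pow_le (m : ℕ) {a b c d : ℝ} (ha : 0 ≤ a)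
    (hab : a ≤ b) (hb : b ≤ 1) (hc : 0 ≤ c) (hcd : c ≤ d) (hd : d ≤ 1) :
    ∫⁻ ω, ENNReal.ofReal (rectIncrement (fun u v => Z u v ω) a b c d ^ (2 * m)) ∂P ≤
      ENNReal.ofReal ((m * q).factorial * 2 ^ (m * q) *
        ((b - a) ^ (2 * (q * ((α : ℝ) - 1) + 1)) * (d - c) ^ (2 * (q * ((β : ℝ) - 1) + 1))) ^ m) := by
  obtain ⟨F, hF, e⟩ := hZ.exists_rectIncrement_mem hq hα hβ ha hab hb hc hcd hd
  have h := lintegral_pow_of_mem_multipleIntegralGraph hW m hF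
  have h' : ∫⁻ ω, ENNReal.ofReal (rectIncrement (fun u v => Z u v ω) a b c d ^ (2 * m)) ∂P =
      ∫⁻ ω, ENNReal.ofReal (F ω ^ (2 * m)) ∂P := by
    refine lintegral_congr_ae ?_
    filter_upwards [e] with ω hω
    rw [hω]
  rw [h']
  refine h.trans (ENNReal.ofReal_le_ofReal ?_)
  have hH₁ := (hermiteHurst_mem hq hα α.2.2).1
  have hH₂ := (hermiteHurst_mem hq hβ β.2.2).1
  have hincr : ∀ {γ x y : ℝ}, 0 < γ → x ≤ y → fbmIncr γ x y x y = (y - x) ^ (2 * γ) := by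
    intro γ x y hγ hxy
    rw [fbmIncr_eq_abs, sub_self, sub_self, abs_zero, Real.zero_rpow (by positivity),
      abs_sub_comm x y, abs_of_nonneg (sub_nonneg.2 hxy)]
    ring
  have hn : ‖limitKernel α β q a b c d‖ ^ 2 = (q.factorial : ℝ)⁻¹ *
      ((b - a) ^ (2 * (q * ((α : ℝ) - 1) + 1)) * (d - c) ^ (2 * (q * ((β : ℝ) - 1) + 1))) := by
    rw [← real_inner_self_eq_norm_sq, inner_limitKernel hq hα hβ ha hab hb hc hcd hd ha hab hb hc
      hcd hd, hincr hH₁ hab, hincr hH₂ hcd]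
  have hnn : 0 ≤ (b - a) ^ (2 * (q * ((α : ℝ) - 1) + 1)) *
      (d - c) ^ (2 * (q * ((β : ℝ) - 1) + 1)) :=
    mul_nonneg (Real.rpow_nonneg (sub_nonneg.2 hab) _) (Real.rpow_nonneg (sub_nonneg.2 hcd) _)
  dsimp only
  rw [pow_mul ‖_‖, hn]
  refine mul_le_mul_of_nonneg_left (pow_le_pow_left₀ (by positivity) ?_ m) (by positivity)
  -- The factor 1/q! of the squared norm is dropped.
  exact mul_le_of_le_one_left hnn (inv_le_one_of_one_le₀ (by exact_mod_cast q.factorial_pos))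

end Law

/-! ### Hölder continuity from dyadic increments -/

/-- The largest dyadic number of level `n` below `s ≥ 0`. -/
def dyadicFloor (n : ℕ) (s : ℝ) : ℝ := ⌊2 ^ n * s⌋₊ / 2 ^ n

/-- The dyadic numbers of `[0,1]`. -/
def dyadics : Set ℝ := {s | s ∈ I ∧ ∃ N, ∀ n ≥ N, dyadicFloor n s = s}

theorem dyadicFloor_le {s : ℝ} (hs : 0 ≤ s) (n : ℕ) : dyadicFloor n s ≤ s := by
  rw [dyadicFloor, div_le_iff₀ (by positivity), mul_comm s]
  exact Nat.floor_le (by positivity)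

theorem sub_dyadicFloor_le (s : ℝ) (n : ℕ) : s - dyadicFloor n s ≤ (1 / 2) ^ n := by
  have h := (Nat.lt_floor_add_one (2 ^ n * s)).le
  rw [dyadicFloor, one_div, inv_pow, sub_le_iff_le_add, ← one_div, ← add_div,
    le_div_iff₀ (by positivity)]
  linarith

theorem dyadicFloor_mem {s : ℝ} (hs : s ∈ I) (n : ℕ) : dyadicFloor n s ∈ I :=
  ⟨by unfold dyadicFloor; positivity, (dyadicFloor_le hs.1 n).trans hs.2⟩

theorem dyadicFloor_mem_dyadics {s : ℝ} (hs : s ∈ I) (n : ℕ) : dyadicFloor n s ∈ dyadics := by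
  refine ⟨dyadicFloor_mem hs n, n, fun m hm => ?_⟩
  obtain ⟨k, rfl⟩ := Nat.exists_eq_add_of_le hm
  have h : (2 : ℝ) ^ (n + k) * dyadicFloor n s = ((2 ^ k * ⌊2 ^ n * s⌋₊ : ℕ) : ℝ) := by
    rw [dyadicFloor, pow_add]
    push_cast
    field_simp
  rw [dyadicFloor, h, Nat.floor_natCast, ← h, mul_div_cancel_left₀ _ (by positivity)]

theorem dyadicFloor_zero (n : ℕ) : dyadicFloor n 0 = 0 := by simp [dyadicFloor]

theorem zero_mem_dyadics : (0 : ℝ) ∈ dyadics :=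
  ⟨⟨le_rfl, zero_le_one⟩, 0, fun n _ => dyadicFloor_zero n⟩

theorem tendsto_dyadicFloor {s : ℝ} (hs : s ∈ I) :
    Tendsto (fun n => dyadicFloor n s) atTop (𝓝 s) := by
  have h : Tendsto (fun n : ℕ => s - (1 / 2 : ℝ) ^ n) atTop (𝓝 s) := by
    simpa using (tendsto_pow_atTop_nhds_zero_of_lt_one (r := (1 / 2 : ℝ)) (by norm_num)
      (by norm_num)).const_sub s
  exact tendsto_of_tendsto_of_tendsto_of_le_of_le h tendsto_const_nhds
    (fun n => by linarith [sub_dyadicFloor_le s n]) (fun n => dyadicFloor_le hs.1 n)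

theorem countable_dyadics : dyadics.Countable := by
  refine (countable_range fun p : ℕ × ℕ => (p.2 / 2 ^ p.1 : ℝ)).mono ?_
  rintro s ⟨-, N, hN⟩
  exact ⟨(N, ⌊2 ^ N * s⌋₊), hN N le_rfl⟩

section OneParameter

variable {g : ℝ → ℝ} {K r : ℝ} (hr0 : 0 < r) (hr1 : r < 1)
  (hg : ∀ m i : ℕ, i < 2 ^ m → |g ((i + 1) / 2 ^ m) - g (i / 2 ^ m)| ≤ K * r ^ m)

include hg

/-- At the next level the index k becomes 2k or 2k + 1, so at most one dyadic cell is crossed. The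
right endpoint s = 1 only produces the even case, so the crossed cell lies in [0,1]. -/
theorem abs_dyadicFloor_succ_sub_le {s : ℝ} (hs : s ∈ I) (n : ℕ) :
    |g (dyadicFloor (n + 1) s) - g (dyadicFloor n s)| ≤ K * r ^ (n + 1) := by
  have h0 : (0 : ℝ) ≤ 2 ^ n * s := mul_nonneg (by positivity) hs.1
  have h1 : (0 : ℝ) ≤ 2 ^ (n + 1) * s := mul_nonneg (by positivity) hs.1
  have hfl := Nat.floor_le h0
  have hlt := Nat.lt_floor_add_one (2 ^ n * s)
  have hlo : 2 * ⌊2 ^ n * s⌋₊ ≤ ⌊2 ^ (n + 1) * s⌋₊ := by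
    refine Nat.le_floor ?_
    push_cast
    rw [pow_succ]; linarith
  have hup : ⌊2 ^ (n + 1) * s⌋₊ < 2 * ⌊2 ^ n * s⌋₊ + 2 := by
    rw [Nat.floor_lt h1]
    push_cast
    rw [pow_succ]; linarith
  have hK : 0 ≤ K * r ^ (n + 1) := (abs_nonneg _).trans (hg (n + 1) 0 (by positivity))
  have e : dyadicFloor n s = ((2 * ⌊2 ^ n * s⌋₊ : ℕ) : ℝ) / 2 ^ (n + 1) := by
    rw [dyadicFloor, pow_succ]
    push_cast
    field_simp
  rcases (show ⌊2 ^ (n + 1) * s⌋₊ = 2 * ⌊2 ^ n * s⌋₊ ∨ ⌊2 ^ (n + 1) * s⌋₊ = 2 * ⌊2 ^ n * s⌋₊ + 1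
    by omega) with h | h
  · rw [e, dyadicFloor, h, sub_self, abs_zero]
    exact hK
  · have hlt : 2 * ⌊2 ^ n * s⌋₊ < 2 ^ (n + 1) := by
      have h2 : (⌊2 ^ (n + 1) * s⌋₊ : ℝ) ≤ 2 ^ (n + 1) :=
        (Nat.floor_le h1).trans (mul_le_of_le_one_right (by positivity) hs.2)
      have h3 : ⌊2 ^ (n + 1) * s⌋₊ ≤ 2 ^ (n + 1) := by exact_mod_cast h2
      omega
    rw [e, dyadicFloor, h]
    push_cast
    have := hg (n + 1) _ hlt
    push_cast at this
    exact this

include hr1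

/-- The bound is the exact value of the geometric sum of K r^{n+j} for 1 ≤ j ≤ k, a form suited to
induction. -/
theorem abs_dyadicFloor_add_sub_le {s : ℝ} (hs : s ∈ I) (n k : ℕ) :
    |g (dyadicFloor (n + k) s) - g (dyadicFloor n s)| ≤
      K * (r ^ n - r ^ (n + k)) * (r / (1 - r)) := by
  induction k with
  | zero => simp
  | succ k ih =>
    have h1 := abs_dyadicFloor_succ_sub_le hg hs (n + k)
    have h2 := abs_sub_le (g (dyadicFloor (n + k + 1) s)) (g (dyadicFloor (n + k) s))
      (g (dyadicFloor n s))
    have h3 : (1 - r) * (r / (1 - r)) = r := mul_div_cancel₀ _ (by linarith)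
    have h4 : K * (r ^ n - r ^ (n + k + 1)) * (r / (1 - r)) =
        K * (r ^ n - r ^ (n + k)) * (r / (1 - r)) + K * r ^ (n + k + 1) := by
      linear_combination K * r ^ (n + k) * h3
    rw [← add_assoc]
    linarith

include hr0

theorem abs_sub_dyadicFloor_le {s : ℝ} (hs : s ∈ dyadics) (n : ℕ) :
    |g s - g (dyadicFloor n s)| ≤ K * r ^ n * (r / (1 - r)) := by
  obtain ⟨hsI, N, hN⟩ := hs
  have h := abs_dyadicFloor_add_sub_le hr1 hg hsI n N
  rw [hN (n + N) (by omega)] at h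
  have hK : 0 ≤ K := by
    have := (abs_nonneg _).trans (hg 0 0 (by norm_num))
    simpa using this
  refine h.trans ?_
  have h1 : 0 ≤ r / (1 - r) := div_nonneg hr0.le (by linarith)
  refine mul_le_mul_of_nonneg_right (mul_le_mul_of_nonneg_left ?_ hK) h1
  have := pow_pos hr0 (n + N)
  linarith

end OneParameter

/-- The constant in the Hölder bound for exponent `a`. -/
def chainingConst (a : ℝ) : ℝ :=
  (1 + 2 * ((1 / 2) ^ a / (1 - (1 / 2) ^ a))) * 2 ^ a

theorem half_rpow_mem {a : ℝ} (ha : 0 < a) : (1 / 2 : ℝ) ^ a ∈ Ioo (0 : ℝ) 1 :=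
  ⟨by positivity, Real.rpow_lt_one (by norm_num) (by norm_num) ha⟩

theorem chainingConst_nonneg {a : ℝ} (ha : 0 < a) : 0 ≤ chainingConst a := by
  have h := half_rpow_mem ha
  have : 0 ≤ (1 / 2 : ℝ) ^ a / (1 - (1 / 2) ^ a) := div_nonneg h.1.le (by linarith [h.2])
  unfold chainingConst
  positivity

/-- Bounds on the increments between neighbouring dyadic numbers imply Hölder continuity on the
dyadic numbers. -/
theorem abs_sub_le_of_dyadic {g : ℝ → ℝ} {K a : ℝ} (ha : 0 < a)
    (hg : ∀ m i : ℕ, i < 2 ^ m → |g ((i + 1) / 2 ^ m) - g (i / 2 ^ m)| ≤ K * ((1 / 2) ^ a) ^ m)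
    {s s' : ℝ} (hs : s ∈ dyadics) (hs' : s' ∈ dyadics) :
    |g s' - g s| ≤ K * chainingConst a * |s - s'| ^ a := by
  have hK : 0 ≤ K := by
    have := (abs_nonneg _).trans (hg 0 0 (by norm_num))
    simpa using this
  wlog hlt : s < s' generalizing s s'
  · rcases (not_lt.1 hlt).eq_or_lt with rfl | h
    · rw [sub_self, abs_zero]
      exact mul_nonneg (mul_nonneg hK (chainingConst_nonneg ha)) (Real.rpow_nonneg (abs_nonneg _) _)
    · rw [abs_sub_comm, abs_sub_comm s]
      exact this hs' hs h
  have hr := half_rpow_mem ha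
  set r : ℝ := (1 / 2) ^ a with hrdef
  have hpos : 0 < s' - s := sub_pos.2 hlt
  -- The level at which s' - s is comparable to a cell: (1/2)^{n+1} < s' - s ≤ (1/2)^n. The two
  -- floors are then equal or adjacent. The path through them costs 1 + 2r/(1-r) in units of K r^n,
  -- and passing from r^n to (s'-s)^a costs 2^a.
  obtain ⟨n, hn1, hn2⟩ := exists_nat_pow_near_of_lt_one hpos (by linarith [hs.1.1, hs'.1.2])
    (by norm_num : (0 : ℝ) < 1 / 2) (by norm_num)
  have hrn : r ^ n ≤ 2 ^ a * (s' - s) ^ a := by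
    rw [hrdef, ← Real.rpow_natCast, ← Real.rpow_mul (by norm_num), mul_comm a,
      Real.rpow_mul (by norm_num), Real.rpow_natCast, ← Real.mul_rpow (by norm_num) hpos.le]
    refine Real.rpow_le_rpow (by positivity) ?_ ha.le
    rw [pow_succ] at hn1
    linarith
  have h0 : (0 : ℝ) ≤ 2 ^ n * s := mul_nonneg (by positivity) hs.1.1
  have h0' : (0 : ℝ) ≤ 2 ^ n * s' := mul_nonneg (by positivity) hs'.1.1
  have hlo : ⌊2 ^ n * s⌋₊ ≤ ⌊2 ^ n * s'⌋₊ :=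
    Nat.floor_le_floor (mul_le_mul_of_nonneg_left hlt.le (by positivity))
  have hup : ⌊2 ^ n * s'⌋₊ < ⌊2 ^ n * s⌋₊ + 2 := by
    rw [Nat.floor_lt h0']
    have h1 := Nat.lt_floor_add_one (2 ^ n * s)
    have h2 : (2 : ℝ) ^ n * (s' - s) ≤ 1 := by
      calc (2 : ℝ) ^ n * (s' - s) ≤ 2 ^ n * (1 / 2) ^ n :=
            mul_le_mul_of_nonneg_left hn2 (by positivity)
        _ = 1 := by rw [← mul_pow]; norm_num
    push_cast
    linarith
  have hmid : |g (dyadicFloor n s') - g (dyadicFloor n s)| ≤ K * r ^ n := by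
    rcases (show ⌊2 ^ n * s'⌋₊ = ⌊2 ^ n * s⌋₊ ∨ ⌊2 ^ n * s'⌋₊ = ⌊2 ^ n * s⌋₊ + 1 by omega) with h | h
    · rw [dyadicFloor, dyadicFloor, h, sub_self, abs_zero]
      exact mul_nonneg hK (pow_nonneg hr.1.le _)
    · have h2 : (⌊2 ^ n * s'⌋₊ : ℝ) ≤ 2 ^ n :=
        (Nat.floor_le h0').trans (mul_le_of_le_one_right (by positivity) hs'.1.2)
      have h3 : ⌊2 ^ n * s'⌋₊ ≤ 2 ^ n := by exact_mod_cast h2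
      rw [dyadicFloor, dyadicFloor, h]
      push_cast
      exact hg n _ (by omega)
  have hA := abs_sub_dyadicFloor_le hr.1 hr.2 hg hs n
  have hB := abs_sub_dyadicFloor_le hr.1 hr.2 hg hs' n
  have hD : 0 ≤ 1 + 2 * (r / (1 - r)) := by
    have : 0 ≤ r / (1 - r) := div_nonneg hr.1.le (by linarith [hr.2])
    positivity
  calc |g s' - g s| ≤ K * r ^ n * (r / (1 - r)) + K * r ^ n + K * r ^ n * (r / (1 - r)) := by
        rw [abs_le] at *
        constructor <;> linarith [hA.1, hA.2, hB.1, hB.2, hmid.1, hmid.2]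
    _ = K * (1 + 2 * (r / (1 - r))) * r ^ n := by ring
    _ ≤ K * (1 + 2 * (r / (1 - r))) * (2 ^ a * (s' - s) ^ a) :=
        mul_le_mul_of_nonneg_left hrn (mul_nonneg hK hD)
    _ = K * chainingConst a * |s - s'| ^ a := by
        rw [abs_sub_comm, abs_of_pos hpos, chainingConst]; ring

/-- A bound on the rectangular increments over dyadic cells. -/
def HasDyadicBound (a b : ℝ) (y : ℝ → ℝ → ℝ) : Prop :=
  ∃ K : ℝ, ∀ m n i j : ℕ, i < 2 ^ m → j < 2 ^ n →
    |rectIncrement y (i / 2 ^ m) ((i + 1) / 2 ^ m) (j / 2 ^ n) ((j + 1) / 2 ^ n)| ≤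
      K * (((1 / 2) ^ a) ^ m * ((1 / 2) ^ b) ^ n)

/-- The one-parameter estimate is used twice: in the first variable for the difference across a
fixed dyadic cell of the second, then in the second variable for the difference between s and s'. -/
theorem HasDyadicBound.exists_rectIncrement_le {a b : ℝ} (ha : 0 < a) (hb : 0 < b)
    {y : ℝ → ℝ → ℝ} (hy : HasDyadicBound a b y) :
    ∃ C : ℝ, 0 ≤ C ∧ ∀ s ∈ dyadics, ∀ s' ∈ dyadics, ∀ t ∈ dyadics, ∀ t' ∈ dyadics,
      |rectIncrement y s s' t t'| ≤ C * (|s - s'| ^ a * |t - t'| ^ b) := by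
  obtain ⟨K, hK⟩ := hy
  have hK0 : 0 ≤ K := by
    have := (abs_nonneg _).trans (hK 0 0 0 0 (by norm_num) (by norm_num))
    simpa using this
  refine ⟨K * chainingConst a * chainingConst b, mul_nonneg (mul_nonneg hK0
    (chainingConst_nonneg ha)) (chainingConst_nonneg hb), fun s hs s' hs' t ht t' ht' => ?_⟩
  have h1 : ∀ n j : ℕ, j < 2 ^ n → |(y s' ((j + 1) / 2 ^ n) - y s ((j + 1) / 2 ^ n)) -
      (y s' (j / 2 ^ n) - y s (j / 2 ^ n))| ≤
      (K * chainingConst a * |s - s'| ^ a) * ((1 / 2) ^ b) ^ n := by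
    intro n j hj
    have := abs_sub_le_of_dyadic ha
      (g := fun u => y u ((j + 1) / 2 ^ n) - y u (j / 2 ^ n)) (K := K * ((1 / 2) ^ b) ^ n)
      (fun m i hi => by
        convert hK m n i j hi hj using 1
        · rw [rectIncrement]; congr 1; ring
        · ring) hs hs'
    convert this using 1
    · congr 1; ring
    · ring
  have h2 := abs_sub_le_of_dyadic hb (g := fun v => y s' v - y s v) h1 ht ht'
  convert h2 using 1
  · rw [rectIncrement]; congr 1; ring
  · ring

/-- Since y vanishes on the axes, y(s',t') - y(s,t) is the sum of the increments over [s,s']×[0,t]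
and [0,s']×[t,t'], and the sides starting at 0 have length at most 1. -/
theorem abs_sub_le_of_rectIncrement_le {a b C : ℝ} (hC : 0 ≤ C) (ha : 0 < a) (hb : 0 < b)
    {y : ℝ → ℝ → ℝ} {S : Set ℝ} (hS : S ⊆ I) (h0 : (0 : ℝ) ∈ S) (hy1 : ∀ s ∈ S, y s 0 = 0)
    (hy2 : ∀ t ∈ S, y 0 t = 0)
    (h : ∀ s ∈ S, ∀ s' ∈ S, ∀ t ∈ S, ∀ t' ∈ S,
      |rectIncrement y s s' t t'| ≤ C * (|s - s'| ^ a * |t - t'| ^ b))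
    {s s' t t' : ℝ} (hs : s ∈ S) (hs' : s' ∈ S) (ht : t ∈ S) (ht' : t' ∈ S) :
    |y s t - y s' t'| ≤ C * (|s - s'| ^ a + |t - t'| ^ b) := by
  have h1 := h s hs s' hs' 0 h0 t ht
  have h2 := h 0 h0 s' hs' t ht t' ht'
  rw [rectIncrement, hy1 s hs, hy1 s' hs'] at h1
  rw [rectIncrement, hy2 t ht, hy2 t' ht'] at h2
  have e1 : |s - s'| ^ a * |0 - t| ^ b ≤ |s - s'| ^ a := by
    refine mul_le_of_le_one_right (Real.rpow_nonneg (abs_nonneg _) _)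
      (Real.rpow_le_one (abs_nonneg _) ?_ hb.le)
    rw [zero_sub, abs_neg, abs_of_nonneg (hS ht).1]
    exact (hS ht).2
  have e2 : |0 - s'| ^ a * |t - t'| ^ b ≤ |t - t'| ^ b := by
    refine mul_le_of_le_one_left (Real.rpow_nonneg (abs_nonneg _) _)
      (Real.rpow_le_one (abs_nonneg _) ?_ ha.le)
    rw [zero_sub, abs_neg, abs_of_nonneg (hS hs').1]
    exact (hS hs').2
  have h1' := h1.trans (mul_le_mul_of_nonneg_left e1 hC)
  have h2' := h2.trans (mul_le_mul_of_nonneg_left e2 hC)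
  rw [mul_add]
  rw [abs_le] at *
  constructor <;> linarith [h1'.1, h1'.2, h2'.1, h2'.2]

/-- Dyadic bounds give a limit along the dyadic approximations. -/
theorem HasDyadicBound.exists_tendsto {a b : ℝ} (ha : 0 < a) (hb : 0 < b) {y : ℝ → ℝ → ℝ}
    (hy : HasDyadicBound a b y) (hy1 : ∀ s ∈ dyadics, y s 0 = 0) (hy2 : ∀ t ∈ dyadics, y 0 t = 0)
    {s t : ℝ} (hs : s ∈ I) (ht : t ∈ I) :
    ∃ z, Tendsto (fun n => y (dyadicFloor n s) (dyadicFloor n t)) atTop (𝓝 z) := by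
  obtain ⟨C, hC, h⟩ := hy.exists_rectIncrement_le ha hb
  refine cauchySeq_tendsto_of_complete ?_
  rw [cauchySeq_iff_tendsto_dist_atTop_0]
  have hd : ∀ {u c : ℝ}, u ∈ I → 0 < c → Tendsto (fun p : ℕ × ℕ =>
      |dyadicFloor p.1 u - dyadicFloor p.2 u| ^ c) atTop (𝓝 0) := by
    intro u c hu hc
    have h1 := cauchySeq_iff_tendsto_dist_atTop_0.1 (tendsto_dyadicFloor hu).cauchySeq
    simpa [Real.dist_eq, Real.zero_rpow hc.ne'] using h1.rpow_const (Or.inr hc.le)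
  refine squeeze_zero (fun _ => dist_nonneg) (fun p => ?_)
    (by simpa using ((hd hs ha).add (hd ht hb)).const_mul C)
  rw [Real.dist_eq]
  exact abs_sub_le_of_rectIncrement_le hC ha hb (fun u hu => hu.1) zero_mem_dyadics hy1 hy2 h
    (dyadicFloor_mem_dyadics hs _) (dyadicFloor_mem_dyadics hs _) (dyadicFloor_mem_dyadics ht _)
    (dyadicFloor_mem_dyadics ht _)

theorem HasDyadicBound.isHolderOnSquare {a b : ℝ} (ha : 0 < a) (hb : 0 < b) {y z : ℝ → ℝ → ℝ}
    (hy : HasDyadicBound a b y) (hy1 : ∀ s ∈ dyadics, y s 0 = 0) (hy2 : ∀ t ∈ dyadics, y 0 t = 0)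
    (hz : ∀ s ∈ I, ∀ t ∈ I,
      Tendsto (fun n => y (dyadicFloor n s) (dyadicFloor n t)) atTop (𝓝 (z s t))) :
    IsHolderOnSquare a b z := by
  obtain ⟨C, hC, h⟩ := hy.exists_rectIncrement_le ha hb
  have h0 : (0 : ℝ) ∈ I := ⟨le_rfl, zero_le_one⟩
  have hz1 : ∀ s ∈ I, z s 0 = 0 := fun s hs => tendsto_nhds_unique (hz s hs 0 h0)
    (tendsto_const_nhds.congr fun n => by
      rw [dyadicFloor_zero, hy1 _ (dyadicFloor_mem_dyadics hs n)])
  have hz2 : ∀ t ∈ I, z 0 t = 0 := fun t ht => tendsto_nhds_unique (hz 0 h0 t ht)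
    (tendsto_const_nhds.congr fun n => by
      rw [dyadicFloor_zero, hy2 _ (dyadicFloor_mem_dyadics ht n)])
  have hrect : ∀ s ∈ I, ∀ s' ∈ I, ∀ t ∈ I, ∀ t' ∈ I,
      |rectIncrement z s s' t t'| ≤ C * (|s - s'| ^ a * |t - t'| ^ b) := by
    intro s hs s' hs' t ht t' ht'
    have hl := ((((hz s' hs' t' ht').sub (hz s hs t' ht')).sub (hz s' hs' t ht)).add
      (hz s hs t ht)).abs
    have hd : ∀ {u u' c : ℝ}, u ∈ I → u' ∈ I → 0 < c → Tendsto (fun n : ℕ =>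
        |dyadicFloor n u - dyadicFloor n u'| ^ c) atTop (𝓝 (|u - u'| ^ c)) :=
      fun hu hu' hc => ((tendsto_dyadicFloor hu).sub (tendsto_dyadicFloor hu')).abs.rpow_const
        (Or.inr hc.le)
    refine le_of_tendsto_of_tendsto' hl (((hd hs hs' ha).mul (hd ht ht' hb)).const_mul C) fun n => ?_
    exact h _ (dyadicFloor_mem_dyadics hs n) _ (dyadicFloor_mem_dyadics hs' n) _
      (dyadicFloor_mem_dyadics ht n) _ (dyadicFloor_mem_dyadics ht' n)
  exact ⟨C, fun s hs s' hs' t ht t' ht' => ⟨hrect s hs s' hs' t ht t' ht',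
    abs_sub_le_of_rectIncrement_le hC ha hb subset_rfl h0 hz1 hz2 hrect hs hs' ht ht'⟩⟩

theorem IsHolderOnSquare.mono {a b a' b' : ℝ} (ha : 0 < a') (hb : 0 < b') (haa : a' ≤ a)
    (hbb : b' ≤ b) {z : ℝ → ℝ → ℝ} (h : IsHolderOnSquare a b z) : IsHolderOnSquare a' b' z := by
  obtain ⟨C, hC⟩ := h
  have hpow : ∀ {u v c c' : ℝ}, u ∈ I → v ∈ I → 0 < c' → c' ≤ c → |u - v| ^ c ≤ |u - v| ^ c' := by
    intro u v c c' hu hv hc hcc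
    have h1 : |u - v| ≤ 1 := abs_sub_le_iff.2 ⟨by linarith [hu.2, hv.1], by linarith [hv.2, hu.1]⟩
    rcases (abs_nonneg (u - v)).eq_or_lt with h0 | h0
    · rw [← h0, Real.zero_rpow hc.ne', Real.zero_rpow (hc.trans_le hcc).ne']
    · exact Real.rpow_le_rpow_of_exponent_ge h0 h1 hcc
  refine ⟨|C|, fun s hs s' hs' t ht t' ht' => ?_⟩
  have h1 := hpow hs hs' ha haa
  have h2 := hpow ht ht' hb hbb
  have n1 : 0 ≤ |s - s'| ^ a := by positivity
  have n2 : 0 ≤ |t - t'| ^ b := by positivity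
  have n3 : 0 ≤ |s - s'| ^ a' := by positivity
  obtain ⟨h3, h4⟩ := hC s hs s' hs' t ht t' ht'
  exact ⟨h3.trans (mul_le_mul (le_abs_self C) (mul_le_mul h1 h2 n2 n3) (mul_nonneg n1 n2)
    (abs_nonneg C)), h4.trans (mul_le_mul (le_abs_self C) (add_le_add h1 h2) (add_nonneg n1 n2)
    (abs_nonneg C))⟩

/-! ### A two-parameter Kolmogorov criterion -/

section Kolmogorov

variable {Ω : Type*} [MeasurableSpace Ω] {P : Measure Ω} {Y : ℝ → ℝ → Ω → ℝ} {H₁ H₂ : ℝ}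

/-- All moments of the rectangular increments are bounded as those of a self-similar Gaussian sheet
with stationary increments. -/
def HasIncrementMoments (H₁ H₂ : ℝ) (Y : ℝ → ℝ → Ω → ℝ) (P : Measure Ω) : Prop :=
  ∀ m : ℕ, ∃ C : ℝ, ∀ a b c d : ℝ, 0 ≤ a → a ≤ b → b ≤ 1 → 0 ≤ c → c ≤ d → d ≤ 1 →
    ∫⁻ ω, ENNReal.ofReal (rectIncrement (fun u v => Y u v ω) a b c d ^ (2 * m)) ∂P ≤
      ENNReal.ofReal (C * ((b - a) ^ (2 * H₁) * (d - c) ^ (2 * H₂)) ^ m)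

theorem measurable_rectIncrement (hY : ∀ s t, Measurable (Y s t)) (a b c d : ℝ) :
    Measurable fun ω => rectIncrement (fun u v => Y u v ω) a b c d := by
  unfold rectIncrement
  exact (((hY b d).sub (hY a d)).sub (hY b c)).add (hY a c)

/-- The 2 counts the doubling of the number of cells at each level; the rest is the decay of the
2m-th moment relative to the target size. A high enough moment wins as soon as a < H. -/
theorem eventually_two_mul_pow_lt_one {H a : ℝ} (h : a < H) :
    ∀ᶠ m : ℕ in atTop, 2 * ((1 / 2 : ℝ) ^ (2 * H) * ((1 / 2 : ℝ) ^ a)⁻¹ ^ 2) ^ m < 1 := by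
  have e : (1 / 2 : ℝ) ^ (2 * H) * ((1 / 2 : ℝ) ^ a)⁻¹ ^ 2 = (1 / 2) ^ (2 * (H - a)) := by
    rw [← Real.rpow_neg (by norm_num), ← Real.rpow_natCast, ← Real.rpow_mul (by norm_num),
      ← Real.rpow_add (by norm_num)]
    congr 1; push_cast; ring
  rw [e]
  have h1 : (1 / 2 : ℝ) ^ (2 * (H - a)) < 1 :=
    Real.rpow_lt_one (by norm_num) (by norm_num) (by linarith)
  have := (tendsto_pow_atTop_nhds_zero_of_lt_one (by positivity) h1).const_mul 2
  rw [mul_zero] at this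
  exact this.eventually (gt_mem_nhds one_pos)

/-- The 2m-th powers of all rescaled dyadic increments, summed over all levels and cells, have
finite expectation, dominated by a double geometric series. The sum is thus almost surely finite and
bounds each of its terms. -/
theorem HasIncrementMoments.ae_hasDyadicBound (hY : ∀ s t, Measurable (Y s t))
    (hmom : HasIncrementMoments H₁ H₂ Y P) {a b : ℝ} (ha : a < H₁) (hb : b < H₂) :
    ∀ᵐ ω ∂P, HasDyadicBound a b fun s t => Y s t ω := by
  obtain ⟨m, hm1, hu, hv⟩ := ((eventually_ge_atTop 1).and
    ((eventually_two_mul_pow_lt_one ha).and (eventually_two_mul_pow_lt_one hb))).exists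
  obtain ⟨C, hC⟩ := hmom m
  set r : ℝ := (1 / 2) ^ a with hr
  set r' : ℝ := (1 / 2) ^ b with hr'
  set w : ℝ := (1 / 2) ^ (2 * H₁) with hw
  set w' : ℝ := (1 / 2) ^ (2 * H₂) with hw'
  have hr0 : 0 < r := by positivity
  have hr0' : 0 < r' := by positivity
  have hw0 : 0 < w := by positivity
  have hw0' : 0 < w' := by positivity
  -- The increment over a cell divided by its target size.
  let x : ℕ × ℕ → ℕ → ℕ → Ω → ℝ := fun p i j ω =>
    rectIncrement (fun s t => Y s t ω) (i / 2 ^ p.1) ((i + 1) / 2 ^ p.1) (j / 2 ^ p.2)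
      ((j + 1) / 2 ^ p.2) * (r⁻¹ ^ p.1 * r'⁻¹ ^ p.2)
  have hx : ∀ p i j, Measurable (x p i j) := fun p i j =>
    (measurable_rectIncrement hY _ _ _ _).mul_const _
  let f : ℕ × ℕ → Ω → ENNReal := fun p ω => ∑ i ∈ Finset.range (2 ^ p.1),
    ∑ j ∈ Finset.range (2 ^ p.2), ENNReal.ofReal (x p i j ω ^ (2 * m))
  have hxm : ∀ p i j, Measurable fun ω => ENNReal.ofReal (x p i j ω ^ (2 * m)) := fun p i j =>
    ((hx p i j).pow_const _).ennreal_ofReal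
  have hf : ∀ p, Measurable (f p) := fun p =>
    Finset.measurable_sum _ fun i _ => Finset.measurable_sum _ fun j _ => hxm p i j
  have hcell : ∀ (p : ℕ × ℕ) (i j : ℕ), i < 2 ^ p.1 → j < 2 ^ p.2 →
      ∫⁻ ω, ENNReal.ofReal (x p i j ω ^ (2 * m)) ∂P ≤
        ENNReal.ofReal (C * (((w * r⁻¹ ^ 2) ^ m) ^ p.1 * ((w' * r'⁻¹ ^ 2) ^ m) ^ p.2)) := by
    intro p i j hi hj
    have hk : 0 ≤ (r⁻¹ ^ p.1 * r'⁻¹ ^ p.2) ^ (2 * m) := by positivity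
    have hdy : ∀ {k n : ℕ}, k < 2 ^ n → (0 : ℝ) ≤ k / 2 ^ n ∧ (k : ℝ) / 2 ^ n ≤ (k + 1) / 2 ^ n ∧
        ((k : ℝ) + 1) / 2 ^ n ≤ 1 ∧ ((k : ℝ) + 1) / 2 ^ n - k / 2 ^ n = (1 / 2) ^ n := by
      intro k n hkn
      refine ⟨by positivity, by gcongr; linarith, ?_, ?_⟩
      · rw [div_le_one (by positivity)]
        exact_mod_cast hkn
      · rw [← sub_div, add_sub_cancel_left, one_div_pow]
    obtain ⟨i1, i2, i3, i4⟩ := hdy hi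
    obtain ⟨j1, j2, j3, j4⟩ := hdy hj
    have h := hC _ _ _ _ i1 i2 i3 j1 j2 j3
    have hpw : ∀ (H : ℝ) (n : ℕ), ((1 / 2 : ℝ) ^ n) ^ (2 * H) = ((1 / 2 : ℝ) ^ (2 * H)) ^ n :=
      fun H n => by
        rw [← Real.rpow_natCast, ← Real.rpow_natCast, ← Real.rpow_mul (by norm_num),
          ← Real.rpow_mul (by norm_num), mul_comm]
    rw [i4, j4, hpw, hpw] at h
    simp only [x, mul_pow _ (r⁻¹ ^ p.1 * r'⁻¹ ^ p.2)]
    calc _ = ∫⁻ ω, ENNReal.ofReal ((r⁻¹ ^ p.1 * r'⁻¹ ^ p.2) ^ (2 * m)) *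
            ENNReal.ofReal (rectIncrement (fun s t => Y s t ω) (i / 2 ^ p.1) ((i + 1) / 2 ^ p.1)
              (j / 2 ^ p.2) ((j + 1) / 2 ^ p.2) ^ (2 * m)) ∂P := by
          refine lintegral_congr fun ω => ?_
          rw [← ENNReal.ofReal_mul hk, mul_comm]
      _ ≤ ENNReal.ofReal ((r⁻¹ ^ p.1 * r'⁻¹ ^ p.2) ^ (2 * m)) *
            ENNReal.ofReal (C * (w ^ p.1 * w' ^ p.2) ^ m) := by
          rw [lintegral_const_mul _
            ((measurable_rectIncrement hY _ _ _ _).pow_const _).ennreal_ofReal]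
          gcongr
      _ = _ := by
          rw [← ENNReal.ofReal_mul hk]
          congr 1
          simp only [mul_pow, ← pow_mul]
          rw [show p.1 * (2 * m) = 2 * m * p.1 by ring, show p.2 * (2 * m) = 2 * m * p.2 by ring,
            mul_comm p.1 m, mul_comm p.2 m]
          ring
  set u : ℝ := 2 * (w * r⁻¹ ^ 2) ^ m with hudef
  set v : ℝ := 2 * (w' * r'⁻¹ ^ 2) ^ m with hvdef
  have hu0 : 0 ≤ u := by positivity
  have hv0 : 0 ≤ v := by positivity
  have hint : ∀ p, ∫⁻ ω, f p ω ∂P ≤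
      ENNReal.ofReal C * (ENNReal.ofReal u ^ p.1 * ENNReal.ofReal v ^ p.2) := by
    intro p
    simp only [f]
    rw [lintegral_finsetSum _ fun i _ => Finset.measurable_sum _ fun j _ => hxm p i j]
    calc _ ≤ ∑ i ∈ Finset.range (2 ^ p.1), ∑ j ∈ Finset.range (2 ^ p.2),
            ENNReal.ofReal (C * (((w * r⁻¹ ^ 2) ^ m) ^ p.1 * ((w' * r'⁻¹ ^ 2) ^ m) ^ p.2)) := by
          refine Finset.sum_le_sum fun i hi => ?_
          rw [lintegral_finsetSum _ fun j _ => hxm p i j]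
          exact Finset.sum_le_sum fun j hj => hcell p i j (Finset.mem_range.1 hi)
            (Finset.mem_range.1 hj)
      _ = _ := by
          have h2 : ∀ n : ℕ, ((2 ^ n : ℕ) : ENNReal) = ENNReal.ofReal (2 ^ n) := fun n => by
            rw [← ENNReal.ofReal_natCast]; push_cast; rfl
          simp only [Finset.sum_const, Finset.card_range, nsmul_eq_mul, h2]
          rw [← ENNReal.ofReal_mul (by positivity), ← ENNReal.ofReal_mul (by positivity),
            ← ENNReal.ofReal_pow hu0, ← ENNReal.ofReal_pow hv0,
            ← ENNReal.ofReal_mul (pow_nonneg hu0 _),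
            ← ENNReal.ofReal_mul' (mul_nonneg (pow_nonneg hu0 _) (pow_nonneg hv0 _))]
          congr 1
          rw [hudef, hvdef, mul_pow, mul_pow]
          ring
  have hsum : ∫⁻ ω, ∑' p, f p ω ∂P ≠ ⊤ := by
    rw [lintegral_tsum fun p => (hf p).aemeasurable]
    refine ne_top_of_le_ne_top ?_ (ENNReal.tsum_le_tsum hint)
    rw [ENNReal.tsum_mul_left,
      ENNReal.tsum_prod (f := fun i j => ENNReal.ofReal u ^ i * ENNReal.ofReal v ^ j)]
    simp only [ENNReal.tsum_mul_left, ENNReal.tsum_mul_right, ENNReal.tsum_geometric]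
    have hg : ∀ {z : ℝ}, z < 1 → (1 - ENNReal.ofReal z)⁻¹ ≠ ⊤ := fun hz => by
      rw [ENNReal.inv_ne_top, ← pos_iff_ne_zero, tsub_pos_iff_lt]
      exact ENNReal.ofReal_lt_one.2 hz
    exact ENNReal.mul_ne_top ENNReal.ofReal_ne_top (ENNReal.mul_ne_top (hg hu) (hg hv))
  filter_upwards [ae_lt_top (Measurable.tsum hf) hsum] with ω hω
  -- Adding 1 avoids taking a root: |x| ≤ 1, or |x| ≤ |x|^{2m} as m ≥ 1.
  refine ⟨1 + (∑' p, f p ω).toReal, fun M N i j hi hj => ?_⟩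
  have h1 : ENNReal.ofReal (x (M, N) i j ω ^ (2 * m)) ≤ ∑' p, f p ω :=
    calc _ ≤ ∑ j ∈ Finset.range (2 ^ N), ENNReal.ofReal (x (M, N) i j ω ^ (2 * m)) :=
          Finset.single_le_sum (f := fun j => ENNReal.ofReal (x (M, N) i j ω ^ (2 * m)))
            (fun _ _ => zero_le) (Finset.mem_range.2 hj)
      _ ≤ f (M, N) ω := Finset.single_le_sum (f := fun i => ∑ j ∈ Finset.range (2 ^ N),
            ENNReal.ofReal (x (M, N) i j ω ^ (2 * m))) (fun _ _ => zero_le) (Finset.mem_range.2 hi)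
      _ ≤ _ := ENNReal.le_tsum (f := fun p => f p ω) (M, N)
  have h2 : x (M, N) i j ω ^ (2 * m) ≤ (∑' p, f p ω).toReal :=
    (ENNReal.ofReal_le_iff_le_toReal hω.ne).1 h1
  have h3 : |x (M, N) i j ω| ≤ 1 + (∑' p, f p ω).toReal := by
    rcases le_total |x (M, N) i j ω| 1 with h | h
    · linarith [ENNReal.toReal_nonneg (a := ∑' p, f p ω)]
    · have := le_self_pow₀ h (show 2 * m ≠ 0 by omega)
      rw [(even_two_mul m).pow_abs] at this
      linarith
  simp only [x] at h3
  rw [abs_mul, abs_of_pos (by positivity : 0 < r⁻¹ ^ M * r'⁻¹ ^ N), inv_pow, inv_pow, ← mul_inv,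
    ← div_eq_mul_inv, div_le_iff₀ (by positivity)] at h3
  exact h3

/-- The second moments are summable, so the squares of the increments are almost surely summable. It
serves to identify the limit along dyadic approximations with the original process. -/
theorem HasIncrementMoments.ae_tendsto_zero (hY : ∀ s t, Measurable (Y s t))
    (hmom : HasIncrementMoments H₁ H₂ Y P) {H : ℝ} (hH : 0 < H) {a b c d : ℕ → ℝ}
    (ha : ∀ n, 0 ≤ a n) (hab : ∀ n, a n ≤ b n) (hb : ∀ n, b n ≤ 1) (hc : ∀ n, 0 ≤ c n)
    (hcd : ∀ n, c n ≤ d n) (hd : ∀ n, d n ≤ 1)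
    (hle : ∀ n, (b n - a n) ^ (2 * H₁) * (d n - c n) ^ (2 * H₂) ≤ ((1 / 2) ^ n) ^ (2 * H)) :
    ∀ᵐ ω ∂P, Tendsto (fun n => rectIncrement (fun u v => Y u v ω) (a n) (b n) (c n) (d n)) atTop
      (𝓝 0) := by
  obtain ⟨C, hC⟩ := hmom 1
  let f : ℕ → Ω → ENNReal := fun n ω => ENNReal.ofReal
    (rectIncrement (fun u v => Y u v ω) (a n) (b n) (c n) (d n) ^ (2 * 1))
  have hf : ∀ n, Measurable (f n) := fun n =>
    ((measurable_rectIncrement hY _ _ _ _).pow_const _).ennreal_ofReal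
  have hsum : ∫⁻ ω, ∑' n, f n ω ∂P ≠ ⊤ := by
    rw [lintegral_tsum fun p => (hf p).aemeasurable]
    have hint : ∀ n, ∫⁻ ω, f n ω ∂P ≤
        ENNReal.ofReal |C| * ENNReal.ofReal ((1 / 2) ^ (2 * H)) ^ n := fun n => by
      refine (hC _ _ _ _ (ha n) (hab n) (hb n) (hc n) (hcd n) (hd n)).trans ?_
      rw [← ENNReal.ofReal_pow (by positivity), ← ENNReal.ofReal_mul (abs_nonneg _), pow_one]
      refine ENNReal.ofReal_le_ofReal ?_
      have hpw : ((1 / 2 : ℝ) ^ (2 * H)) ^ n = ((1 / 2 : ℝ) ^ n) ^ (2 * H) := by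
        rw [← Real.rpow_natCast, ← Real.rpow_natCast, ← Real.rpow_mul (by norm_num),
          ← Real.rpow_mul (by norm_num), mul_comm]
      rw [hpw]
      have h0 : 0 ≤ (b n - a n) ^ (2 * H₁) * (d n - c n) ^ (2 * H₂) :=
        mul_nonneg (Real.rpow_nonneg (sub_nonneg.2 (hab n)) _)
          (Real.rpow_nonneg (sub_nonneg.2 (hcd n)) _)
      exact mul_le_mul (le_abs_self C) (hle n) h0 (abs_nonneg C)
    refine ne_top_of_le_ne_top ?_ (ENNReal.tsum_le_tsum hint)
    rw [ENNReal.tsum_mul_left, ENNReal.tsum_geometric]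
    refine ENNReal.mul_ne_top ENNReal.ofReal_ne_top ?_
    rw [ENNReal.inv_ne_top, ← pos_iff_ne_zero, tsub_pos_iff_lt]
    exact ENNReal.ofReal_lt_one.2 (Real.rpow_lt_one (by norm_num) (by norm_num) (by positivity))
  filter_upwards [ae_lt_top (Measurable.tsum hf) hsum] with ω hω
  have h := (ENNReal.continuousAt_toReal ENNReal.zero_ne_top).tendsto.comp
    (ENNReal.tendsto_atTop_zero_of_tsum_ne_top hω.ne)
  have h2 : Tendsto (fun n => rectIncrement (fun u v => Y u v ω) (a n) (b n) (c n) (d n) ^ 2) atTop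
      (𝓝 0) := by
    simpa [f, Function.comp_def, ENNReal.toReal_ofReal, sq_nonneg] using h
  have h3 := h2.sqrt
  simp only [Real.sqrt_sq_eq_abs, Real.sqrt_zero] at h3
  exact (tendsto_zero_iff_abs_tendsto_zero _).2 h3

/-- Kolmogorov's criterion for sheets that vanish on the axes. -/
theorem HasIncrementMoments.exists_modification (hY : ∀ s t, Measurable (Y s t))
    (hmom : HasIncrementMoments H₁ H₂ Y P) (hH₁ : 0 < H₁) (hH₂ : 0 < H₂)
    (h1 : ∀ s ∈ I, Y s 0 =ᵐ[P] 0) (h2 : ∀ t ∈ I, Y 0 t =ᵐ[P] 0) :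
    ∃ Z : ℝ → ℝ → Ω → ℝ, (∀ s ∈ I, ∀ t ∈ I, Measurable (Z s t) ∧ Z s t =ᵐ[P] Y s t) ∧
      ∀ ω, ∀ a ∈ Ioo 0 H₁, ∀ b ∈ Ioo 0 H₂, IsHolderOnSquare a b fun s t => Z s t ω := by
  -- Rational exponents are countably many, so a single null set serves for all (a,b).
  have hgood : ∀ᵐ ω ∂P, (∀ s ∈ dyadics, Y s 0 ω = 0) ∧ (∀ t ∈ dyadics, Y 0 t ω = 0) ∧
      ∀ p : ℚ × ℚ, (p.1 : ℝ) < H₁ → (p.2 : ℝ) < H₂ → HasDyadicBound p.1 p.2 fun s t => Y s t ω := by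
    refine ((ae_ball_iff countable_dyadics).2 fun s hs => h1 s hs.1).and
      (((ae_ball_iff countable_dyadics).2 fun t ht => h2 t ht.1).and (ae_all_iff.2 fun p => ?_))
    by_cases hp : (p.1 : ℝ) < H₁ ∧ (p.2 : ℝ) < H₂
    · filter_upwards [hmom.ae_hasDyadicBound hY hp.1 hp.2] with ω hω _ _ using hω
    · exact ae_of_all _ fun ω k1 k2 => absurd ⟨k1, k2⟩ hp
  obtain ⟨N, hN, hNm, hN0⟩ := exists_measurable_superset_of_null hgood
  have hG : ∀ ω ∉ N, (∀ s ∈ dyadics, Y s 0 ω = 0) ∧ (∀ t ∈ dyadics, Y 0 t ω = 0) ∧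
      ∀ p : ℚ × ℚ, (p.1 : ℝ) < H₁ → (p.2 : ℝ) < H₂ → HasDyadicBound p.1 p.2 fun s t => Y s t ω :=
    fun ω hω => by_contra fun h => hω (hN h)
  obtain ⟨a₀, ha₀, ha₀'⟩ := exists_rat_btwn hH₁
  obtain ⟨b₀, hb₀, hb₀'⟩ := exists_rat_btwn hH₂
  -- The modification is the limit along dyadic approximations off the null set, and 0 on it, so
  -- that the path property holds for every ω.
  have hlim : ∀ s t ω, ∃ z : ℝ, s ∈ I → t ∈ I → (ω ∈ N → z = 0) ∧ (ω ∉ N →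
      Tendsto (fun n => Y (dyadicFloor n s) (dyadicFloor n t) ω) atTop (𝓝 z)) := by
    intro s t ω
    by_cases h : s ∈ I ∧ t ∈ I ∧ ω ∉ N
    · obtain ⟨g1, g2, g3⟩ := hG ω h.2.2
      obtain ⟨z, hz⟩ := (g3 (a₀, b₀) ha₀' hb₀').exists_tendsto ha₀ hb₀ g1 g2 h.1 h.2.1
      exact ⟨z, fun _ _ => ⟨fun hω => absurd hω h.2.2, fun _ => hz⟩⟩
    · exact ⟨0, fun hs ht => ⟨fun _ => rfl, fun hω => absurd ⟨hs, ht, hω⟩ h⟩⟩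
  choose Z hZ using hlim
  refine ⟨Z, fun s hs t ht => ⟨?_, ?_⟩, fun ω a ha b hb => ?_⟩
  · refine measurable_of_tendsto_metrizable (f := fun n =>
      Nᶜ.indicator (Y (dyadicFloor n s) (dyadicFloor n t)))
      (fun n => (hY _ _).indicator hNm.compl) (tendsto_pi_nhds.2 fun ω => ?_)
    by_cases hω : ω ∈ N
    · simp [indicator, hω, (hZ s t ω hs ht).1 hω]
    · simpa [indicator, hω] using (hZ s t ω hs ht).2 hω
  · have hfl := fun {u : ℝ} (hu : u ∈ I) n => dyadicFloor_mem hu n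
    have hpow : ∀ {x H : ℝ}, x ∈ I → 0 < H → x ^ (2 * H) ≤ 1 := fun hx hH =>
      Real.rpow_le_one hx.1 hx.2 (by positivity)
    -- With s_n, t_n the dyadic floors, Y(s,t) - Y(s_n,t_n) is almost surely the sum of the
    -- increments over [s_n,s]×[0,t] and [0,s_n]×[t_n,t]; both tend to 0.
    have t1 := hmom.ae_tendsto_zero hY hH₁ (a := fun n => dyadicFloor n s) (b := fun _ => s)
      (c := fun _ => 0) (d := fun _ => t) (fun n => (hfl hs n).1) (fun n => dyadicFloor_le hs.1 n)
      (fun _ => hs.2) (fun _ => le_rfl) (fun _ => ht.1) (fun _ => ht.2) (fun n => by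
        have h3 : 0 ≤ s - dyadicFloor n s := sub_nonneg.2 (dyadicFloor_le hs.1 n)
        rw [sub_zero]
        exact (mul_le_of_le_one_right (Real.rpow_nonneg h3 _) (hpow ht hH₂)).trans
          (Real.rpow_le_rpow h3 (sub_dyadicFloor_le s n) (by positivity)))
    have t2 := hmom.ae_tendsto_zero hY hH₂ (a := fun _ => 0) (b := fun n => dyadicFloor n s)
      (c := fun n => dyadicFloor n t) (d := fun _ => t) (fun _ => le_rfl) (fun n => (hfl hs n).1)
      (fun n => (hfl hs n).2) (fun n => (hfl ht n).1) (fun n => dyadicFloor_le ht.1 n)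
      (fun _ => ht.2) (fun n => by
        have h3 : 0 ≤ t - dyadicFloor n t := sub_nonneg.2 (dyadicFloor_le ht.1 n)
        rw [sub_zero]
        exact (mul_le_of_le_one_left (Real.rpow_nonneg h3 _) (hpow (hfl hs n) hH₁)).trans
          (Real.rpow_le_rpow h3 (sub_dyadicFloor_le t n) (by positivity)))
    have hNae : ∀ᵐ ω ∂P, ω ∉ N := measure_eq_zero_iff_ae_notMem.1 hN0
    filter_upwards [hNae, t1, t2, h1 s hs, h2 t ht] with ω hω k1 k2 k3 k4
    obtain ⟨g1, g2, -⟩ := hG ω hω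
    have h3 := (k1.add k2).const_sub (Y s t ω)
    refine tendsto_nhds_unique ((hZ s t ω hs ht).2 hω) ?_
    rw [add_zero, sub_zero] at h3
    refine h3.congr fun n => ?_
    simp only [rectIncrement, k3, k4, g1 _ (dyadicFloor_mem_dyadics hs n),
      g2 _ (dyadicFloor_mem_dyadics ht n), Pi.zero_apply]
    ring
  · by_cases hω : ω ∈ N
    · refine ⟨0, fun s hs s' hs' t ht t' ht' => ?_⟩
      simp [rectIncrement, (hZ s t ω hs ht).1 hω, (hZ s' t ω hs' ht).1 hω,
        (hZ s t' ω hs ht').1 hω, (hZ s' t' ω hs' ht').1 hω]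
    · obtain ⟨g1, g2, g3⟩ := hG ω hω
      obtain ⟨a', ha1, ha2⟩ := exists_rat_btwn ha.2
      obtain ⟨b', hb1, hb2⟩ := exists_rat_btwn hb.2
      exact ((g3 (a', b') ha2 hb2).isHolderOnSquare (ha.1.trans ha1) (hb.1.trans hb1) g1 g2
        fun s hs t ht => (hZ s t ω hs ht).2 hω).mono ha.1 hb.1 ha1.le hb1.le

end Kolmogorov

/-! ### The Hermite sheet -/

section Main

variable {Ω : Type*} [MeasurableSpace Ω] {P : Measure Ω} [IsProbabilityMeasure P] {α β : Hurst}
  {W : ℝ → ℝ → Ω → ℝ} (hW : IsFractionalBrownianSheet α β W P) {q : ℕ} (hq : 1 ≤ q)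
  (hα : 1 - 1 / (2 * (q : ℝ)) < α) (hβ : 1 - 1 / (2 * (q : ℝ)) < β)
  {Z : ℝ → ℝ → Ω → ℝ} (hZ : IsHermiteSheet α β q W P Z)

include hW hq hα hβ hZ

/-- On the axes the second moment vanishes. -/
theorem IsHermiteSheet.ae_eq_zero {s t : ℝ} (hs : s ∈ I) (ht : t ∈ I) (h : s = 0 ∨ t = 0) :
    Z s t =ᵐ[P] 0 := by
  have h0 : ∫ ω, Z s t ω * Z s t ω ∂P = 0 := by
    rw [hZ.integral_mul hW hq hα hβ hs ht hs ht]
    rcases h with rfl | rfl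
    · rw [fbmCov_zero_left (hermiteHurst_mem hq hα α.2.2).1 le_rfl, zero_mul]
    · rw [fbmCov_zero_left (hermiteHurst_mem hq hβ β.2.2).1 le_rfl, mul_zero]
  have hL := (hZ.memLp_integral hW hq hα hβ hs ht).1
  rw [integral_eq_zero_iff_of_nonneg (fun ω => mul_self_nonneg _) (hL.integrable_mul hL)] at h0
  filter_upwards [h0] with ω hω
  exact mul_self_eq_zero.1 hω

theorem IsHermiteSheet.covariance_eq {s t u v : ℝ} (hs : s ∈ I) (ht : t ∈ I) (hu : u ∈ I)
    (hv : v ∈ I) : cov[Z s t, Z u v; P] =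
      fbmCov (q * ((α : ℝ) - 1) + 1) s u * fbmCov (q * ((β : ℝ) - 1) + 1) t v := by
  obtain ⟨h1, h1'⟩ := hZ.memLp_integral hW hq hα hβ hs ht
  obtain ⟨h2, h2'⟩ := hZ.memLp_integral hW hq hα hβ hu hv
  rw [covariance_eq_sub h1 h2, h1', h2', mul_zero, sub_zero]
  exact hZ.integral_mul hW hq hα hβ hs ht hu hv

omit [IsProbabilityMeasure P] hq hα hβ hZ in
theorem IsFractionalBrownianSheet.covariance_eq [IsProbabilityMeasure P] {s t u v : ℝ} (hs : s ∈ I)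
    (ht : t ∈ I) (hu : u ∈ I) (hv : v ∈ I) :
    cov[W s t, W u v; P] = fbmCov α s u * fbmCov β t v := by
  rw [covariance_eq_sub (hW.memLp (⟨s, hs⟩, ⟨t, ht⟩)) (hW.memLp (⟨u, hu⟩, ⟨v, hv⟩)),
    hW.centered s hs t ht, zero_mul, sub_zero]
  exact hW.covariance s hs t ht u hu v hv

theorem IsHermiteSheet.exists_holder_modification :
    ∃ Z' : ℝ → ℝ → Ω → ℝ, (∀ s ∈ I, ∀ t ∈ I, Measurable (Z' s t) ∧ Z' s t =ᵐ[P] Z s t) ∧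
      ∀ ω, ∀ a ∈ Ioo (0 : ℝ) (q * ((α : ℝ) - 1) + 1), ∀ b ∈ Ioo (0 : ℝ) (q * ((β : ℝ) - 1) + 1),
        IsHolderOnSquare a b fun s t => Z' s t ω := by
  -- Kolmogorov's criterion needs genuinely measurable variables. Measurable versions still form a
  -- Hermite sheet, since the definition only sees classes modulo null sets.
  have hY : ∀ s t : ℝ, ∃ Y : Ω → ℝ, Measurable Y ∧ (s ∈ I → t ∈ I → Y =ᵐ[P] Z s t) := fun s t => by
    by_cases h : s ∈ I ∧ t ∈ I
    · have hm := (hZ.memLp_integral hW hq hα hβ h.1 h.2).1.aestronglyMeasurable.aemeasurable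
      exact ⟨hm.mk _, hm.measurable_mk, fun _ _ => hm.ae_eq_mk.symm⟩
    · exact ⟨0, measurable_const, fun hs ht => absurd ⟨hs, ht⟩ h⟩
  choose Y hYm hYZ using hY
  have hYh : IsHermiteSheet α β q W P Y := fun s hs t ht => by
    obtain ⟨μ, F, h1, h2, h3⟩ := hZ s hs t ht
    exact ⟨μ, F, h1, h2, (hYZ s t hs ht).trans h3⟩
  have h0 : (0 : ℝ) ∈ I := ⟨le_rfl, zero_le_one⟩
  have hmom : HasIncrementMoments (q * ((α : ℝ) - 1) + 1) (q * ((β : ℝ) - 1) + 1) Y P := fun m =>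
    ⟨_, fun a b c d ha hab hb hc hcd hd =>
      hYh.lintegral_rectIncrement_pow_le hW hq hα hβ m ha hab hb hc hcd hd⟩
  obtain ⟨Z', h1, h2⟩ := hmom.exists_modification hYm (hermiteHurst_mem hq hα α.2.2).1
    (hermiteHurst_mem hq hβ β.2.2).1
    (fun s hs => hYh.ae_eq_zero hW hq hα hβ hs h0 (Or.inr rfl))
    (fun t ht => hYh.ae_eq_zero hW hq hα hβ h0 ht (Or.inl rfl))
  exact ⟨Z', fun s hs t ht => ⟨(h1 s hs t ht).1, (h1 s hs t ht).2.trans (hYZ s t hs ht)⟩, h2⟩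

end Main

end HermiteSheet

end

theorem mainTheorem3 {Ω : Type*} [MeasurableSpace Ω] (P : MeasureTheory.Measure Ω)
    [MeasureTheory.IsProbabilityMeasure P] (q : ℕ) (hq : 1 ≤ q) (α β : HermiteSheet.Hurst)
    (hα : 1 - 1 / (2 * (q : ℝ)) < α) (hβ : 1 - 1 / (2 * (q : ℝ)) < β)
    (W : ℝ → ℝ → Ω → ℝ) (hW : HermiteSheet.IsFractionalBrownianSheet α β W P) :
    -- the Hermite sheet exists
    (∃ Z : ℝ → ℝ → Ω → ℝ, HermiteSheet.IsHermiteSheet α β q W P Z) ∧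
    ∀ Z : ℝ → ℝ → Ω → ℝ, HermiteSheet.IsHermiteSheet α β q W P Z →
      -- a) it is centered, square integrable, with the stated covariance
      (∀ s ∈ I, ∀ t ∈ I, MemLp (Z s t) 2 P ∧ ∫ ω, Z s t ω ∂P = 0) ∧
      (∀ s ∈ I, ∀ t ∈ I, ∀ u ∈ I, ∀ v ∈ I,
        ∫ ω, Z s t ω * Z u v ω ∂P =
          HermiteSheet.fbmCov (q * ((α : ℝ) - 1) + 1) s u *
            HermiteSheet.fbmCov (q * ((β : ℝ) - 1) + 1) t v) ∧
      -- which is that of any fractional Brownian sheet with these (admissible) Hurst indices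
      ((q * ((α : ℝ) - 1) + 1 ∈ Ioo (0 : ℝ) 1 ∧ q * ((β : ℝ) - 1) + 1 ∈ Ioo (0 : ℝ) 1) ∧
        ∀ (Ω' : Type*) [MeasurableSpace Ω'] (P' : Measure Ω') [IsProbabilityMeasure P']
          (B : ℝ → ℝ → Ω' → ℝ),
          HermiteSheet.IsFractionalBrownianSheet (q * ((α : ℝ) - 1) + 1) (q * ((β : ℝ) - 1) + 1)
            B P' →
          ∀ s ∈ I, ∀ t ∈ I, ∀ u ∈ I, ∀ v ∈ I,
            cov[Z s t, Z u v; P] = cov[B s t, B u v; P']) ∧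
      -- b) self-similarity
      HermiteSheet.IsSelfSimilar (q * ((α : ℝ) - 1) + 1) (q * ((β : ℝ) - 1) + 1) Z P ∧
      -- c) stationary increments
      HermiteSheet.HasStationaryIncrements Z P ∧
      -- d) a modification has paths that are Hölder continuous of every order below the
      -- self-similarity indices
      ∃ Z' : ℝ → ℝ → Ω → ℝ,
        (∀ s ∈ I, ∀ t ∈ I, Measurable (Z' s t) ∧ Z' s t =ᵐ[P] Z s t) ∧
        ∀ ω, ∀ a ∈ Ioo (0 : ℝ) (q * ((α : ℝ) - 1) + 1),
          ∀ b ∈ Ioo (0 : ℝ) (q * ((β : ℝ) - 1) + 1),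
            HermiteSheet.IsHolderOnSquare a b fun s t => Z' s t ω := by
  have hH₁ := HermiteSheet.hermiteHurst_mem hq hα α.2.2
  have hH₂ := HermiteSheet.hermiteHurst_mem hq hβ β.2.2
  refine ⟨HermiteSheet.exists_isHermiteSheet hW hq hα hβ, fun Z hZ => ?_⟩
  refine ⟨fun s hs t ht => hZ.memLp_integral hW hq hα hβ hs ht,
    fun s hs t ht u hu v hv => hZ.integral_mul hW hq hα hβ hs ht hu hv, ⟨⟨hH₁, hH₂⟩, ?_⟩,
    hZ.isSelfSimilar hW hq hα hβ, hZ.hasStationaryIncrements hW hq hα hβ,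
    hZ.exists_holder_modification hW hq hα hβ⟩
  intro Ω' _ P' _ B hB s hs t ht u hu v hv
  rw [hZ.covariance_eq hW hq hα hβ hs ht hu hv]
  exact (HermiteSheet.IsFractionalBrownianSheet.covariance_eq (α := ⟨_, hH₁⟩) (β := ⟨_, hH₂⟩)
    hB hs ht hu hv).symm
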